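/- Let $\mathbb F_q$ be a finite field of odd characteristic $p$, and let $\psi$ be a non-trivial additive character of $\mathbb F_p$. **Families.** For $d\ge 0$ let $\mathcal S_d$ be the space of homogeneous polynomials of degree $d$ in $\mathbb F_q[X,Z]$, together with $0$. Let $\mathcal F_d$ be one of the following sets of pairs $f=(g,h)$, where $f$ is regarded as the rational function $g/h$ on $\mathbb P^1$: * the full family $\{(g,h): g,h\in\mathcal S_d,\ (g,h)=1\}$; * the ordinary family, in which moreover $h$ is square-free; * a non-empty family of prescribed factorization type, in which $(g,h)=1$ and, up to a nonzero constant, $h=P_1^{e_1}\cdots P_n^{e_n}$ with $P_1,\dots,P_n\in\mathbb F_q[X,Z]$ irreducible homogeneous, pairwise non-proportional, $\deg P_t=r_t$, where $e_t\ge 1$ and $d=\sum_t r_te_t$. Here $n$ and $r_1,\dots,r_n$ are fixed, while the exponents $e_t$ vary with $d$. Write $\langle G\rangle=\frac1{|\mathcal F_d|}\sum_{f\in\mathcal F_d}G(f)$. **Sums.** For $k\ge1$ and an additive character $\chi$ of $\mathbb F_p$ put $$S_k(f,\chi)=\sum_{x\in\mathbb P^1(\mathbb F_{q^k}),\ f(x)\ne\infty}\chi(\mathrm{tr}_{\mathbb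 F_{q^k}/\mathbb F_p}f(x)).$$ Let $\mathcal I=[-\beta/2,\beta/2]$ with $0<\beta=|\mathcal I|<1$, let $K\ge1$ be an integer, and let $I_K^{\pm}$ be the Beurling–Selberg majorant ($+$) and minorant ($-$) of the indicator function of $\mathcal I$ of degree $\le K$, that is, $$I_K^+(x)=\beta+B_K(x-\tfrac\beta2)+B_K(-\tfrac\beta2-x),\qquad I_K^-(x)=\beta-B_K(\tfrac\beta2-x)-B_K(x+\tfrac\beta2),$$ where $B_K$ is Beurling's polynomial $$B_K(x)=-\sum_{k=1}^K J\!\left(\tfrac k{K+1}\right)\frac{\sin 2\pi kx}{\pi k}+\frac1{2(K+1)}\sum_{|k|\le K}\left(1-\tfrac{|k|}{K+1}\right)e^{2\pi ikx},\qquad J(u)=\pi u(1-u)\cot(\pi u)+u .$$ With $\widehat I(k)=\int_{-1/2}^{1/2}I(\theta)e^{-2\pi ik\theta}\,d\theta$ put $$S^\pm(K,f,\chi)=\sum_{k=1}^K\frac{\widehat I_K^\pm(k)S_k(f,\chi)+\widehat I_K^\pm(-k)S_k(f,\bar\chi)}{q^{k/2}},\qquad S^\pm(K,C_f)=\sum_{h=1}^{p-1}S^\pm(K,f,\psi^h).$$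 **Theorem.** Let $\beta_0<1$. For all integers $1\le h_1,h_2\le(p-1)/2$ and all $d$, $K$, $\mathcal I$ with $|\mathcal I|\le\beta_0$ and $1/|\mathcal I|<K<d/6$, $$\langle S^\pm(K,f,\psi^{h_1})S^\pm(K,f,\psi^{h_2})\rangle=\langle S^\pm(K,f,\psi^{h_1})S^\mp(K,f,\psi^{h_2})\rangle=\begin{cases}\frac1{\pi^2}\log(K|\mathcal I|)+O(1)&h_1=h_2,\\ O(1)&h_1\ne h_2,\end{cases}$$ and $$\langle S^\pm(K,C_f)^2\rangle=\langle S^+(K,C_f)S^-(K,C_f)\rangle=\frac{2(p-1)}{\pi^2}\log(K|\mathcal I|)+O(1).$$ The implied constants depend only on $\mathbb F_q$, on $\beta_0$ and on the kind of family (for prescribed factorization types, on $n$ and $r_1,\dots,r_n$), but not on $\psi$, $d$, the exponents $e_t$, $K$ or $\mathcal I$. -/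

import Mathlib

open scoped LinearAlgebra.Projectivization

noncomputable section

namespace ArtinSchreier

/-! ### Binary forms and the families of covers -/

/-- Pairs `(g, h)` of polynomials in `F[X, Z]`, standing for `f = g / h`
(`X` is the variable `0` and `Z` is the variable `1`). -/
abbrev FormPair (F : Type*) [Field F] : Type _ :=
  MvPolynomial (Fin 2) F × MvPolynomial (Fin 2) F

/-- All pairs of forms of degree `d` without common factor. -/
def fullFamily (F : Type*) [Field F] (d : ℕ) : Set (FormPair F) :=
  {f | f.1.IsHomogeneous d ∧ f.2.IsHomogeneous d ∧ IsRelPrime f.1 f.2}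

/-- The ordinary family: moreover `h` is square-free. -/
def ordFamily (F : Type*) [Field F] (d : ℕ) : Set (FormPair F) :=
  {f | f ∈ fullFamily F d ∧ Squarefree f.2}

/-- `h` has factorization type `(r₁^{e₁}, …, rₙ^{eₙ})`: up to a nonzero constant it is
`P₁^{e₁} ⋯ Pₙ^{eₙ}`, where the `Pₜ` are distinct (pairwise non-proportional) irreducible forms and
`Pₜ` has degree `rₜ`. Equal degrees among the `rₜ` are allowed. -/
def HasFactorizationType {F : Type*} [Field F] {n : ℕ} (r e : Fin n → ℕ)
    (h : MvPolynomial (Fin 2) F) : Prop :=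
  ∃ P : Fin n → MvPolynomial (Fin 2) F,
    (∀ t, Irreducible (P t) ∧ (P t).IsHomogeneous (r t)) ∧
    (∀ s t, s ≠ t → ¬ Associated (P s) (P t)) ∧
    Associated (∏ t, P t ^ e t) h

/-- The family of prescribed factorization type. -/
def factFamily (F : Type*) [Field F] (d : ℕ) {n : ℕ} (r e : Fin n → ℕ) : Set (FormPair F) :=
  {f | f ∈ fullFamily F d ∧ HasFactorizationType r e f.2}

/-- The three kinds of families. For prescribed factorization types the number of poles and their
degrees `r` are fixed parameters; the exponents (the pole orders) vary with `d`. -/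
inductive FamilyKind : Type
  | ord : FamilyKind
  | full : FamilyKind
  | fact {n : ℕ} (r : Fin n → ℕ) : FamilyKind

/-- The families `𝓕_d` of a given kind and degree `d`: one family for the ordinary and for the full
kind, and one for every choice of positive exponents for prescribed factorization types (only
types that do occur over `F` are considered). -/
def FamilyKind.members (F : Type*) [Field F] : FamilyKind → ℕ → Set (Set (FormPair F))
  | .ord, d => {ordFamily F d}
  | .full, d => {fullFamily F d}
  | .fact r, d => {𝓕 | ∃ e, (∀ t, 1 ≤ e t) ∧ ∑ t, r t * e t = d ∧
      𝓕 = factFamily F d r e ∧ 𝓕.Nonempty}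

/-- The average of `G` over a (finite) family. -/
def average {F : Type*} [Field F] (𝓕 : Set (FormPair F)) (G : FormPair F → ℂ) : ℂ :=
  (∑ᶠ f ∈ 𝓕, G f) / (𝓕.ncard : ℂ)

/-! ### The exponential sums -/

/-- `S_k(f, ψ) = ∑ ψ(tr f(x))` over the points `x` of the projective line over the extension of
degree `k` of `F` with `f(x) ≠ ∞`, i.e. `h(x) ≠ 0`; `tr` is the trace to the prime field. The
summand does not depend on the homogeneous coordinates `x.rep` of `x`, as `g` and `h` are forms of
the same degree. -/
def expSum {F : Type*} [Field F] [Finite F] {p : ℕ} [Fact p.Prime] [CharP F p]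
    (k : ℕ) [NeZero k] (f : FormPair F) (ψ : AddChar (ZMod p) ℂ) : ℂ :=
  ∑ᶠ x ∈ {x : ℙ (FiniteField.Extension F p k) (Fin 2 → FiniteField.Extension F p k) |
      MvPolynomial.aeval x.rep f.2 ≠ 0},
    ψ (Algebra.trace (ZMod p) (FiniteField.Extension F p k)
      (MvPolynomial.aeval x.rep f.1 / MvPolynomial.aeval x.rep f.2))

/-! ### The Beurling–Selberg polynomials -/

/-- The Fejér kernel `∑_{|k| < N} (1 - |k|/N) e(kx)`. -/
def fejer (N : ℕ) (x : ℝ) : ℝ :=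
  1 + 2 * ∑ k ∈ Finset.Ico 1 N, (1 - (k : ℝ) / N) * Real.cos (2 * Real.pi * k * x)

/-- Vaaler's polynomial of degree `K`, an approximation of the sawtooth function
`x ↦ x - ⌊x⌋ - 1/2`. -/
def vaaler (K : ℕ) (x : ℝ) : ℝ :=
  -∑ k ∈ Finset.Icc 1 K,
    (Real.pi * ((k : ℝ) / (K + 1)) * (1 - (k : ℝ) / (K + 1)) *
        Real.cot (Real.pi * ((k : ℝ) / (K + 1))) + (k : ℝ) / (K + 1)) *
      (Real.sin (2 * Real.pi * k * x) / (Real.pi * k))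

/-- Beurling's polynomial of degree `K`, the extremal majorant of the sawtooth function. -/
def beurling (K : ℕ) (x : ℝ) : ℝ :=
  vaaler K x + fejer (K + 1) x / (2 * (K + 1))

/-- The Beurling–Selberg polynomial `I_K^±` of degree `K` of the interval `[-β/2, β/2]`:
the majorant `β + B_K(x - β/2) + B_K(-β/2 - x)` for the sign `s = 1` and the minorant
`β - B_K(β/2 - x) - B_K(x + β/2)` for the sign `s = -1`. -/
def selberg (s : ℤˣ) (K : ℕ) (β : ℝ) (x : ℝ) : ℝ :=
  β + ((s : ℤ) : ℝ) *
    (beurling K (x - ((s : ℤ) : ℝ) * (β / 2)) + beurling K (-x - ((s : ℤ) : ℝ) * (β / 2)))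

/-- The Fourier coefficient `∫_{-1/2}^{1/2} I(θ) e(-kθ) dθ`. -/
def fourierCoefficient (I : ℝ → ℝ) (k : ℤ) : ℂ :=
  ∫ θ in (-(1 / 2) : ℝ)..(1 / 2),
    (I θ : ℂ) * Complex.exp (-(2 * Real.pi * Complex.I * (k : ℂ) * (θ : ℂ)))

/-! ### The sums `S^±` -/

/-- `S^±(K, f, ψ) = ∑_{k=1}^K (Î(k) S_k(f, ψ) + Î(-k) S_k(f, ψ̄)) q^{-k/2}` with `I = I_K^±`; here
`k = j + 1` and `ψ̄ = ψ⁻¹`. -/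
def charSum {F : Type*} [Field F] [Finite F] {p : ℕ} [Fact p.Prime] [CharP F p]
    (s : ℤˣ) (K : ℕ) (β : ℝ) (f : FormPair F) (ψ : AddChar (ZMod p) ℂ) : ℂ :=
  ∑ j ∈ Finset.range K,
    (fourierCoefficient (selberg s K β) ((j + 1 : ℕ) : ℤ) * expSum (j + 1) f ψ +
      fourierCoefficient (selberg s K β) (-((j + 1 : ℕ) : ℤ)) * expSum (j + 1) f ψ⁻¹) /
      ((Real.sqrt (Nat.card F) ^ (j + 1) : ℝ) : ℂ)

/-- `S^±(K, C_f) = ∑_{h=1}^{p-1} S^±(K, f, ψ^h)`. -/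
def curveSum {F : Type*} [Field F] [Finite F] {p : ℕ} [Fact p.Prime] [CharP F p]
    (s : ℤˣ) (K : ℕ) (β : ℝ) (f : FormPair F) (ψ : AddChar (ZMod p) ℂ) : ℂ :=
  ∑ h ∈ Finset.Icc 1 (p - 1), charSum s K β f (ψ ^ h)

end ArtinSchreier

end

/-! The coefficients of the Beurling–Selberg polynomials are real and even, so S(K, f, χ) splits
into one sum for χ and one for χ⁻¹ (`charSum_eq`). Everything reduces to the averages of S_{k₁}(f,
χ₁) S_{k₂}(f, χ₂) with χ₁, χ₂ nontrivial and k₁, k₂ ≤ K. Such an average is a sum, over pairs of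
points (x, y), of the mean of χ₁(tr f(x)) χ₂(tr f(y)).

For a fixed denominator h that does not vanish at x, y, this product is an additive character of the
numerator g. Coprimality of g and h is sieved by inclusion-exclusion over the square-free divisors D
of h, and the sum over the multiples of D vanishes if the character is nontrivial on them. For a
`Separated` pair this holds once d - deg D + 1 ≥ deg x + deg y. The remaining D have a cofactor of
small degree in the radical of h, so they are few (`norm_sum_isRelPrime_le`). The ordinary and the
full family have positive density among all pairs of forms (`card_family_squarefree_ge`), so the
mean at a separated pair is O(q^{2(k₁+k₂)-d}). This is O(q^{-(k₁+k₂)}) because 3(k₁+k₂) ≤ 6K < d,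
and the O(q^{k₁+k₂}) pairs contribute O(1). For prescribed factorization types the radical of h has
bounded degree, and the sum is zero unless d is bounded.

The pairs that are not separated are of two kinds. If k₁ = k₂ = k, χ₁χ₂ = 1 and x, y are conjugate
of exact degree k, the product is 1 away from the poles; these pairs give the main term k q^k. The
others are exceptional: conjugate points of degree at most (k₁+k₂)/3, or points whose residue fields
both have index divisible by p ≥ 3, so that their degrees are at most k₁/3 and k₂/3. There are
O((k₁+k₂+1) q^{(k₁+k₂)/3}) of these. The outcome is `norm_average_expSum_mul_sub_le`; after division
by q^{(k₁+k₂)/2} the errors are summable over k₁ and k₂.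

What remains is ∑ k c_k c'_k with coefficients c_k, c'_k = sin(πkβ)/(πk) + O(1/K) for either sign.
It equals π⁻² ∑ sin²(πkβ)/k + O(1) = log(Kβ)/(2π²) + O(1), and it occurs twice if χ₁ = χ₂ and twice
if χ₁χ₂ = 1. -/

noncomputable section
namespace ArtinSchreier

/-! ### Homogeneous divisors of forms -/

section HomogeneousDivisors

variable {σ R : Type*} [CommRing R]

/-- The substitution `X i ↦ X i * T`, which separates the homogeneous components. -/
def gradingHom (σ R : Type*) [CommRing R] :
    MvPolynomial σ R →ₐ[R] Polynomial (MvPolynomial σ R) :=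
  MvPolynomial.aeval fun i => Polynomial.C (MvPolynomial.X i) * Polynomial.X

lemma gradingHom_monomial (m : σ →₀ ℕ) (c : R) :
    gradingHom σ R (MvPolynomial.monomial m c) =
      Polynomial.C (MvPolynomial.monomial m c) * Polynomial.X ^ m.degree := by
  rw [gradingHom, MvPolynomial.aeval_monomial]
  simp only [mul_pow, Finsupp.prod_mul]
  have h1 : (m.prod fun _ k => (Polynomial.X : Polynomial (MvPolynomial σ R)) ^ k) =
      Polynomial.X ^ m.degree := by
    rw [Finsupp.prod, Finset.prod_pow_eq_pow_sum]
    rfl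
  rw [h1, ← mul_assoc, MvPolynomial.monomial_eq]
  simp only [Finsupp.prod, Polynomial.C_mul, map_prod, map_pow,
    IsScalarTower.algebraMap_apply R (MvPolynomial σ R) (Polynomial (MvPolynomial σ R)),
    MvPolynomial.algebraMap_eq, Polynomial.algebraMap_eq]

lemma coeff_gradingHom (p : MvPolynomial σ R) (j : ℕ) :
    (gradingHom σ R p).coeff j = MvPolynomial.homogeneousComponent j p := by
  classical
  induction p using MvPolynomial.induction_on' with
  | monomial m c =>
    rw [gradingHom_monomial, Polynomial.coeff_C_mul_X_pow,
      MvPolynomial.homogeneousComponent_of_mem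
        (MvPolynomial.isHomogeneous_monomial c rfl : (MvPolynomial.monomial m c).IsHomogeneous _)]
  | add p q hp hq => rw [map_add, Polynomial.coeff_add, hp, hq, map_add]

/-- The substitution sends a form of degree n to a monomial in T of degree n. Over a domain both the
degree and the trailing degree in T are additive, so they must agree for each factor, which
therefore has a single homogeneous component. -/
lemma isHomogeneous_of_mul_left [IsDomain R] {p q : MvPolynomial σ R} {n : ℕ}
    (h : (p * q).IsHomogeneous n) (h0 : p * q ≠ 0) : p.IsHomogeneous p.totalDegree := by
  set A := gradingHom σ R p with hA
  set B := gradingHom σ R q with hB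
  have hAB : A * B = Polynomial.C (p * q) * Polynomial.X ^ n := by
    rw [hA, hB, ← map_mul]
    ext1 j
    rw [coeff_gradingHom, Polynomial.coeff_C_mul_X_pow,
      MvPolynomial.homogeneousComponent_of_mem h]
  have hAB0 : A * B ≠ 0 := by
    rw [hAB]
    simpa using h0
  have h1 := Polynomial.natDegree_mul (left_ne_zero_of_mul hAB0) (right_ne_zero_of_mul hAB0)
  have h2 := Polynomial.natTrailingDegree_mul (left_ne_zero_of_mul hAB0)
    (right_ne_zero_of_mul hAB0)
  rw [hAB, Polynomial.natDegree_C_mul_X_pow _ _ h0] at h1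
  rw [hAB, Polynomial.C_mul_X_pow_eq_monomial,
    Polynomial.natTrailingDegree_monomial h0] at h2
  have h3 := A.natTrailingDegree_le_natDegree
  have h4 := B.natTrailingDegree_le_natDegree
  have h5 : ∀ j, j ≠ A.natDegree → MvPolynomial.homogeneousComponent j p = 0 := by
    intro j hj
    rw [← coeff_gradingHom, ← hA]
    rcases lt_or_gt_of_ne hj with hj | hj
    · exact Polynomial.coeff_eq_zero_of_lt_natTrailingDegree (by lia)
    · exact Polynomial.coeff_eq_zero_of_natDegree_lt hj
  have h6 : MvPolynomial.homogeneousComponent A.natDegree p = p := by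
    by_cases hlt : A.natDegree ∈ Finset.range (p.totalDegree + 1)
    · conv_rhs => rw [← MvPolynomial.sum_homogeneousComponent p]
      rw [Finset.sum_eq_single_of_mem _ hlt]
      intro j _ hj
      exact h5 j hj
    · exfalso
      apply left_ne_zero_of_mul h0
      rw [← MvPolynomial.sum_homogeneousComponent p]
      refine Finset.sum_eq_zero fun j hj => h5 j ?_
      rintro rfl
      exact hlt hj
  have h7 : p.IsHomogeneous A.natDegree := by
    rw [← h6]
    exact MvPolynomial.homogeneousComponent_isHomogeneous _ _
  rwa [h7.totalDegree (left_ne_zero_of_mul h0)]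

lemma isHomogeneous_of_dvd [IsDomain R] {p q : MvPolynomial σ R} {n : ℕ}
    (h : q.IsHomogeneous n) (h0 : q ≠ 0) (hpq : p ∣ q) : p.IsHomogeneous p.totalDegree := by
  obtain ⟨r, rfl⟩ := hpq
  exact isHomogeneous_of_mul_left h h0

lemma isHomogeneous_of_mul_right [IsDomain R] {p q : MvPolynomial σ R} {m n : ℕ}
    (hp : p.IsHomogeneous m) (hp0 : p ≠ 0) (h : (p * q).IsHomogeneous n) :
    q.IsHomogeneous (n - m) := by
  rcases eq_or_ne q 0 with rfl | hq0
  · exact MvPolynomial.isHomogeneous_zero _ _ _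
  have h1 : q.IsHomogeneous q.totalDegree :=
    isHomogeneous_of_mul_left (q := p) (by rwa [mul_comm]) (mul_ne_zero hq0 hp0)
  have h2 : m + q.totalDegree = n := (hp.mul h1).inj_right h (mul_ne_zero hp0 hq0)
  rwa [show n - m = q.totalDegree by lia]

lemma degree_le_of_dvd [IsDomain R] {p q : MvPolynomial σ R} {m n : ℕ}
    (hp : p.IsHomogeneous m) (hq : q.IsHomogeneous n) (hq0 : q ≠ 0) (h : p ∣ q) : m ≤ n := by
  obtain ⟨r, rfl⟩ := h
  have h1 := isHomogeneous_of_dvd hq hq0 (dvd_mul_left r p)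
  have := (hp.mul h1).inj_right hq hq0
  lia

end HomogeneousDivisors

/-! ### Counting forms -/

section Forms

variable {F : Type*} [Field F]

/-- The dehomogenization `Z ↦ 1`. -/
def dehomogenize : MvPolynomial (Fin 2) F →ₐ[F] Polynomial F :=
  MvPolynomial.aeval ![Polynomial.X, 1]

lemma homogenize_dehomogenize {n : ℕ} {g : MvPolynomial (Fin 2) F} (hg : g.IsHomogeneous n) :
    (dehomogenize g).homogenize n = g :=
  Polynomial.homogenize_eq_of_isHomogeneous hg rfl

lemma natDegree_dehomogenize_le {n : ℕ} {g : MvPolynomial (Fin 2) F} (hg : g.IsHomogeneous n) :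
    (dehomogenize g).natDegree ≤ n := by
  rw [dehomogenize, MvPolynomial.aeval_def, MvPolynomial.eval₂_eq']
  refine Polynomial.natDegree_sum_le_of_forall_le _ _ fun m hm => ?_
  have h := hg.degree_eq_sum_deg_support hm
  have h' : m 0 + m 1 = n := by
    rw [h, Finset.sum_subset (Finset.subset_univ _) (by simp), Fin.sum_univ_two]
  have : (algebraMap F (Polynomial F)) (MvPolynomial.coeff m g) *
      ∏ i, (![Polynomial.X, 1] i : Polynomial F) ^ m i =
      Polynomial.C (MvPolynomial.coeff m g) * Polynomial.X ^ m 0 := by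
    simp [Fin.prod_univ_two]
  rw [this]
  exact (Polynomial.natDegree_C_mul_X_pow_le _ _).trans (by lia)

/-- Forms of degree `n` and polynomials of degree at most `n`. -/
def formsEquiv (F : Type*) [Field F] (n : ℕ) :
    MvPolynomial.homogeneousSubmodule (Fin 2) F n ≃ Polynomial.degreeLT F (n + 1) where
  toFun g := ⟨dehomogenize g.1, Polynomial.mem_degreeLT.2 <| by
    have h := natDegree_dehomogenize_le g.2
    exact Polynomial.degree_le_natDegree.trans_lt (by exact_mod_cast Nat.lt_succ_of_le h)⟩
  invFun p := ⟨p.1.homogenize n, Polynomial.isHomogeneous_homogenize _⟩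
  left_inv g := Subtype.ext (homogenize_dehomogenize g.2)
  right_inv p := Subtype.ext <| Polynomial.aeval_homogenize_X_one _ <| by
    refine Polynomial.natDegree_le_iff_coeff_eq_zero.2 fun j hj =>
      Polynomial.coeff_eq_zero_of_degree_lt ?_
    exact (Polynomial.mem_degreeLT.1 p.2).trans_le (by exact_mod_cast hj)

variable [Finite F]

instance finite_forms (n : ℕ) : Finite (MvPolynomial.homogeneousSubmodule (Fin 2) F n) := by
  have : Finite (Polynomial.degreeLT F (n + 1)) :=
    Finite.of_equiv _ (Polynomial.degreeLTEquiv F (n + 1)).symm.toEquiv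
  exact Finite.of_equiv _ (formsEquiv F n).symm

/-- The finite set of forms of degree `n`. -/
def forms (F : Type*) [Field F] [Finite F] (n : ℕ) : Finset (MvPolynomial (Fin 2) F) :=
  haveI : Finite ((MvPolynomial.homogeneousSubmodule (Fin 2) F n : Submodule _ _) :
    Set (MvPolynomial (Fin 2) F)) := finite_forms n
  (Set.toFinite ((MvPolynomial.homogeneousSubmodule (Fin 2) F n : Submodule _ _) :
    Set (MvPolynomial (Fin 2) F))).toFinset

@[simp]
lemma mem_forms {n : ℕ} {g : MvPolynomial (Fin 2) F} : g ∈ forms F n ↔ g.IsHomogeneous n := by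
  simp [forms]

lemma card_forms (n : ℕ) : (forms F n).card = Nat.card F ^ (n + 1) := by
  have h : (forms F n).card =
      Nat.card (MvPolynomial.homogeneousSubmodule (Fin 2) F n) := by
    rw [← Nat.card_eq_finsetCard]
    exact Nat.card_congr (Equiv.subtypeEquivRight fun g => mem_forms)
  rw [h]
  refine (Nat.card_congr ((formsEquiv F n).trans
    (Polynomial.degreeLTEquiv F (n + 1)).toEquiv)).trans ?_
  rw [Nat.card_fun]
  simp

open scoped Classical in
lemma forms_filter_dvd {d j : ℕ} (hj : j ≤ d) {D : MvPolynomial (Fin 2) F}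
    (hD : D.IsHomogeneous j) (hD0 : D ≠ 0) :
    (forms F d).filter (D ∣ ·) = (forms F (d - j)).image (D * ·) := by
  ext g
  simp only [Finset.mem_filter, mem_forms, Finset.mem_image]
  constructor
  · rintro ⟨hg, r, rfl⟩
    exact ⟨r, isHomogeneous_of_mul_right hD hD0 hg, rfl⟩
  · rintro ⟨r, hr, rfl⟩
    refine ⟨?_, dvd_mul_right _ _⟩
    have := hD.mul hr
    rwa [Nat.add_sub_cancel' hj] at this

open scoped Classical in
lemma card_forms_filter_dvd {d j : ℕ} (hj : j ≤ d) {D : MvPolynomial (Fin 2) F}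
    (hD : D.IsHomogeneous j) (hD0 : D ≠ 0) :
    ((forms F d).filter (D ∣ ·)).card = Nat.card F ^ (d - j + 1) := by
  rw [forms_filter_dvd hj hD hD0, Finset.card_image_of_injective _ (mul_right_injective₀ hD0),
    card_forms]

end Forms

/-! ### Points of the projective line over a finite extension -/

section Points

open IntermediateField

variable {F : Type*} [Field F] {E E' : Type*} [Field E] [Algebra F E] [Field E'] [Algebra F E']

/-- Homogeneous coordinates of a point of the projective line. -/
def coords (x : OnePoint E) : Fin 2 → E :=
  x.elim ![1, 0] fun a => ![a, 1]

/-- The value of a form at a point, in the coordinates `coords`. -/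
def val (x : OnePoint E) : MvPolynomial (Fin 2) F →ₐ[F] E :=
  MvPolynomial.aeval (coords x)

lemma val_some_homogenize {n : ℕ} {G : Polynomial F} (hG : G.natDegree ≤ n) (a : E) :
    val (a : OnePoint E) (G.homogenize n) = Polynomial.aeval a G :=
  Polynomial.aeval_homogenize_of_eq_one hG _ rfl

lemma val_infty_homogenize (n : ℕ) (G : Polynomial F) :
    val (OnePoint.infty : OnePoint E) (G.homogenize n) = algebraMap F E (G.coeff n) := by
  rw [Polynomial.homogenize, map_sum, Finset.sum_eq_single (n, 0)]
  · simp [val, coords, MvPolynomial.aeval_monomial, Finsupp.prod_fintype, Fin.prod_univ_two]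
  · rintro ⟨i, j⟩ hij hne
    have hj : j ≠ 0 := by
      rintro rfl
      simp_all
    simp [val, coords, MvPolynomial.aeval_monomial, Finsupp.prod_fintype, Fin.prod_univ_two, hj]
  · simp

/-- The field generated by a point. -/
def ptField (F : Type*) [Field F] {E : Type*} [Field E] [Algebra F E] (x : OnePoint E) :
    IntermediateField F E :=
  x.elim ⊥ fun a => F⟮a⟯

/-- The degree of a point. -/
def ptDeg (F : Type*) [Field F] {E : Type*} [Field E] [Algebra F E] (x : OnePoint E) : ℕ :=
  Module.finrank F (ptField F x)

/-- An invariant of points that separates the conjugacy classes. -/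
def ptClass (F : Type*) [Field F] {E : Type*} [Field E] [Algebra F E] (x : OnePoint E) :
    OnePoint (Polynomial F) :=
  x.elim OnePoint.infty fun a => (minpoly F a : OnePoint (Polynomial F))

/-- A form of degree `ptDeg F x` that vanishes exactly at the conjugates of `x`. -/
def ptForm (F : Type*) [Field F] {E : Type*} [Field E] [Algebra F E] (x : OnePoint E) :
    MvPolynomial (Fin 2) F :=
  x.elim (MvPolynomial.X 1) fun a => (minpoly F a).homogenize (minpoly F a).natDegree

lemma val_mem_ptField (x : OnePoint E) (g : MvPolynomial (Fin 2) F) : val x g ∈ ptField F x := by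
  have h : ∀ i, coords x i ∈ (ptField F x).toSubalgebra := by
    intro i
    induction x using OnePoint.rec with
    | infty => fin_cases i <;> simp [coords]
    | coe a =>
      fin_cases i
      · exact mem_adjoin_simple_self F a
      · simp [coords]
  rw [val, MvPolynomial.aeval_def, MvPolynomial.eval₂_eq']
  exact sum_mem fun m _ => mul_mem (IntermediateField.algebraMap_mem _ _)
    (prod_mem fun i _ => pow_mem (h i) _)

lemma ptDeg_infty : ptDeg F (OnePoint.infty : OnePoint E) = 1 :=
  IntermediateField.finrank_bot

lemma ptDeg_mul_finrank (x : OnePoint E) :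
    ptDeg F x * Module.finrank (ptField F x) E = Module.finrank F E :=
  Module.finrank_mul_finrank F (ptField F x) E

lemma ptDeg_dvd (x : OnePoint E) : ptDeg F x ∣ Module.finrank F E :=
  ⟨_, (ptDeg_mul_finrank x).symm⟩

variable [Algebra.IsIntegral F E]

lemma ptDeg_some (a : E) : ptDeg F (a : OnePoint E) = (minpoly F a).natDegree :=
  adjoin.finrank (Algebra.IsIntegral.isIntegral a)

lemma ptDeg_pos (x : OnePoint E) : 0 < ptDeg F x := by
  induction x using OnePoint.rec with
  | infty => simp [ptDeg_infty]
  | coe a =>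
    rw [ptDeg_some]
    exact minpoly.natDegree_pos (Algebra.IsIntegral.isIntegral a)

/-- Elements of F(a) are polynomials in a of degree below that of the minimal polynomial, and these
can be homogenized to degree n; at ∞ the multiples of X^n suffice. This interpolation supplies all
the test numerators below. -/
lemma exists_form_val_eq {x : OnePoint E} {n : ℕ} (hn : ptDeg F x ≤ n + 1) {y : E}
    (hy : y ∈ ptField F x) :
    ∃ g : MvPolynomial (Fin 2) F, g.IsHomogeneous n ∧ val x g = y := by
  induction x using OnePoint.rec with
  | infty =>
    obtain ⟨c, rfl⟩ := IntermediateField.mem_bot.1 hy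
    refine ⟨(Polynomial.C c * Polynomial.X ^ n).homogenize n,
      Polynomial.isHomogeneous_homogenize _, ?_⟩
    rw [val_infty_homogenize]
    simp
  | coe a =>
    have ha : IsIntegral F a := Algebra.IsIntegral.isIntegral a
    have hy' : y ∈ Algebra.adjoin F {a} := by
      rw [← adjoin_simple_toSubalgebra_of_isAlgebraic ha.isAlgebraic]
      exact hy
    rw [Algebra.adjoin_singleton_eq_range_aeval] at hy'
    obtain ⟨r, rfl⟩ := hy'
    have hdeg : (r %ₘ minpoly F a).natDegree ≤ n := by
      have := Polynomial.natDegree_modByMonic_lt r (minpoly.monic ha) (minpoly.ne_one F a)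
      rw [ptDeg_some] at hn
      lia
    refine ⟨(r %ₘ minpoly F a).homogenize n, Polynomial.isHomogeneous_homogenize _, ?_⟩
    rw [val_some_homogenize hdeg, Polynomial.aeval_modByMonic_eq_self_of_root (minpoly.aeval F a)]
    rfl

lemma isHomogeneous_ptForm (x : OnePoint E) : (ptForm F x).IsHomogeneous (ptDeg F x) := by
  induction x using OnePoint.rec with
  | infty => rw [ptDeg_infty]; exact MvPolynomial.isHomogeneous_X _ _
  | coe a => rw [ptDeg_some]; exact Polynomial.isHomogeneous_homogenize _

/-- A monic irreducible polynomial with root b is the minimal polynomial of b. The two points may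
lie over different extensions; this is why classes are recorded by polynomials over F. -/
lemma val_ptForm_eq_zero_iff (x : OnePoint E) (y : OnePoint E') :
    val y (ptForm F x) = 0 ↔ ptClass F y = ptClass F x := by
  induction x using OnePoint.rec with
  | infty =>
    induction y using OnePoint.rec with
    | infty => simp [val, ptForm, coords, ptClass]
    | coe b => simp [val, ptForm, coords, ptClass]
  | coe a =>
    have ha : IsIntegral F a := Algebra.IsIntegral.isIntegral a
    induction y using OnePoint.rec with
    | infty =>
      change val OnePoint.infty ((minpoly F a).homogenize _) = 0 ↔ _
      rw [val_infty_homogenize, Polynomial.coeff_natDegree, (minpoly.monic ha).leadingCoeff]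
      simp [ptClass, OnePoint.infty_ne_coe]
    | coe b =>
      change val (b : OnePoint E') ((minpoly F a).homogenize _) = 0 ↔
        (minpoly F b : OnePoint (Polynomial F)) = (minpoly F a : OnePoint (Polynomial F))
      rw [val_some_homogenize le_rfl, OnePoint.coe_eq_coe]
      constructor
      · intro h
        exact (minpoly.eq_of_irreducible_of_monic (minpoly.irreducible ha) h
          (minpoly.monic ha)).symm
      · intro h
        rw [← h, minpoly.aeval]

variable [Algebra.IsIntegral F E']

lemma ptDeg_eq_of_ptClass_eq {x : OnePoint E} {y : OnePoint E'} (h : ptClass F x = ptClass F y) :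
    ptDeg F x = ptDeg F y := by
  induction x using OnePoint.rec with
  | infty =>
    induction y using OnePoint.rec with
    | infty => rw [ptDeg_infty, ptDeg_infty]
    | coe b => exact absurd h (OnePoint.infty_ne_coe _)
  | coe a =>
    induction y using OnePoint.rec with
    | infty => exact absurd h (OnePoint.coe_ne_infty _)
    | coe b => rw [ptDeg_some, ptDeg_some, OnePoint.coe_injective h]

end Points

/-! ### Conjugacy classes and numbers of points of bounded degree -/

section PointCounts

open IntermediateField

variable {F : Type*} [Field F] {E E' : Type*} [Field E] [Algebra F E] [Finite E]
  [Field E'] [Algebra F E'] [Finite E']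

instance {α : Type*} [Finite α] : Finite (OnePoint α) := inferInstanceAs (Finite (Option α))

noncomputable instance {α : Type*} [Finite α] : Fintype (OnePoint α) := Fintype.ofFinite _

/-- Finite extensions of finite fields are normal, so roots of one minimal polynomial are exchanged
by an automorphism, which then carries all values of forms along. -/
lemma exists_algEquiv_of_ptClass_eq {x y : OnePoint E} (h : ptClass F x = ptClass F y) :
    ∃ σ : E ≃ₐ[F] E, ∀ g : MvPolynomial (Fin 2) F, val y g = σ (val x g) := by
  obtain ⟨σ, hσ⟩ : ∃ σ : E ≃ₐ[F] E, ∀ i, coords y i = σ (coords x i) := by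
    induction x using OnePoint.rec with
    | infty =>
      induction y using OnePoint.rec with
      | infty =>
        refine ⟨AlgEquiv.refl, fun i => ?_⟩
        simp
      | coe b => exact absurd h (OnePoint.infty_ne_coe _)
    | coe a =>
      induction y using OnePoint.rec with
      | infty => exact absurd h (OnePoint.coe_ne_infty _)
      | coe b =>
        obtain ⟨σ, hσ⟩ := isConjRoot_iff_exists_algEquiv.1
          (show IsConjRoot F b a from (OnePoint.coe_injective h).symm)
        refine ⟨σ, fun i => ?_⟩
        fin_cases i <;> simp [coords, hσ]
  refine ⟨σ, fun g => ?_⟩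
  have : (val y : MvPolynomial (Fin 2) F →ₐ[F] E) = (σ : E →ₐ[F] E).comp (val x) := by
    refine MvPolynomial.algHom_ext fun i => ?_
    simp [val, hσ]
  rw [this]
  rfl

lemma pow_card_pow_ptDeg (a : E) : a ^ Nat.card F ^ ptDeg F (a : OnePoint E) = a := by
  have := Fintype.ofFinite F⟮a⟯
  have h := FiniteField.pow_card (⟨a, mem_adjoin_simple_self F a⟩ : F⟮a⟯)
  rw [← Nat.card_eq_fintype_card, Module.natCard_eq_pow_finrank (K := F)] at h
  exact congrArg Subtype.val h

open scoped Classical in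
-- Affine points of degree B + 1 are roots of X^{q^{B+1}} - X, so each step adds at most q^{B+1}
-- points, and 2q^B ≤ q^{B+1}. Including ∞ from the start makes every new point affine.
lemma card_ptDeg_le_aux [Finite F] (B : ℕ) :
    (insert OnePoint.infty (Finset.univ.filter fun x : OnePoint E => ptDeg F x ≤ B)).card ≤
      2 * Nat.card F ^ B := by
  have hq : 2 ≤ Nat.card F := Finite.one_lt_card
  induction B with
  | zero =>
    have : (Finset.univ.filter fun x : OnePoint E => ptDeg F x ≤ 0) = ∅ := by
      refine Finset.filter_eq_empty_iff.2 fun x _ => ?_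
      have := ptDeg_pos (F := F) x
      lia
    rw [this]
    simp
  | succ B ih =>
    set P : Polynomial E := Polynomial.X ^ Nat.card F ^ (B + 1) - Polynomial.X with hP
    have h1 : 1 < Nat.card F ^ (B + 1) := Nat.one_lt_pow (by lia) (by lia)
    have hP0 : P ≠ 0 := FiniteField.X_pow_card_sub_X_ne_zero E h1
    have hsub : insert OnePoint.infty (Finset.univ.filter fun x : OnePoint E => ptDeg F x ≤ B + 1) ⊆
        insert OnePoint.infty (Finset.univ.filter fun x : OnePoint E => ptDeg F x ≤ B) ∪
          P.roots.toFinset.image (fun a : E => (a : OnePoint E)) := by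
      intro x hx
      rw [Finset.mem_union]
      induction x using OnePoint.rec with
      | infty => left; simp
      | coe a =>
        simp only [Finset.mem_insert, OnePoint.coe_ne_infty, Finset.mem_filter, Finset.mem_univ,
          true_and, false_or, Finset.mem_image, Multiset.mem_toFinset, OnePoint.coe_eq_coe,
          exists_eq_right] at hx ⊢
        rcases Nat.lt_or_ge B (ptDeg F (a : OnePoint E)) with h | h
        · right
          have h2 : ptDeg F (a : OnePoint E) = B + 1 := by lia
          rw [Polynomial.mem_roots hP0]
          have := pow_card_pow_ptDeg (F := F) a
          rw [h2] at this
          simp [hP, this]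
        · exact Or.inl h
    refine (Finset.card_le_card hsub).trans ((Finset.card_union_le _ _).trans ?_)
    have h2 : (P.roots.toFinset.image (fun a : E => (a : OnePoint E))).card ≤
        Nat.card F ^ (B + 1) := by
      refine Finset.card_image_le.trans ((Multiset.toFinset_card_le _).trans
        ((Polynomial.card_roots' _).trans ?_))
      rw [hP, FiniteField.X_pow_card_sub_X_natDegree_eq E h1]
    have h3 : 2 * Nat.card F ^ B ≤ Nat.card F ^ (B + 1) := by
      rw [pow_succ']
      exact Nat.mul_le_mul_right _ hq
    lia

open scoped Classical in
lemma card_ptDeg_le [Finite F] (B : ℕ) :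
    (Finset.univ.filter fun x : OnePoint E => ptDeg F x ≤ B).card ≤ 2 * Nat.card F ^ B :=
  (Finset.card_le_card (Finset.subset_insert _ _)).trans (card_ptDeg_le_aux B)

open scoped Classical in
lemma filter_ptClass_infty :
    (Finset.univ.filter fun y : OnePoint E' => ptClass F y = OnePoint.infty) =
      {OnePoint.infty} := by
  ext y
  rw [Finset.mem_filter, Finset.mem_singleton]
  induction y using OnePoint.rec with
  | infty => simp [ptClass]
  | coe b => simp [ptClass]

open scoped Classical in
lemma filter_ptClass_some (a : E) :
    (Finset.univ.filter fun y : OnePoint E' => ptClass F y = ptClass F (a : OnePoint E)) =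
      ((minpoly F a).rootSet E').toFinset.image (fun b : E' => (b : OnePoint E')) := by
  have ha : IsIntegral F a := Algebra.IsIntegral.isIntegral a
  ext y
  simp only [Finset.mem_filter, Finset.mem_univ, true_and]
  rw [← val_ptForm_eq_zero_iff]
  induction y using OnePoint.rec with
  | infty =>
    rw [val_ptForm_eq_zero_iff]
    simp [ptClass, OnePoint.infty_ne_coe]
  | coe b =>
    change val (b : OnePoint E') ((minpoly F a).homogenize _) = 0 ↔ _
    rw [val_some_homogenize le_rfl]
    simp [Polynomial.mem_rootSet, minpoly.ne_zero ha]

open scoped Classical in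
lemma card_ptClass_eq_le (x : OnePoint E) :
    (Finset.univ.filter fun y : OnePoint E' => ptClass F y = ptClass F x).card ≤ ptDeg F x := by
  induction x using OnePoint.rec with
  | infty =>
    change (Finset.univ.filter fun y : OnePoint E' => ptClass F y = OnePoint.infty).card ≤ _
    rw [filter_ptClass_infty, ptDeg_infty, Finset.card_singleton]
  | coe a =>
    rw [filter_ptClass_some, ptDeg_some]
    refine Finset.card_image_le.trans ?_
    rw [show ((minpoly F a).rootSet E').toFinset = ((minpoly F a).aroots E').toFinset by
      ext b; simp [Polynomial.rootSet_def]]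
    refine (Multiset.toFinset_card_le _).trans ((Polynomial.card_roots' _).trans ?_)
    exact Polynomial.natDegree_map_le

open scoped Classical in
-- Over the field of x itself the minimal polynomial splits into distinct factors, so the upper
-- bound by the degree is attained.
lemma card_ptClass_eq (x : OnePoint E) :
    (Finset.univ.filter fun y : OnePoint E => ptClass F y = ptClass F x).card = ptDeg F x := by
  induction x using OnePoint.rec with
  | infty =>
    change (Finset.univ.filter fun y : OnePoint E => ptClass F y = OnePoint.infty).card = _
    rw [filter_ptClass_infty, ptDeg_infty, Finset.card_singleton]
  | coe a =>
    rw [filter_ptClass_some, ptDeg_some, Finset.card_image_of_injective _ OnePoint.coe_injective,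
      Set.toFinset_card]
    exact Polynomial.card_rootSet_eq_natDegree (Algebra.IsSeparable.isSeparable F a)
      (Normal.splits inferInstance a)

lemma card_onePoint (α : Type*) [Finite α] : Fintype.card (OnePoint α) = Nat.card α + 1 := by
  rw [← Nat.card_eq_fintype_card]
  exact Finite.card_option

end PointCounts

/-! ### Trace characters of values and separated pairs of points -/

section Characters

open IntermediateField

variable {F : Type*} [Field F] {p : ℕ} [Fact p.Prime]
  {E E' : Type*} [Field E] [Algebra F E] [Algebra (ZMod p) E]
  [Field E'] [Algebra F E'] [Algebra (ZMod p) E']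

/-- The contribution of the point `x` to the exponential sum of `χ` and `f`. -/
def term (χ : AddChar (ZMod p) ℂ) (x : OnePoint E) (f : FormPair F) : ℂ :=
  open scoped Classical in
  if val x f.2 = 0 then 0 else χ (Algebra.trace (ZMod p) E (val x f.1 / val x f.2))

lemma norm_term_le_one (χ : AddChar (ZMod p) ℂ) (x : OnePoint E) (f : FormPair F) :
    ‖term χ x f‖ ≤ 1 := by
  rw [term]
  split_ifs
  · simp
  · simp

/-- No nontrivial relation between the values of the two characters at the values `f x` and `f y`
persists when the numerator of `f` runs over the multiples of a form. -/
def Separated (F : Type*) [Field F] [Algebra F E] [Algebra F E'] (χ₁ χ₂ : AddChar (ZMod p) ℂ)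
    (x : OnePoint E) (y : OnePoint E') : Prop :=
  ∀ h D : MvPolynomial (Fin 2) F, val x h ≠ 0 → val y h ≠ 0 → val x D ≠ 0 → val y D ≠ 0 →
    ∀ n, ptDeg F x + ptDeg F y ≤ n + 1 → ∃ g : MvPolynomial (Fin 2) F, g.IsHomogeneous n ∧
      χ₁ (Algebra.trace (ZMod p) E (val x (D * g) / val x h)) *
        χ₂ (Algebra.trace (ZMod p) E' (val y (D * g) / val y h)) ≠ 1

lemma Separated.symm {χ₁ χ₂ : AddChar (ZMod p) ℂ} {x : OnePoint E} {y : OnePoint E'}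
    (h : Separated F χ₁ χ₂ x y) : Separated F χ₂ χ₁ y x := by
  intro k D h1 h2 h3 h4 n hn
  obtain ⟨g, hg, hne⟩ := h k D h2 h1 h4 h3 n (by lia)
  exact ⟨g, hg, by rwa [mul_comm]⟩

lemma aeval_smul_coords {d : ℕ} {g : MvPolynomial (Fin 2) F} (hg : g.IsHomogeneous d) (c : E)
    (v : Fin 2 → E) : MvPolynomial.aeval (c • v) g = c ^ d * MvPolynomial.aeval v g := by
  simp only [MvPolynomial.aeval_def, MvPolynomial.eval₂_eq', Finset.mul_sum]
  refine Finset.sum_congr rfl fun m hm => ?_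
  have h : d = m 0 + m 1 := by
    rw [hg.degree_eq_sum_deg_support hm, Finset.sum_subset (Finset.subset_univ _) (by simp),
      Fin.sum_univ_two]
  simp only [Fin.prod_univ_two, Pi.smul_apply, smul_eq_mul, h]
  ring

variable [CharP F p] [Finite E] [Finite E']

/-- On K the trace from E is [E : K] times the trace from K, and the latter is onto the prime field;
the factor is invertible when p does not divide it. -/
lemma exists_trace_ne_one {χ : AddChar (ZMod p) ℂ} (hχ : χ ≠ 1) (K : IntermediateField F E)
    (hK : ¬ p ∣ Module.finrank K E) : ∃ y ∈ K, χ (Algebra.trace (ZMod p) E y) ≠ 1 := by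
  let : Algebra (ZMod p) F := ZMod.algebra F p
  have : IsScalarTower (ZMod p) F E := .of_algebraMap_eq' (Subsingleton.elim _ _)
  obtain ⟨c, hc⟩ := (AddChar.ne_one_iff).1 hχ
  obtain ⟨y, hy⟩ := Algebra.trace_surjective (ZMod p) K
    (((Module.finrank K E : ℕ) : ZMod p)⁻¹ * c)
  refine ⟨y, y.2, ?_⟩
  have h0 : ((Module.finrank K E : ℕ) : ZMod p) ≠ 0 := by
    rwa [Ne, ZMod.natCast_eq_zero_iff]
  have h1 : Algebra.trace (ZMod p) E (y : E) = c := by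
    rw [← Algebra.trace_trace (S := K), show (y : E) = algebraMap K E y from rfl,
      Algebra.trace_algebraMap, map_nsmul, hy, nsmul_eq_mul, mul_inv_cancel_left₀ h0]
  rwa [h1]

/-- Multiples of the form of y vanish at y and silence the second character, while their values at x
remain free in the residue field. -/
lemma separated_of_ptClass_ne {χ₁ χ₂ : AddChar (ZMod p) ℂ} (hχ : χ₁ ≠ 1) {x : OnePoint E}
    {y : OnePoint E'} (hxy : ptClass F x ≠ ptClass F y)
    (hp : ¬ p ∣ Module.finrank (ptField F x) E) : Separated F χ₁ χ₂ x y := by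
  intro h D hx _ hDx _ n hn
  obtain ⟨z, hz, hne⟩ := exists_trace_ne_one hχ (ptField F x) hp
  have hP : val x (ptForm F y) ≠ 0 := (val_ptForm_eq_zero_iff y x).not.2 hxy
  have hy := ptDeg_pos (F := F) y
  have hx' := ptDeg_pos (F := F) x
  -- The prescribed value cancels D(x), h(x) and the factor vanishing at y, so that the quotient at
  -- x is exactly z.
  obtain ⟨g, hg, hgz⟩ := exists_form_val_eq (F := F) (x := x) (n := n - ptDeg F y)
    (y := z * val x h / (val x D * val x (ptForm F y))) (by lia)
    (div_mem (mul_mem hz (val_mem_ptField x h))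
      (mul_mem (val_mem_ptField x D) (val_mem_ptField x _)))
  refine ⟨ptForm F y * g, ?_, ?_⟩
  · have := (isHomogeneous_ptForm y).mul hg
    rwa [Nat.add_sub_cancel' (by lia)] at this
  · have h1 : val x (D * (ptForm F y * g)) / val x h = z := by
      rw [map_mul, map_mul, hgz]
      field_simp
    have h2 : val y (D * (ptForm F y * g)) / val y h = 0 := by
      rw [map_mul, map_mul, (val_ptForm_eq_zero_iff y y).2 rfl]
      simp
    rw [h1, h2, map_zero, AddChar.map_zero_eq_one, mul_one]
    exact hne

lemma trace_val_eq {x y : OnePoint E} (hxy : ptClass F x = ptClass F y)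
    (g h : MvPolynomial (Fin 2) F) : Algebra.trace (ZMod p) E (val y g / val y h) =
      Algebra.trace (ZMod p) E (val x g / val x h) := by
  let : Algebra (ZMod p) F := ZMod.algebra F p
  have : IsScalarTower (ZMod p) F E := .of_algebraMap_eq' (Subsingleton.elim _ _)
  obtain ⟨σ, hσ⟩ := exists_algEquiv_of_ptClass_eq hxy
  rw [hσ, hσ, ← map_div₀]
  exact Algebra.trace_eq_of_algEquiv (σ.restrictScalars (ZMod p)) _

lemma val_eq_zero_iff_of_ptClass_eq {x y : OnePoint E} (hxy : ptClass F x = ptClass F y)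
    (h : MvPolynomial (Fin 2) F) : val y h = 0 ↔ val x h = 0 := by
  obtain ⟨σ, hσ⟩ := exists_algEquiv_of_ptClass_eq hxy
  rw [hσ]
  simp

/-- At conjugate points the traces coincide, so only the product χ₁χ₂ is seen. Full degree makes the
residue field all of E, of index 1, prime to p. -/
lemma separated_of_mul_ne_one {χ₁ χ₂ : AddChar (ZMod p) ℂ} (hχ : χ₁ * χ₂ ≠ 1) {x y : OnePoint E}
    (hxy : ptClass F x = ptClass F y) (hx : ptDeg F x = Module.finrank F E) :
    Separated F χ₁ χ₂ x y := by
  intro h D hhx _ hDx _ n hn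
  have hp : ¬ p ∣ Module.finrank (ptField F x) E := by
    have h1 := ptDeg_mul_finrank (F := F) x
    have h2 := ptDeg_pos (F := F) x
    have h3 : Module.finrank (ptField F x) E = 1 := by
      rw [← hx] at h1
      exact Nat.eq_of_mul_eq_mul_left h2 (by lia)
    rw [h3]
    exact (Fact.out : p.Prime).not_dvd_one
  obtain ⟨z, hz, hne⟩ := exists_trace_ne_one hχ (ptField F x) hp
  obtain ⟨g, hg, hgz⟩ := exists_form_val_eq (F := F) (x := x) (n := n)
    (y := z * val x h / val x D) (by lia)
    (div_mem (mul_mem hz (val_mem_ptField x h)) (val_mem_ptField x D))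
  refine ⟨g, hg, ?_⟩
  rw [trace_val_eq hxy, ← AddChar.mul_apply, map_mul, hgz]
  have : val x D * (z * val x h / val x D) / val x h = z := by field_simp
  rwa [this]

/-- The source of the main term: equal traces and χ₁χ₂ = 1 leave no oscillation, only the condition
that x is not a pole. -/
lemma term_mul_term_of_ptClass_eq {χ₁ χ₂ : AddChar (ZMod p) ℂ} (hχ : χ₁ * χ₂ = 1)
    {x y : OnePoint E} (hxy : ptClass F x = ptClass F y) (f : FormPair F) :
    term χ₁ x f * term χ₂ y f = open scoped Classical in if val x f.2 = 0 then 0 else 1 := by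
  rw [term, term, trace_val_eq hxy]
  by_cases h : val x f.2 = 0
  · simp [h]
  · rw [if_neg h, if_neg h, if_neg ((val_eq_zero_iff_of_ptClass_eq hxy _).not.2 h),
      ← AddChar.mul_apply, hχ, AddChar.one_apply]

/-- Two coordinate vectors of a point differ by a scalar c, and the factor c^d cancels in g/h
because both forms have degree d. -/
lemma expSum_eq_sum_term [Finite F] {k : ℕ} [NeZero k] {d : ℕ} {f : FormPair F} (h1 : f.1.IsHomogeneous d)
    (h2 : f.2.IsHomogeneous d) (χ : AddChar (ZMod p) ℂ) :
    expSum k f χ = ∑ x : OnePoint (FiniteField.Extension F p k), term χ x f := by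
  classical
  rw [expSum, ← finsum_eq_sum_of_fintype,
    ← finsum_comp_equiv (OnePoint.equivProjectivization (FiniteField.Extension F p k))]
  refine finsum_congr fun x => ?_
  obtain ⟨c, hc⟩ : ∃ c : (FiniteField.Extension F p k)ˣ, c • coords x =
      (OnePoint.equivProjectivization (FiniteField.Extension F p k) x).rep := by
    induction x using OnePoint.rec with
    | infty => exact Projectivization.exists_smul_eq_mk_rep _ _ _
    | coe a => exact Projectivization.exists_smul_eq_mk_rep _ _ _
  have hv : ∀ {g : MvPolynomial (Fin 2) F}, g.IsHomogeneous d → MvPolynomial.aeval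
      (OnePoint.equivProjectivization (FiniteField.Extension F p k) x).rep g =
      (c : FiniteField.Extension F p k) ^ d * val x g := by
    intro g hg
    rw [← hc]
    exact aeval_smul_coords hg _ _
  have hc0 : (c : FiniteField.Extension F p k) ^ d ≠ 0 := pow_ne_zero _ c.ne_zero
  simp only [Set.mem_ofPred_eq, hv h1, hv h2, term, mul_div_mul_left _ _ hc0]
  by_cases h0 : val x f.2 = 0
  · simp [h0]
  · simp [h0, hc0]

end Characters

/-! ### Character sums over numerators coprime to a given denominator -/

section Sieve

/-- `S` is a set of representatives of the prime factors of `h`. -/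
structure IsPrimeSupport {R : Type*} [CommRing R] (S : Finset R) (h : R) : Prop where
  prime : ∀ P ∈ S, Prime P
  dvd : ∀ P ∈ S, P ∣ h
  eq_of_dvd : ∀ P ∈ S, ∀ Q ∈ S, P ∣ Q → P = Q
  exists_dvd : ∀ Q, Prime Q → Q ∣ h → ∃ P ∈ S, P ∣ Q

section UFD

variable {R : Type*} [CommRing R] [IsDomain R] [UniqueFactorizationMonoid R]

lemma exists_isPrimeSupport {h : R} (h0 : h ≠ 0) : ∃ S : Finset R, IsPrimeSupport S h := by
  classical
  let : StrongNormalizationMonoid R := UniqueFactorizationMonoid.strongNormalizationMonoid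
  refine ⟨(UniqueFactorizationMonoid.normalizedFactors h).toFinset, ?_, ?_, ?_, ?_⟩
  · intro P hP
    exact UniqueFactorizationMonoid.prime_of_normalized_factor P (Multiset.mem_toFinset.1 hP)
  · intro P hP
    exact UniqueFactorizationMonoid.dvd_of_mem_normalizedFactors (Multiset.mem_toFinset.1 hP)
  · intro P hP Q hQ hPQ
    rw [Multiset.mem_toFinset] at hP hQ
    have h1 := (UniqueFactorizationMonoid.prime_of_normalized_factor P hP).associated_of_dvd
      (UniqueFactorizationMonoid.prime_of_normalized_factor Q hQ) hPQ
    have h2 := normalize_eq_normalize_iff_associated.2 h1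
    rwa [UniqueFactorizationMonoid.normalize_normalized_factor P hP,
      UniqueFactorizationMonoid.normalize_normalized_factor Q hQ] at h2
  · intro Q hQ hQh
    obtain ⟨P, hP, hPQ⟩ :=
      UniqueFactorizationMonoid.exists_mem_normalizedFactors_of_dvd h0 hQ.irreducible hQh
    exact ⟨P, Multiset.mem_toFinset.2 hP, hPQ.symm.dvd⟩

namespace IsPrimeSupport

variable {S : Finset R} {h : R}

lemma isRelPrime_iff (hS : IsPrimeSupport S h) (h0 : h ≠ 0) (g : R) : IsRelPrime g h ↔ ∀ P ∈ S, ¬ P ∣ g := by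
  rw [isRelPrime_comm, UniqueFactorizationMonoid.isRelPrime_iff_no_prime_factors h0]
  constructor
  · intro H P hP hPg
    exact H (hS.dvd P hP) hPg (hS.prime P hP)
  · intro H Q hQh hQg hQ
    obtain ⟨P, hP, hPQ⟩ := hS.exists_dvd Q hQ hQh
    exact H P hP (hPQ.trans hQg)

lemma prod_dvd_iff (hS : IsPrimeSupport S h) {T : Finset R} (hT : T ⊆ S) (g : R) : ∏ P ∈ T, P ∣ g ↔ ∀ P ∈ T, P ∣ g := by
  refine ⟨fun H P hP => (Finset.dvd_prod_of_mem _ hP).trans H, fun H => ?_⟩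
  refine Finset.prod_dvd_of_isRelPrime (fun P hP Q hQ hne => ?_) H
  rw [Function.onFun, (hS.prime P (hT hP)).irreducible.isRelPrime_iff_not_dvd]
  exact fun hd => hne (hS.eq_of_dvd P (hT hP) Q (hT hQ) hd)

lemma subset_of_prod_eq (hS : IsPrimeSupport S h) {T U : Finset R} (hT : T ⊆ S) (hU : U ⊆ S)
    (h : ∏ P ∈ T, P = ∏ P ∈ U, P) : T ⊆ U := by
  intro P hP
  obtain ⟨Q, hQ, hPQ⟩ := (hS.prime P (hT hP)).exists_mem_finset_dvd
    (h ▸ Finset.dvd_prod_of_mem (fun P => P) hP)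
  rwa [hS.eq_of_dvd P (hT hP) Q (hU hQ) hPQ]

lemma eq_of_prod_eq (hS : IsPrimeSupport S h) {T U : Finset R} (hT : T ⊆ S) (hU : U ⊆ S)
    (h : ∏ P ∈ T, P = ∏ P ∈ U, P) : T = U :=
  (hS.subset_of_prod_eq hT hU h).antisymm (hS.subset_of_prod_eq hU hT h.symm)

open scoped Classical in
-- Expansion of the product of 1 - [P ∣ g] over the primes P of h: a Möbius inversion over
-- square-free divisors, indexed by sets of primes.
lemma ite_isRelPrime (hS : IsPrimeSupport S h) (h0 : h ≠ 0) (g : R) : (if IsRelPrime g h then (1 : ℂ) else 0) =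
    ∑ T ∈ S.powerset, (-1) ^ T.card * (if ∏ P ∈ T, P ∣ g then 1 else 0) := by
  have h1 : (if IsRelPrime g h then (1 : ℂ) else 0) =
      ∏ P ∈ S, (-(if P ∣ g then 1 else 0) + 1) := by
    have h2 : ∀ P ∈ S, (-(if P ∣ g then (1 : ℂ) else 0) + 1) = if ¬ P ∣ g then 1 else 0 := by
      intro P _
      split_ifs <;> simp_all
    rw [Finset.prod_congr rfl h2, Finset.prod_ite_zero, Finset.prod_const_one]
    simp only [hS.isRelPrime_iff h0]
  rw [h1, Finset.prod_add]
  refine Finset.sum_congr rfl fun T hT => ?_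
  rw [Finset.prod_const_one, mul_one, Finset.prod_neg, Finset.prod_ite_zero,
    Finset.prod_const_one]
  simp only [hS.prod_dvd_iff (Finset.mem_powerset.1 hT)]

end IsPrimeSupport

end UFD

variable {F : Type*} [Field F] [Finite F]

/-- Translation by g₀ permutes the forms of degree n and multiplies the sum by Φ(D g₀) ≠ 1. -/
lemma sum_forms_eq_zero (Φ : AddChar (MvPolynomial (Fin 2) F) ℂ) (D : MvPolynomial (Fin 2) F)
    {n : ℕ} (h : ∃ g : MvPolynomial (Fin 2) F, g.IsHomogeneous n ∧ Φ (D * g) ≠ 1) :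
    ∑ g ∈ forms F n, Φ (D * g) = 0 := by
  obtain ⟨g₀, hg₀, hne⟩ := h
  have h1 : ∑ g ∈ forms F n, Φ (D * g) = Φ (D * g₀) * ∑ g ∈ forms F n, Φ (D * g) := by
    rw [Finset.mul_sum]
    refine Finset.sum_bij' (fun g _ => g - g₀) (fun g _ => g + g₀) ?_ ?_ ?_ ?_ ?_
    · exact fun g hg => mem_forms.2 ((mem_forms.1 hg).sub hg₀)
    · exact fun g hg => mem_forms.2 ((mem_forms.1 hg).add hg₀)
    · simp
    · simp
    · intro g _
      rw [← AddChar.map_add_eq_mul, ← mul_add]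
      simp
  have h2 : (1 - Φ (D * g₀)) * ∑ g ∈ forms F n, Φ (D * g) = 0 := by linear_combination h1
  exact (mul_eq_zero.1 h2).resolve_left (sub_ne_zero.2 hne.symm)

/-- `Φ` is nontrivial on the multiples of degree `d` of every divisor of `h` of codimension at least
`m`. -/
def NontrivialOnMultiples (Φ : AddChar (MvPolynomial (Fin 2) F) ℂ) (h : MvPolynomial (Fin 2) F)
    (m : ℕ) : Prop :=
  ∀ D, D ∣ h → ∀ n, m ≤ n + 1 → ∃ g : MvPolynomial (Fin 2) F, g.IsHomogeneous n ∧ Φ (D * g) ≠ 1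

open scoped Classical in
lemma sum_isRelPrime_eq {d : ℕ} {h : MvPolynomial (Fin 2) F} (hh : h.IsHomogeneous d)
    (h0 : h ≠ 0) {S : Finset (MvPolynomial (Fin 2) F)} (hS : IsPrimeSupport S h)
    (Φ : AddChar (MvPolynomial (Fin 2) F) ℂ) :
    ∑ g ∈ (forms F d).filter (IsRelPrime · h), Φ g =
      ∑ T ∈ S.powerset, (-1) ^ T.card *
        ∑ g ∈ forms F (d - (∏ P ∈ T, P).totalDegree), Φ ((∏ P ∈ T, P) * g) := by
  have h1 : ∀ g, (if IsRelPrime g h then Φ g else 0) =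
      ∑ T ∈ S.powerset, (-1) ^ T.card * (if ∏ P ∈ T, P ∣ g then Φ g else 0) := by
    intro g
    rw [← mul_boole, mul_comm, hS.ite_isRelPrime h0, Finset.sum_mul]
    refine Finset.sum_congr rfl fun T _ => ?_
    rw [mul_assoc, boole_mul]
  rw [Finset.sum_filter, Finset.sum_congr rfl fun g _ => h1 g, Finset.sum_comm]
  refine Finset.sum_congr rfl fun T hT => ?_
  rw [← Finset.mul_sum, ← Finset.sum_filter]
  have hTh : ∏ P ∈ T, P ∣ h := (hS.prod_dvd_iff (Finset.mem_powerset.1 hT) h).2 fun P hP =>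
    hS.dvd P (Finset.mem_powerset.1 hT hP)
  have hT0 := ne_zero_of_dvd_ne_zero h0 hTh
  have hThom := isHomogeneous_of_dvd hh h0 hTh
  rw [forms_filter_dvd (degree_le_of_dvd hThom hh h0 hTh) hThom hT0,
    Finset.sum_image fun a _ b _ hab => mul_right_injective₀ hT0 hab]

/-- If the radical of h has small degree, every square-free divisor leaves enough room for the
character to be nontrivial on its multiples, and each sieve term vanishes. -/
lemma sum_isRelPrime_eq_zero {d m : ℕ} {h : MvPolynomial (Fin 2) F} (hh : h.IsHomogeneous d)
    (h0 : h ≠ 0) {S : Finset (MvPolynomial (Fin 2) F)} (hS : IsPrimeSupport S h)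
    {Φ : AddChar (MvPolynomial (Fin 2) F) ℂ} (hΦ : NontrivialOnMultiples Φ h m)
    (hdeg : m + ∑ P ∈ S, P.totalDegree ≤ d + 1) :
    open scoped Classical in ∑ g ∈ (forms F d).filter (IsRelPrime · h), Φ g = 0 := by
  rw [sum_isRelPrime_eq hh h0 hS]
  refine Finset.sum_eq_zero fun T hT => ?_
  rw [Finset.mem_powerset] at hT
  have hTh : ∏ P ∈ T, P ∣ h := (hS.prod_dvd_iff hT h).2 fun P hP => hS.dvd P (hT hP)
  have h1 : (∏ P ∈ T, P).totalDegree ≤ ∑ P ∈ S, P.totalDegree :=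
    (MvPolynomial.totalDegree_finsetProd _ _).trans (Finset.sum_le_sum_of_subset hT)
  rw [sum_forms_eq_zero Φ _ (hΦ _ hTh _ (by lia)), mul_zero]

/-- Only divisors with d - deg D + 1 < m survive. Each contributes at most q^m, the number of
numerators left, and there are at most q^{m+1} of them, since they are determined by their cofactors
in the radical, forms of degree below m. The bound does not involve the number of primes of h. -/
lemma norm_sum_isRelPrime_le {d m : ℕ} {h : MvPolynomial (Fin 2) F} (hh : h.IsHomogeneous d)
    (h0 : h ≠ 0) {Φ : AddChar (MvPolynomial (Fin 2) F) ℂ} (hΦ1 : ∀ g, ‖Φ g‖ ≤ 1)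
    (hΦ : NontrivialOnMultiples Φ h m) :
    ‖open scoped Classical in ∑ g ∈ (forms F d).filter (IsRelPrime · h), Φ g‖ ≤
      (Nat.card F : ℝ) ^ (2 * m + 1) := by
  classical
  obtain ⟨S, hS⟩ := exists_isPrimeSupport h0
  have hq : 1 ≤ Nat.card F := Nat.card_pos
  have hq2 : 2 ≤ Nat.card F := Finite.one_lt_card
  have hdvd : ∀ T ⊆ S, ∏ P ∈ T, P ∣ h := fun T hT =>
    (hS.prod_dvd_iff hT h).2 fun P hP => hS.dvd P (hT hP)
  have hhom : ∀ T ⊆ S, (∏ P ∈ T, P).IsHomogeneous (∏ P ∈ T, P).totalDegree := fun T hT =>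
    isHomogeneous_of_dvd hh h0 (hdvd T hT)
  rw [sum_isRelPrime_eq hh h0 hS]
  set 𝒯 := S.powerset.filter fun T => d - (∏ P ∈ T, P).totalDegree + 1 < m with h𝒯
  have h1 : ∀ T ∈ S.powerset, ‖(-1 : ℂ) ^ T.card *
      ∑ g ∈ forms F (d - (∏ P ∈ T, P).totalDegree), Φ ((∏ P ∈ T, P) * g)‖ ≤
      if d - (∏ P ∈ T, P).totalDegree + 1 < m then (Nat.card F : ℝ) ^ m else 0 := by
    intro T hT
    rw [Finset.mem_powerset] at hT
    split_ifs with hm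
    · rw [norm_mul, norm_pow, norm_neg, norm_one, one_pow, one_mul]
      refine (norm_sum_le_of_le _ fun g _ => hΦ1 _).trans ?_
      rw [Finset.sum_const, card_forms, nsmul_eq_mul, mul_one]
      push_cast
      exact pow_le_pow_right₀ (by exact_mod_cast hq) hm.le
    · rw [sum_forms_eq_zero Φ _ (hΦ _ (hdvd T hT) _ (by lia)), mul_zero, norm_zero]
  refine (norm_sum_le_of_le _ h1).trans ?_
  rw [← Finset.sum_filter, Finset.sum_const, nsmul_eq_mul]
  -- The complementary product determines T, and its degree is at most d minus that of the product
  -- over T.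
  have h2 : 𝒯.card ≤ ((Finset.range m).biUnion fun i => forms F i).card := by
    refine Finset.card_le_card_of_injOn (fun T => ∏ P ∈ S \ T, P) ?_ ?_
    · intro T hT
      rw [Finset.mem_coe, Finset.mem_filter, Finset.mem_powerset] at hT
      have h3 := (hhom (S \ T) Finset.sdiff_subset).mul (hhom T hT.1)
      rw [Finset.prod_sdiff hT.1] at h3
      have h4 := degree_le_of_dvd h3 hh h0 (hdvd S Finset.Subset.rfl)
      refine Finset.mem_coe.2 (Finset.mem_biUnion.2 ⟨_, Finset.mem_range.2 ?_,
        mem_forms.2 (hhom _ Finset.sdiff_subset)⟩)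
      lia
    · intro T hT U hU hTU
      rw [Finset.mem_coe, Finset.mem_filter, Finset.mem_powerset] at hT hU
      have h3 := hS.eq_of_prod_eq Finset.sdiff_subset Finset.sdiff_subset hTU
      rw [← Finset.sdiff_sdiff_eq_self hT.1, h3, Finset.sdiff_sdiff_eq_self hU.1]
  have h3 : ((Finset.range m).biUnion fun i => forms F i).card ≤ Nat.card F ^ (m + 1) := by
    refine Finset.card_biUnion_le.trans ?_
    simp only [card_forms]
    clear * - hq2
    induction m with
    | zero => simp
    | succ m ih =>
      rw [Finset.sum_range_succ, pow_succ _ (m + 1)]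
      have := Nat.mul_le_mul_left (Nat.card F ^ (m + 1)) hq2
      lia
  calc ((𝒯.card : ℕ) : ℝ) * (Nat.card F : ℝ) ^ m
      ≤ (Nat.card F : ℝ) ^ (m + 1) * (Nat.card F : ℝ) ^ m := by
        gcongr
        exact_mod_cast h2.trans h3
    _ = (Nat.card F : ℝ) ^ (2 * m + 1) := by ring

end Sieve

/-! ### Representatives of the prime forms up to constants -/

section LowerBound

variable {F : Type*} [Field F] {E : Type*} [Field E] [Algebra F E]

/-- At an affine point the minimal polynomial divides the dehomogenization; vanishing at ∞ means
that the degree drops, which yields a factor Z. -/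
lemma ptForm_dvd [Finite E] {x : OnePoint E} {d : ℕ} {h : MvPolynomial (Fin 2) F}
    (hh : h.IsHomogeneous d) (hx : val x h = 0) : ptForm F x ∣ h := by
  rcases eq_or_ne h 0 with rfl | h0
  · exact dvd_zero _
  set H := dehomogenize h with hH
  have hHh : H.homogenize d = h := homogenize_dehomogenize hh
  have hdeg : H.natDegree ≤ d := natDegree_dehomogenize_le hh
  have hH0 : H ≠ 0 := by
    rintro h1
    rw [h1, Polynomial.homogenize_zero] at hHh
    exact h0 hHh.symm
  induction x using OnePoint.rec with
  | infty =>
    rw [← hHh, val_infty_homogenize, FaithfulSMul.algebraMap_eq_zero_iff] at hx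
    have hlt : H.natDegree < d := by
      refine lt_of_le_of_ne hdeg fun h1 => hH0 ?_
      rwa [← h1, Polynomial.coeff_natDegree, Polynomial.leadingCoeff_eq_zero] at hx
    have h1 := Polynomial.homogenize_mul (1 : Polynomial F) H (m := 1) (n := d - 1) (by simp)
      (by lia)
    rw [one_mul, Nat.add_sub_cancel' (by lia), hHh, Polynomial.homogenize_one, pow_one] at h1
    exact ⟨_, h1⟩
  | coe a =>
    have ha : IsIntegral F a := Algebra.IsIntegral.isIntegral a
    rw [← hHh, val_some_homogenize hdeg] at hx
    obtain ⟨G, hG⟩ := minpoly.dvd F a hx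
    have hG0 : G ≠ 0 := by
      rintro rfl
      exact hH0 (by rw [hG, mul_zero])
    have h2 := Polynomial.natDegree_mul (minpoly.ne_zero ha) hG0
    rw [← hG] at h2
    have h1 := Polynomial.homogenize_mul (minpoly F a) G (m := (minpoly F a).natDegree)
      (n := d - (minpoly F a).natDegree) le_rfl (by lia)
    rw [← hG, Nat.add_sub_cancel' (by lia), hHh] at h1
    exact ⟨_, h1⟩

lemma X_one_dvd [Finite F] {d : ℕ} {h : MvPolynomial (Fin 2) F} (hh : h.IsHomogeneous d)
    (hx : val (OnePoint.infty : OnePoint F) h = 0) : MvPolynomial.X 1 ∣ h := by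
  have h1 := ptForm_dvd hh hx
  exact h1

lemma ptForm_zero : ptForm F ((0 : F) : OnePoint F) = MvPolynomial.X 0 := by
  change (minpoly F (0 : F)).homogenize _ = _
  rw [minpoly.zero]
  simp

lemma X_zero_dvd [Finite F] {d : ℕ} {h : MvPolynomial (Fin 2) F} (hh : h.IsHomogeneous d)
    (hx : val ((0 : F) : OnePoint F) h = 0) : MvPolynomial.X 0 ∣ h := by
  have h1 := ptForm_dvd hh hx
  rwa [ptForm_zero] at h1

variable [Finite F]

open scoped Classical in
/-- Linear forms that represent all prime forms of degree one. -/
def linearForms (F : Type*) [Field F] [Finite F] : Finset (MvPolynomial (Fin 2) F) :=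
  let := Fintype.ofFinite F
  insert (MvPolynomial.X 1)
    (Finset.univ.image fun a : F => MvPolynomial.X 0 + MvPolynomial.C a * MvPolynomial.X 1)

open scoped Classical in
/-- Normalized forms of degree `r` without zeros at `0` and `∞`; they represent all prime forms of
degree `r ≥ 2`. -/
def normalizedForms (F : Type*) [Field F] [Finite F] (r : ℕ) :
    Finset (MvPolynomial (Fin 2) F) :=
  let := Fintype.ofFinite F
  ((Finset.univ.erase (0 : F)) ×ˢ forms F (r - 2)).image fun a =>
    MvPolynomial.X 0 ^ r + MvPolynomial.C a.1 * MvPolynomial.X 1 ^ r +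
      MvPolynomial.X 0 * MvPolynomial.X 1 * a.2

lemma card_linearForms_le : (linearForms F).card ≤ Nat.card F + 1 := by
  classical
  let := Fintype.ofFinite F
  refine (Finset.card_insert_le _ _).trans ?_
  gcongr
  refine Finset.card_image_le.trans ?_
  rw [Finset.card_univ, Nat.card_eq_fintype_card]

lemma card_normalizedForms_le {r : ℕ} (hr : 2 ≤ r) :
    (normalizedForms F r).card ≤ (Nat.card F - 1) * Nat.card F ^ (r - 1) := by
  classical
  let := Fintype.ofFinite F
  refine Finset.card_image_le.trans ?_
  rw [Finset.card_product, card_forms, Finset.card_erase_of_mem (Finset.mem_univ _),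
    Finset.card_univ, ← Nat.card_eq_fintype_card, show r - 2 + 1 = r - 1 by lia]

lemma linearForms_spec {P : MvPolynomial (Fin 2) F} (hP : P ∈ linearForms F) :
    P.IsHomogeneous 1 ∧ P ≠ 0 := by
  classical
  let := Fintype.ofFinite F
  rw [linearForms, Finset.mem_insert, Finset.mem_image] at hP
  rcases hP with rfl | ⟨a, -, rfl⟩
  · exact ⟨MvPolynomial.isHomogeneous_X _ _, MvPolynomial.X_ne_zero _⟩
  · refine ⟨(MvPolynomial.isHomogeneous_X _ _).add (MvPolynomial.isHomogeneous_C_mul_X _ _), ?_⟩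
    intro h
    simpa [val, coords] using congrArg (val (OnePoint.infty : OnePoint F)) h

lemma normalizedForms_spec {r : ℕ} (hr : 2 ≤ r) {P : MvPolynomial (Fin 2) F}
    (hP : P ∈ normalizedForms F r) : P.IsHomogeneous r ∧ P ≠ 0 := by
  classical
  let := Fintype.ofFinite F
  rw [normalizedForms, Finset.mem_image] at hP
  obtain ⟨⟨a, Q⟩, hQ, rfl⟩ := hP
  rw [Finset.mem_product, mem_forms] at hQ
  refine ⟨?_, ?_⟩
  · refine ((MvPolynomial.isHomogeneous_X_pow _ _).add
      (MvPolynomial.isHomogeneous_C_mul_X_pow _ _ _)).add ?_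
    have h := ((MvPolynomial.isHomogeneous_X F (0 : Fin 2)).mul
      (MvPolynomial.isHomogeneous_X F (1 : Fin 2))).mul hQ.2
    rwa [show 1 + 1 + (r - 2) = r by lia] at h
  · intro h
    simpa [val, coords, show r ≠ 0 by lia] using
      congrArg (val (OnePoint.infty : OnePoint F)) h

lemma associated_C_mul {c : F} (hc : c ≠ 0) (P : MvPolynomial (Fin 2) F) :
    Associated P (MvPolynomial.C c * P) := by
  rw [mul_comm]
  exact ⟨(IsUnit.map MvPolynomial.C (isUnit_iff_ne_zero.2 hc)).unit, rfl⟩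

lemma val_C (x : OnePoint F) (b : F) : val x (MvPolynomial.C b : MvPolynomial (Fin 2) F) = b := by
  simp [val]

/-- With a the value of P at 0, the difference P - X^r - aZ^r vanishes at 0 and ∞ and is therefore
divisible by XZ. -/
lemma exists_eq_of_val_infty_eq_one {P : MvPolynomial (Fin 2) F} {r : ℕ} (hr : P.IsHomogeneous r)
    (hr1 : r ≠ 0) (h1 : val (OnePoint.infty : OnePoint F) P = 1) :
    ∃ Q : MvPolynomial (Fin 2) F, P = MvPolynomial.X 0 ^ r +
      MvPolynomial.C (val ((0 : F) : OnePoint F) P) * MvPolynomial.X 1 ^ r +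
        MvPolynomial.X 0 * MvPolynomial.X 1 * Q ∧ Q.IsHomogeneous (r - 2) ∧ (r = 1 → Q = 0) := by
  set a := val ((0 : F) : OnePoint F) P with ha
  set R : MvPolynomial (Fin 2) F := P -
    (MvPolynomial.X 0 ^ r + MvPolynomial.C a * MvPolynomial.X 1 ^ r) with hR
  have hRhom : R.IsHomogeneous r := hr.sub ((MvPolynomial.isHomogeneous_X_pow _ _).add
    (MvPolynomial.isHomogeneous_C_mul_X_pow _ _ _))
  have hRinf : val (OnePoint.infty : OnePoint F) R = 0 := by
    rw [hR, map_sub, h1]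
    simp [val, coords, hr1]
  have hR0 : val ((0 : F) : OnePoint F) R = 0 := by
    rw [hR, map_sub, ← ha]
    simp [val, coords, hr1]
  obtain ⟨R₁, hR₁⟩ : MvPolynomial.X 1 ∣ R := X_one_dvd hRhom hRinf
  have hX0 : (MvPolynomial.X 0 : MvPolynomial (Fin 2) F) ∣ R :=
    X_zero_dvd hRhom hR0
  rw [hR₁] at hX0
  obtain ⟨Q, hQ⟩ := ((MvPolynomial.X_prime (i := (0 : Fin 2))).dvd_or_dvd hX0).resolve_left (by
    rw [MvPolynomial.X_dvd_X]
    simp)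
  have h3 : (MvPolynomial.X 1 * MvPolynomial.X 0 * Q : MvPolynomial (Fin 2) F).IsHomogeneous r := by
    rw [mul_assoc, ← hQ, ← hR₁]
    exact hRhom
  have h4 : (MvPolynomial.X 1 * MvPolynomial.X 0 : MvPolynomial (Fin 2) F).IsHomogeneous 2 :=
    (MvPolynomial.isHomogeneous_X F (1 : Fin 2)).mul (MvPolynomial.isHomogeneous_X F (0 : Fin 2))
  have h5 : (MvPolynomial.X 1 * MvPolynomial.X 0 : MvPolynomial (Fin 2) F) ≠ 0 :=
    mul_ne_zero (MvPolynomial.X_ne_zero _) (MvPolynomial.X_ne_zero _)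
  refine ⟨Q, ?_, isHomogeneous_of_mul_right h4 h5 h3, fun hr1 => ?_⟩
  · rw [hQ] at hR₁
    rw [← sub_eq_iff_eq_add', ← hR, hR₁]
    ring
  · by_contra hQ0
    have := degree_le_of_dvd h4 h3 (mul_ne_zero h5 hQ0) (dvd_mul_right _ _)
    lia

lemma X_one_mem_linearForms : MvPolynomial.X 1 ∈ linearForms F := by
  classical
  let := Fintype.ofFinite F
  rw [linearForms, Finset.mem_insert]
  exact Or.inl rfl

lemma X_zero_add_mem_linearForms (a : F) :
    MvPolynomial.X 0 + MvPolynomial.C a * MvPolynomial.X 1 ∈ linearForms F := by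
  classical
  let := Fintype.ofFinite F
  rw [linearForms, Finset.mem_insert, Finset.mem_image]
  exact Or.inr ⟨a, Finset.mem_univ _, rfl⟩

lemma degree_ne_zero_of_prime {P : MvPolynomial (Fin 2) F} {r : ℕ} (hP : Prime P)
    (hr : P.IsHomogeneous r) : r ≠ 0 := by
  rintro rfl
  rw [← MvPolynomial.totalDegree_zero_iff_isHomogeneous,
    MvPolynomial.totalDegree_eq_zero_iff_eq_C] at hr
  refine hP.not_isUnit ?_
  rw [hr]
  refine IsUnit.map MvPolynomial.C (isUnit_iff_ne_zero.2 fun h => hP.ne_zero ?_)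
  rw [hr, h, map_zero]

/-- Every prime form is associated to a linear form or to a normalized form. -/
lemma exists_associated_of_prime {P : MvPolynomial (Fin 2) F} {r : ℕ} (hP : Prime P)
    (hr : P.IsHomogeneous r) : (∃ Q ∈ linearForms F, Associated Q P) ∨
      (2 ≤ r ∧ ∃ Q ∈ normalizedForms F r, Associated Q P) := by
  classical
  let := Fintype.ofFinite F
  have hr1 := degree_ne_zero_of_prime hP hr
  by_cases h1 : val (OnePoint.infty : OnePoint F) P = 0
  · exact Or.inl ⟨_, X_one_mem_linearForms,
      (MvPolynomial.X_prime (i := (1 : Fin 2))).associated_of_dvd hP (X_one_dvd hr h1)⟩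
  by_cases h2 : val ((0 : F) : OnePoint F) P = 0
  · refine Or.inl ⟨_, X_zero_add_mem_linearForms 0, ?_⟩
    rw [map_zero, zero_mul, add_zero]
    refine (MvPolynomial.X_prime (i := (0 : Fin 2))).associated_of_dvd hP (X_zero_dvd hr h2)
  -- Scaling by the inverse of the value at ∞ makes the coefficient of X^r equal to 1.
  have hassoc := (associated_C_mul (inv_ne_zero h1) P).symm
  set P₁ := MvPolynomial.C (val (OnePoint.infty : OnePoint F) P)⁻¹ * P with hP₁
  have hhom : P₁.IsHomogeneous r := hr.C_mul _
  obtain ⟨Q, hQ, hQhom, hQ1⟩ := exists_eq_of_val_infty_eq_one hhom hr1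
    (by rw [hP₁, map_mul, val_C, inv_mul_cancel₀ h1])
  have ha0 : val ((0 : F) : OnePoint F) P₁ ≠ 0 := by
    rw [hP₁, map_mul, val_C]
    exact mul_ne_zero (inv_ne_zero h1) h2
  generalize val ((0 : F) : OnePoint F) P₁ = a at ha0 hQ
  rcases Nat.lt_or_ge r 2 with hr2 | hr2
  · refine Or.inl ⟨_, X_zero_add_mem_linearForms a, ?_⟩
    rw [hQ1 (by lia), show r = 1 by lia, mul_zero, add_zero, pow_one, pow_one] at hQ
    rwa [← hQ]
  · refine Or.inr ⟨hr2, P₁, ?_, hassoc⟩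
    rw [normalizedForms, Finset.mem_image]
    refine ⟨(a, Q), ?_, hQ.symm⟩
    simp [ha0, hQhom]

end LowerBound

/-! ### Positive density of the ordinary family -/

section OrdinaryCount

variable {F : Type*} [Field F] [Finite F]

open scoped Classical in
/-- The pairs of coprime forms of degree `d` whose denominator satisfies `H`. -/
def family (d : ℕ) (H : MvPolynomial (Fin 2) F → Prop) : Finset (FormPair F) :=
  (forms F d ×ˢ forms F d).filter fun f => H f.2 ∧ IsRelPrime f.1 f.2

lemma mem_family {d : ℕ} {H : MvPolynomial (Fin 2) F → Prop} {f : FormPair F} :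
    f ∈ family d H ↔ (f.1.IsHomogeneous d ∧ f.2.IsHomogeneous d) ∧ H f.2 ∧ IsRelPrime f.1 f.2 := by
  classical
  rw [family, Finset.mem_filter, Finset.mem_product, mem_forms, mem_forms]

open scoped Classical in
/-- Pairs for which `P` obstructs membership in the ordinary family. -/
def obstructed (d : ℕ) (P : MvPolynomial (Fin 2) F) : Finset (FormPair F) :=
  forms F d ×ˢ (forms F d).filter (fun h => P * P ∣ h ∧ h ≠ 0) ∪
    (forms F d).filter (P ∣ ·) ×ˢ (forms F d).filter (P ∣ ·)

lemma mem_obstructed {d : ℕ} {P : MvPolynomial (Fin 2) F} {f : FormPair F} :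
    f ∈ obstructed d P ↔ (f.1.IsHomogeneous d ∧ f.2.IsHomogeneous d) ∧
      ((P * P ∣ f.2 ∧ f.2 ≠ 0) ∨ (P ∣ f.1 ∧ P ∣ f.2)) := by
  classical
  rw [obstructed, Finset.mem_union, Finset.mem_product, Finset.mem_product, Finset.mem_filter,
    Finset.mem_filter, Finset.mem_filter, mem_forms, mem_forms]
  tauto

/-- Both obstructions, P² dividing h and P dividing g and h, have density at most q^{-2r}. Excluding
h = 0 makes the first one empty when 2r > d. -/
lemma card_obstructed_le {d r : ℕ} (hr : r ≤ d) {P : MvPolynomial (Fin 2) F}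
    (hP : P.IsHomogeneous r) (hP0 : P ≠ 0) :
    (obstructed d P).card ≤ 2 * Nat.card F ^ (2 * (d + 1 - r)) := by
  classical
  refine (Finset.card_union_le _ _).trans ?_
  rw [two_mul]
  refine add_le_add ?_ ?_
  · rw [Finset.card_product, card_forms]
    rcases Nat.lt_or_ge d (2 * r) with h | h
    · have h1 : (forms F d).filter (fun h => P * P ∣ h ∧ h ≠ 0) = ∅ := by
        refine Finset.filter_eq_empty_iff.2 fun g hg hd => ?_
        have := degree_le_of_dvd (hP.mul hP) (mem_forms.1 hg) hd.2 hd.1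
        lia
      rw [h1]
      simp
    · have h1 : ((forms F d).filter (fun h => P * P ∣ h ∧ h ≠ 0)).card ≤
          Nat.card F ^ (d - (r + r) + 1) := by
        rw [← card_forms_filter_dvd (by lia) (hP.mul hP) (mul_ne_zero hP0 hP0)]
        exact Finset.card_le_card (Finset.monotone_filter_right _ fun g _ hg => hg.1)
      refine (Nat.mul_le_mul_left _ h1).trans ?_
      rw [← pow_add]
      exact Nat.pow_le_pow_right Nat.card_pos (by lia)
  · rw [Finset.card_product, card_forms_filter_dvd hr hP hP0, ← pow_add]
    exact Nat.pow_le_pow_right Nat.card_pos (by lia)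

/-- Inclusion-exclusion: a proportion of about 1/q of the pairs obstructed in one way is obstructed
in both. Without the resulting saving q^{2d-1} the union bound would fail for q = 3. -/
lemma card_obstructed_linear_le {d : ℕ} (hd : 2 ≤ d) {P : MvPolynomial (Fin 2) F}
    (hP : P.IsHomogeneous 1) (hP0 : P ≠ 0) :
    (obstructed d P).card + Nat.card F ^ (2 * d - 1) ≤ 2 * Nat.card F ^ (2 * d) := by
  classical
  set A : Finset (FormPair F) :=
    forms F d ×ˢ (forms F d).filter (fun h => P * P ∣ h ∧ h ≠ 0) with hA
  set B : Finset (FormPair F) :=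
    (forms F d).filter (P ∣ ·) ×ˢ (forms F d).filter (P ∣ ·) with hB
  have h1 : (obstructed d P).card + (A ∩ B).card = A.card + B.card :=
    Finset.card_union_add_card_inter A B
  have hsq : ((forms F d).filter (fun h => P * P ∣ h ∧ h ≠ 0)).card + 1 =
      Nat.card F ^ (d - 1) := by
    have h2 := card_forms_filter_dvd (d := d) (by lia) (hP.mul hP) (mul_ne_zero hP0 hP0)
    rw [show d - (1 + 1) + 1 = d - 1 by lia] at h2
    have h0 : (0 : MvPolynomial (Fin 2) F) ∈ (forms F d).filter (P * P ∣ ·) := by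
      rw [Finset.mem_filter, mem_forms]
      exact ⟨MvPolynomial.isHomogeneous_zero _ _ _, dvd_zero _⟩
    rw [← h2, ← Finset.card_erase_add_one h0]
    congr 2
    ext g
    simp only [Finset.mem_filter, Finset.mem_erase]
    tauto
  have hdiv : ((forms F d).filter (P ∣ ·)).card = Nat.card F ^ d := by
    rw [card_forms_filter_dvd (by lia) hP hP0, Nat.sub_add_cancel (by lia)]
  have hA' : A.card + Nat.card F ^ (d + 1) = Nat.card F ^ (2 * d) := by
    rw [hA, Finset.card_product, card_forms, ← mul_add_one, hsq, ← pow_add]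
    congr 1
    lia
  have hB' : B.card = Nat.card F ^ (2 * d) := by
    rw [hB, Finset.card_product, hdiv, ← pow_add, two_mul]
  have hAB : (forms F d).filter (P ∣ ·) ×ˢ (forms F d).filter (fun h => P * P ∣ h ∧ h ≠ 0) ⊆
      A ∩ B := by
    intro f hf
    rw [Finset.mem_product, Finset.mem_filter, Finset.mem_filter] at hf
    rw [Finset.mem_inter, hA, hB, Finset.mem_product, Finset.mem_product, Finset.mem_filter,
      Finset.mem_filter, Finset.mem_filter]
    have := (dvd_mul_right P P).trans hf.2.2.1
    tauto
  have h3 := Finset.card_le_card hAB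
  rw [Finset.card_product, hdiv] at h3
  have h4 : Nat.card F ^ d * (((forms F d).filter (fun h => P * P ∣ h ∧ h ≠ 0)).card + 1) =
      Nat.card F ^ (2 * d - 1) := by
    rw [hsq, ← pow_add]
    congr 1
    lia
  rw [mul_add_one] at h4
  have h5 : Nat.card F ^ d ≤ Nat.card F ^ (d + 1) :=
    Nat.pow_le_pow_right Nat.card_pos (Nat.le_succ d)
  lia

/-- Degree r contributes at most 2(q - 1)q^{2d+1-r}, and this telescopes. The leftover 2q^{d+1}
later absorbs the pairs with h = 0. -/
lemma sum_card_obstructed_normalized_le {d : ℕ} (hd : 1 ≤ d) :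
    ∑ r ∈ Finset.Icc 2 d, ∑ P ∈ normalizedForms F r, (obstructed d P).card +
      2 * Nat.card F ^ (d + 1) ≤ 2 * Nat.card F ^ (2 * d) := by
  have hq : 1 ≤ Nat.card F := Nat.card_pos
  have h1 : ∀ r ∈ Finset.Icc 2 d, ∑ P ∈ normalizedForms F r, (obstructed d P).card ≤
      2 * ((Nat.card F - 1) * Nat.card F ^ (2 * d + 1 - r)) := by
    intro r hr
    rw [Finset.mem_Icc] at hr
    have h2 : ∀ P ∈ normalizedForms F r,
        (obstructed d P).card ≤ 2 * Nat.card F ^ (2 * (d + 1 - r)) := fun P hP =>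
      card_obstructed_le hr.2 (normalizedForms_spec hr.1 hP).1 (normalizedForms_spec hr.1 hP).2
    refine (Finset.sum_le_card_nsmul _ _ _ h2).trans ?_
    rw [smul_eq_mul]
    refine (Nat.mul_le_mul_right _ (card_normalizedForms_le hr.1)).trans (le_of_eq ?_)
    rw [show 2 * d + 1 - r = (r - 1) + 2 * (d + 1 - r) by lia, pow_add]
    ring
  have h2 : ∀ j, 1 ≤ j → j ≤ d → ∑ r ∈ Finset.Icc 2 j,
      2 * ((Nat.card F - 1) * Nat.card F ^ (2 * d + 1 - r)) + 2 * Nat.card F ^ (2 * d + 1 - j) =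
        2 * Nat.card F ^ (2 * d) := by
    intro j hj
    induction j, hj using Nat.le_induction with
    | base => intro _; simp
    | succ j hj ih =>
      intro hjd
      rw [← ih (by lia), Finset.sum_Icc_succ_top (by lia), add_assoc]
      congr 1
      rw [show 2 * d + 1 - j = (2 * d + 1 - (j + 1)) + 1 by lia, pow_succ,
        ← mul_add, ← add_one_mul, Nat.sub_add_cancel hq, mul_comm (Nat.card F)]
  have h3 := h2 d hd le_rfl
  rw [show 2 * d + 1 - d = d + 1 by lia] at h3
  have h4 := Finset.sum_le_sum h1
  lia

lemma not_mem_family_squarefree {d : ℕ} {f : FormPair F} (h1 : f.1.IsHomogeneous d)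
    (h2 : f.2.IsHomogeneous d) (h0 : f.2 ≠ 0) (hf : f ∉ family d Squarefree) :
    (∃ P ∈ linearForms F, f ∈ obstructed d P) ∨
      ∃ r ∈ Finset.Icc 2 d, ∃ P ∈ normalizedForms F r, f ∈ obstructed d P := by
  obtain ⟨Q, hQ, hQd⟩ : ∃ Q, Prime Q ∧ ((Q * Q ∣ f.2) ∨ (Q ∣ f.1 ∧ Q ∣ f.2)) := by
    by_contra! hcon
    refine hf (mem_family.2 ⟨⟨h1, h2⟩, ?_, ?_⟩)
    · rw [squarefree_iff_irreducible_sq_not_dvd_of_ne_zero h0]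
      exact fun Q hQ => (hcon Q hQ.prime).1
    · rw [isRelPrime_comm, UniqueFactorizationMonoid.isRelPrime_iff_no_prime_factors h0]
      exact fun Q hQ2 hQ1 hQ => (hcon Q hQ).2 hQ1 hQ2
  have hQ2 : Q ∣ f.2 := hQd.elim (fun h => (dvd_mul_right Q Q).trans h) fun h => h.2
  have hQhom := isHomogeneous_of_dvd h2 h0 hQ2
  have hQdeg := degree_le_of_dvd hQhom h2 h0 hQ2
  have key : ∀ P, Associated P Q → f ∈ obstructed d P := by
    intro P hP
    rw [mem_obstructed]
    refine ⟨⟨h1, h2⟩, hQd.imp (fun h => ⟨?_, h0⟩) fun h =>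
      ⟨hP.dvd.trans h.1, hP.dvd.trans h.2⟩⟩
    exact (mul_dvd_mul hP.dvd hP.dvd).trans h
  rcases exists_associated_of_prime hQ hQhom with ⟨P, hP, hPQ⟩ | ⟨hr, P, hP, hPQ⟩
  · exact Or.inl ⟨P, hP, key P hPQ⟩
  · exact Or.inr ⟨_, Finset.mem_Icc.2 ⟨hr, hQdeg⟩, P, hP, key P hPQ⟩

/-- The ordinary family has positive density among all pairs of forms. -/
lemma card_family_squarefree_ge {d : ℕ} (hd : 2 ≤ d) (hq : 3 ≤ Nat.card F) :
    Nat.card F ^ (2 * d + 2) ≤ 27 * (family (F := F) d Squarefree).card := by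
  classical
  set q := Nat.card F with hqdef
  have hsub : forms F d ×ˢ forms F d ⊆ family d Squarefree ∪ (forms F d ×ˢ {0} ∪
      ((linearForms F).biUnion (obstructed d) ∪
        (Finset.Icc 2 d).biUnion fun r => (normalizedForms F r).biUnion (obstructed d))) := by
    intro f hf
    rw [Finset.mem_product, mem_forms, mem_forms] at hf
    simp only [Finset.mem_union, Finset.mem_biUnion, Finset.mem_product, mem_forms,
      Finset.mem_singleton]
    by_cases h0 : f.2 = 0
    · exact Or.inr (Or.inl ⟨hf.1, h0⟩)
    by_cases h1 : f ∈ family d Squarefree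
    · exact Or.inl h1
    · exact Or.inr (Or.inr (not_mem_family_squarefree hf.1 hf.2 h0 h1))
  have h1 := Finset.card_le_card hsub
  rw [Finset.card_product, card_forms, ← hqdef, ← pow_add] at h1
  have h2 : ((linearForms F).biUnion (obstructed d)).card ≤
      (q + 1) * (2 * q ^ (2 * d) - q ^ (2 * d - 1)) := by
    refine Finset.card_biUnion_le.trans ((Finset.sum_le_card_nsmul _ _
      (2 * q ^ (2 * d) - q ^ (2 * d - 1)) ?_).trans ?_)
    · intro P hP
      have := card_obstructed_linear_le hd (linearForms_spec hP).1 (linearForms_spec hP).2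
      lia
    · rw [smul_eq_mul]
      exact Nat.mul_le_mul_right _ card_linearForms_le
  have h3 : ((Finset.Icc 2 d).biUnion fun r => (normalizedForms F r).biUnion (obstructed d)).card
      ≤ ∑ r ∈ Finset.Icc 2 d, ∑ P ∈ normalizedForms F r, (obstructed d P).card :=
    Finset.card_biUnion_le.trans (Finset.sum_le_sum fun r _ => Finset.card_biUnion_le)
  have h4 := sum_card_obstructed_normalized_le (F := F) (d := d) (by lia)
  rw [← hqdef] at h4
  have h5 : (forms F d ×ˢ ({0} : Finset (MvPolynomial (Fin 2) F))).card = q ^ (d + 1) := by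
    rw [Finset.card_product, card_forms, Finset.card_singleton, mul_one]
  have h6 := (Finset.card_union_le _ _).trans (Nat.add_le_add_left
    ((Finset.card_union_le (forms F d ×ˢ ({0} : Finset (MvPolynomial (Fin 2) F)))
      ((linearForms F).biUnion (obstructed d) ∪ (Finset.Icc 2 d).biUnion fun r =>
        (normalizedForms F r).biUnion (obstructed d))).trans (Nat.add_le_add_left
          (Finset.card_union_le _ _) _)) (family (F := F) d Squarefree).card)
  have h7 := h1.trans h6
  have e1 : q ^ (2 * d) = q * q ^ (2 * d - 1) := by
    rw [← pow_succ']
    congr 1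
    lia
  have e2 : q ^ (2 * d + 2) = q ^ 3 * q ^ (2 * d - 1) := by
    rw [← pow_add]
    congr 1
    lia
  rw [show d + 1 + (d + 1) = 2 * d + 2 by lia] at h7
  rw [e1] at h2 h4
  rw [e2] at h7 ⊢
  generalize q ^ (2 * d - 1) = T at *
  have e3 : (2 * (q * T) - T : ℕ) = (2 * q - 1) * T := by
    rw [Nat.sub_mul, one_mul, mul_assoc]
  rw [e3] at h2
  have e4 : q ^ 3 * T ≤ (family (F := F) d Squarefree).card +
      ((q + 1) * ((2 * q - 1) * T) + 2 * (q * T)) := by lia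
  -- At q = 3 the excluded part is (4 · 5 + 6)T = 26T out of 27T, whence the constant 27; for larger
  -- q the inequality has room. For q = 2 the union bound would be void.
  obtain ⟨r, hr⟩ : ∃ r, q = r + 3 := ⟨q - 3, by lia⟩
  have e5 : 2 * q - 1 = 2 * r + 5 := by lia
  rw [e5, hr] at e4
  rw [hr]
  nlinarith [Nat.zero_le (r ^ 3 * T), Nat.zero_le (r ^ 2 * T), Nat.zero_le (r * T)]

end OrdinaryCount

/-! ### Cancellation at separated points and the frequency of poles -/

section Equidistribution

variable {F : Type*} [Field F] [Finite F] {p : ℕ} [Fact p.Prime]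

section TwoPoints

variable {E E' : Type*} [Field E] [Algebra F E] [Algebra (ZMod p) E]
  [Field E'] [Algebra F E'] [Algebra (ZMod p) E']

/-- The character `g ↦ χ₁(tr g(x)/h(x)) χ₂(tr g(y)/h(y))`. -/
def valChar (χ₁ χ₂ : AddChar (ZMod p) ℂ) (x : OnePoint E) (y : OnePoint E')
    (h : MvPolynomial (Fin 2) F) : AddChar (MvPolynomial (Fin 2) F) ℂ where
  toFun g := χ₁ (Algebra.trace (ZMod p) E (val x g / val x h)) *
    χ₂ (Algebra.trace (ZMod p) E' (val y g / val y h))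
  map_zero_eq_one' := by simp
  map_add_eq_mul' a b := by
    simp only [map_add, add_div, AddChar.map_add_eq_mul]
    ring

lemma valChar_apply (χ₁ χ₂ : AddChar (ZMod p) ℂ) (x : OnePoint E) (y : OnePoint E')
    (g h : MvPolynomial (Fin 2) F) : valChar χ₁ χ₂ x y h g =
      χ₁ (Algebra.trace (ZMod p) E (val x g / val x h)) *
        χ₂ (Algebra.trace (ZMod p) E' (val y g / val y h)) := rfl

lemma norm_valChar_le (χ₁ χ₂ : AddChar (ZMod p) ℂ) (x : OnePoint E) (y : OnePoint E')
    (g h : MvPolynomial (Fin 2) F) : ‖valChar χ₁ χ₂ x y h g‖ ≤ 1 := by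
  rw [valChar_apply, norm_mul, AddChar.norm_apply, AddChar.norm_apply, mul_one]

lemma Separated.nontrivialOnMultiples {χ₁ χ₂ : AddChar (ZMod p) ℂ} {x : OnePoint E}
    {y : OnePoint E'} (hs : Separated F χ₁ χ₂ x y) {h : MvPolynomial (Fin 2) F}
    (hx : val x h ≠ 0) (hy : val y h ≠ 0) :
    NontrivialOnMultiples (valChar χ₁ χ₂ x y h) h (ptDeg F x + ptDeg F y) := by
  intro D hD n hn
  obtain ⟨R, rfl⟩ := hD
  rw [map_mul] at hx hy
  exact hs (D * R) D (by rwa [map_mul]) (by rwa [map_mul]) (left_ne_zero_of_mul hx)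
    (left_ne_zero_of_mul hy) n hn

open scoped Classical in
lemma sum_family_eq (d : ℕ) (H : MvPolynomial (Fin 2) F → Prop) (G : FormPair F → ℂ) :
    ∑ f ∈ family d H, G f = ∑ h ∈ (forms F d).filter H,
      ∑ g ∈ (forms F d).filter (IsRelPrime · h), G (g, h) := by
  rw [Finset.sum_sigma']
  refine Finset.sum_bij' (fun f _ => ⟨f.2, f.1⟩) (fun a _ => (a.2, a.1)) ?_ ?_ ?_ ?_ ?_
  · intro f hf
    rw [mem_family] at hf
    simp only [Finset.mem_sigma, Finset.mem_filter, mem_forms]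
    tauto
  · intro a ha
    simp only [Finset.mem_sigma, Finset.mem_filter, mem_forms] at ha
    rw [mem_family]
    tauto
  · intro f _; rfl
  · intro a _; rfl
  · intro f _; rfl

lemma term_mul_term_eq_zero (χ₁ χ₂ : AddChar (ZMod p) ℂ) {x : OnePoint E} {y : OnePoint E'}
    {f : FormPair F} (h : ¬ (val x f.2 ≠ 0 ∧ val y f.2 ≠ 0)) :
    term χ₁ x f * term χ₂ y f = 0 := by
  rw [term, term]
  split_ifs <;> simp_all

lemma term_mul_term_eq_valChar (χ₁ χ₂ : AddChar (ZMod p) ℂ) {x : OnePoint E} {y : OnePoint E'}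
    {f : FormPair F} (h : val x f.2 ≠ 0 ∧ val y f.2 ≠ 0) :
    term χ₁ x f * term χ₂ y f = valChar χ₁ χ₂ x y f.2 f.1 := by
  rw [term, term, if_neg h.1, if_neg h.2, valChar_apply]

/-- All cancellation comes from the numerators; the sum over denominators is estimated trivially by
q^{d+1}, so any condition H is allowed. -/
lemma norm_sum_family_le {χ₁ χ₂ : AddChar (ZMod p) ℂ} {x : OnePoint E} {y : OnePoint E'}
    (hs : Separated F χ₁ χ₂ x y) (d : ℕ) (H : MvPolynomial (Fin 2) F → Prop) :
    ‖∑ f ∈ family d H, term χ₁ x f * term χ₂ y f‖ ≤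
      (Nat.card F : ℝ) ^ (d + 1) * (Nat.card F : ℝ) ^ (2 * (ptDeg F x + ptDeg F y) + 1) := by
  classical
  rw [sum_family_eq]
  have h1 : ∀ h ∈ (forms F d).filter H, ‖∑ g ∈ (forms F d).filter (IsRelPrime · h),
      term χ₁ x (g, h) * term χ₂ y (g, h)‖ ≤
        (Nat.card F : ℝ) ^ (2 * (ptDeg F x + ptDeg F y) + 1) := by
    intro h hh
    rw [Finset.mem_filter, mem_forms] at hh
    by_cases hv : val x h ≠ 0 ∧ val y h ≠ 0
    · have h0 : h ≠ 0 := by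
        rintro rfl
        exact hv.1 (map_zero _)
      rw [Finset.sum_congr rfl fun g _ => term_mul_term_eq_valChar χ₁ χ₂ (f := (g, h)) hv]
      exact norm_sum_isRelPrime_le hh.1 h0 (norm_valChar_le χ₁ χ₂ x y · h)
        (hs.nontrivialOnMultiples hv.1 hv.2)
    · rw [Finset.sum_congr rfl fun g _ => term_mul_term_eq_zero χ₁ χ₂ (f := (g, h)) hv,
        Finset.sum_const_zero, norm_zero]
      positivity
  refine (norm_sum_le_of_le _ h1).trans ?_
  rw [Finset.sum_const, nsmul_eq_mul]
  gcongr
  exact_mod_cast (Finset.card_filter_le _ _).trans (card_forms (F := F) d).le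

lemma sum_family_eq_zero {χ₁ χ₂ : AddChar (ZMod p) ℂ} {x : OnePoint E} {y : OnePoint E'}
    (hs : Separated F χ₁ χ₂ x y) (d : ℕ) (H : MvPolynomial (Fin 2) F → Prop)
    (hH : ∀ h, H h → h ≠ 0 → ∃ S, IsPrimeSupport S h ∧
      ptDeg F x + ptDeg F y + ∑ P ∈ S, P.totalDegree ≤ d + 1) :
    ∑ f ∈ family d H, term χ₁ x f * term χ₂ y f = 0 := by
  classical
  rw [sum_family_eq]
  refine Finset.sum_eq_zero fun h hh => ?_
  rw [Finset.mem_filter, mem_forms] at hh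
  by_cases hv : val x h ≠ 0 ∧ val y h ≠ 0
  · have h0 : h ≠ 0 := by
      rintro rfl
      exact hv.1 (map_zero _)
    obtain ⟨S, hS, hdeg⟩ := hH h hh.2 h0
    rw [Finset.sum_congr rfl fun g _ => term_mul_term_eq_valChar χ₁ χ₂ (f := (g, h)) hv]
    exact sum_isRelPrime_eq_zero hh.1 h0 hS (hs.nontrivialOnMultiples hv.1 hv.2) hdeg
  · rw [Finset.sum_congr rfl fun g _ => term_mul_term_eq_zero χ₁ χ₂ (f := (g, h)) hv,
      Finset.sum_const_zero]

end TwoPoints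

section Zeros

variable {E : Type*} [Field E] [Algebra F E] [Finite E]

open scoped Classical in
-- Vanishing at x is divisibility by the form of x, which costs a factor q^{deg x}.
lemma card_forms_val_eq_zero_le {x : OnePoint E} {d : ℕ} (hx : ptDeg F x ≤ d) :
    ((forms F d).filter fun h => val x h = 0).card ≤ Nat.card F ^ (d + 1 - ptDeg F x) := by
  have h0 : ptForm F x ≠ 0 := by
    induction x using OnePoint.rec with
    | infty => exact MvPolynomial.X_ne_zero _
    | coe a =>
      intro h
      exact minpoly.ne_zero (Algebra.IsIntegral.isIntegral a)
        (Polynomial.eq_zero_of_homogenize_eq_zero le_rfl h)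
  have h1 : (forms F d).filter (fun h => val x h = 0) ⊆
      (forms F d).filter (ptForm F x ∣ ·) := by
    intro h hh
    rw [Finset.mem_filter] at hh ⊢
    exact ⟨hh.1, ptForm_dvd (mem_forms.1 hh.1) hh.2⟩
  refine (Finset.card_le_card h1).trans ?_
  rw [card_forms_filter_dvd hx (isHomogeneous_ptForm x) h0, Nat.sub_add_comm hx]

open scoped Classical in
-- There are at most 2q^k points of degree k, and a denominator vanishes at each with density at
-- most q^{-k}: a bounded number of poles on average.
lemma sum_family_card_zeros_le {d k : ℕ} (hk : k ≤ d) (hE : Module.finrank F E = k)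
    (H : MvPolynomial (Fin 2) F → Prop) :
    ∑ f ∈ family d H, (Finset.univ.filter fun x : OnePoint E =>
      ptDeg F x = k ∧ val x f.2 = 0).card ≤ 2 * Nat.card F ^ (2 * d + 2) := by
  have hq : 1 ≤ Nat.card F := Nat.card_pos
  have h1 : ∀ f : FormPair F, (Finset.univ.filter fun x : OnePoint E =>
      ptDeg F x = k ∧ val x f.2 = 0).card = ∑ x ∈ Finset.univ.filter fun x : OnePoint E =>
        ptDeg F x = k, if val x f.2 = 0 then 1 else 0 := by
    intro f
    rw [← Finset.filter_filter, Finset.card_filter]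
  simp only [h1]
  rw [Finset.sum_comm]
  have h2 : ∀ x ∈ Finset.univ.filter fun x : OnePoint E => ptDeg F x = k,
      (∑ f ∈ family d H, if val x f.2 = 0 then 1 else 0) ≤
        Nat.card F ^ (d + 1) * Nat.card F ^ (d + 1 - k) := by
    intro x hx
    rw [Finset.mem_filter] at hx
    rw [← Finset.card_filter]
    have h3 : (family d H).filter (fun f => val x f.2 = 0) ⊆
        forms F d ×ˢ (forms F d).filter (fun h => val x h = 0) := by
      intro f hf
      rw [Finset.mem_filter, mem_family] at hf
      rw [Finset.mem_product, Finset.mem_filter, mem_forms, mem_forms]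
      tauto
    refine (Finset.card_le_card h3).trans ?_
    rw [Finset.card_product, card_forms, ← hx.2]
    exact Nat.mul_le_mul_left _ (card_forms_val_eq_zero_le (by lia))
  refine (Finset.sum_le_card_nsmul _ _ _ h2).trans ?_
  rw [smul_eq_mul]
  have h4 : (Finset.univ.filter fun x : OnePoint E => ptDeg F x = k).card ≤ 2 * Nat.card F ^ k := by
    refine (Finset.card_le_card ?_).trans (card_ptDeg_le (F := F) (E := E) k)
    exact Finset.monotone_filter_right _ fun x _ hx => le_of_eq hx
  refine (Nat.mul_le_mul_right _ h4).trans (le_of_eq ?_)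
  rw [mul_assoc, ← pow_add, ← pow_add]
  congr 2
  lia

open scoped Classical in
-- The extra 1 accounts for the point ∞.
lemma card_val_eq_zero_le {P : MvPolynomial (Fin 2) F} {r : ℕ} (hP : P.IsHomogeneous r)
    (hP0 : P ≠ 0) : (Finset.univ.filter fun x : OnePoint E => val x P = 0).card ≤ r + 1 := by
  set G := dehomogenize P with hG
  have hPG : G.homogenize r = P := homogenize_dehomogenize hP
  have hdeg : G.natDegree ≤ r := natDegree_dehomogenize_le hP
  have hG0 : G ≠ 0 := by
    intro h
    rw [h, Polynomial.homogenize_zero] at hPG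
    exact hP0 hPG.symm
  have hsub : (Finset.univ.filter fun x : OnePoint E => val x P = 0) ⊆
      insert OnePoint.infty ((G.aroots E).toFinset.image fun a : E => (a : OnePoint E)) := by
    intro x hx
    rw [Finset.mem_filter] at hx
    rw [Finset.mem_insert, Finset.mem_image]
    induction x using OnePoint.rec with
    | infty => exact Or.inl rfl
    | coe a =>
      refine Or.inr ⟨a, ?_, rfl⟩
      rw [← hPG, val_some_homogenize hdeg] at hx
      rw [Multiset.mem_toFinset, Polynomial.mem_aroots]
      exact ⟨hG0, hx.2⟩
  refine (Finset.card_le_card hsub).trans ((Finset.card_insert_le _ _).trans ?_)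
  gcongr
  exact Finset.card_image_le.trans ((Multiset.toFinset_card_le _).trans
    ((Polynomial.card_roots' _).trans (Polynomial.natDegree_map_le.trans hdeg)))

end Zeros

section FactorizationType

variable {n : ℕ} {r e : Fin n → ℕ} {h : MvPolynomial (Fin 2) F}

lemma HasFactorizationType.exists_isPrimeSupport (hh : HasFactorizationType r e h)
    (he : ∀ t, 1 ≤ e t) :
    ∃ S, IsPrimeSupport S h ∧ ∑ P ∈ S, P.totalDegree ≤ ∑ t, r t := by
  classical
  obtain ⟨P, hP, hne, hass⟩ := hh
  have hprime : ∀ t, Prime (P t) := fun t => (hP t).1.prime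
  have hdvd : ∀ t, P t ∣ h := by
    intro t
    have h1 : P t ∣ P t ^ e t := dvd_pow_self _ (Nat.one_le_iff_ne_zero.1 (he t))
    have h2 : P t ^ e t ∣ ∏ t, P t ^ e t := Finset.dvd_prod_of_mem _ (Finset.mem_univ t)
    exact (h1.trans h2).trans hass.dvd
  have hinj : ∀ s t, P s ∣ P t → P s = P t := by
    intro s t hd
    by_contra hst
    exact hne s t (fun h => hst (by rw [h])) ((hprime s).associated_of_dvd (hprime t) hd)
  have hcover : ∀ Q, Prime Q → Q ∣ h → ∃ t, P t ∣ Q := by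
    intro Q hQ hQh
    obtain ⟨t, -, ht⟩ := hQ.exists_mem_finset_dvd (hQh.trans hass.symm.dvd)
    exact ⟨t, (hQ.associated_of_dvd (hprime t) (hQ.dvd_of_dvd_pow ht)).symm.dvd⟩
  refine ⟨Finset.univ.image P, ⟨?_, ?_, ?_, ?_⟩, ?_⟩
  · intro Q hQ
    obtain ⟨t, -, rfl⟩ := Finset.mem_image.1 hQ
    exact hprime t
  · intro Q hQ
    obtain ⟨t, -, rfl⟩ := Finset.mem_image.1 hQ
    exact hdvd t
  · intro Q hQ R hR hd
    obtain ⟨s, -, rfl⟩ := Finset.mem_image.1 hQ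
    obtain ⟨t, -, rfl⟩ := Finset.mem_image.1 hR
    exact hinj s t hd
  · intro Q hQ hQh
    obtain ⟨t, ht⟩ := hcover Q hQ hQh
    exact ⟨P t, Finset.mem_image_of_mem _ (Finset.mem_univ t), ht⟩
  · have h1 : ∑ Q ∈ Finset.univ.image P, Q.totalDegree ≤ ∑ t, (P t).totalDegree :=
      Finset.sum_image_le_of_nonneg fun _ _ => Nat.zero_le _
    exact h1.trans (Finset.sum_le_sum fun t _ => (hP t).2.totalDegree_le)

open scoped Classical in
lemma HasFactorizationType.card_zeros_le {E : Type*} [Field E] [Algebra F E] [Finite E]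
    (hh : HasFactorizationType r e h) :
    (Finset.univ.filter fun x : OnePoint E => val x h = 0).card ≤ ∑ t, (r t + 1) := by
  obtain ⟨P, hP, -, hass⟩ := hh
  have hsub : (Finset.univ.filter fun x : OnePoint E => val x h = 0) ⊆
      Finset.univ.biUnion fun t => Finset.univ.filter fun x : OnePoint E => val x (P t) = 0 := by
    intro x hx
    rw [Finset.mem_filter] at hx
    obtain ⟨u, hu⟩ := hass
    rw [← hu, map_mul, mul_eq_zero] at hx
    have h1 := hx.2.resolve_right (IsUnit.map (val x) u.isUnit).ne_zero
    rw [map_prod, Finset.prod_eq_zero_iff] at h1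
    obtain ⟨t, -, ht⟩ := h1
    rw [map_pow] at ht
    simp only [Finset.mem_biUnion, Finset.mem_filter, Finset.mem_univ, true_and]
    exact ⟨t, eq_zero_of_pow_eq_zero ht⟩
  refine (Finset.card_le_card hsub).trans (Finset.card_biUnion_le.trans
    (Finset.sum_le_sum fun t _ => card_val_eq_zero_le (hP t).2 (hP t).1.ne_zero))

end FactorizationType

end Equidistribution

/-! ### Uniform equidistribution for the three kinds of families -/

section Families

variable {F : Type*} [Field F] [Finite F] {p : ℕ} [Fact p.Prime] [CharP F p]

open scoped Classical in
/-- The two properties of a family that determine the second moments: cancellation at separated pairs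
of points, and a bound for the number of poles of a given degree. -/
structure Equidistributed (p : ℕ) [Fact p.Prime] [CharP F p] (C : ℝ) (d : ℕ)
    (𝓢 : Finset (FormPair F)) : Prop where
  isHomogeneous : ∀ f ∈ 𝓢, f.1.IsHomogeneous d ∧ f.2.IsHomogeneous d
  nonempty : 𝓢.Nonempty
  norm_sum_le : ∀ (k₁ k₂ : ℕ) [NeZero k₁] [NeZero k₂] (χ₁ χ₂ : AddChar (ZMod p) ℂ)
    (x : OnePoint (FiniteField.Extension F p k₁)) (y : OnePoint (FiniteField.Extension F p k₂)),
    Separated F χ₁ χ₂ x y → 3 * (k₁ + k₂) ≤ d →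
      ‖∑ f ∈ 𝓢, term χ₁ x f * term χ₂ y f‖ * (Nat.card F : ℝ) ^ d ≤
        C * (Nat.card F : ℝ) ^ (2 * (k₁ + k₂)) * 𝓢.card
  sum_zeros_le : ∀ (k : ℕ) [NeZero k], k ≤ d →
    ∑ f ∈ 𝓢, ((Finset.univ.filter fun x : OnePoint (FiniteField.Extension F p k) =>
      ptDeg F x = k ∧ val x f.2 = 0).card : ℝ) ≤ C * 𝓢.card

lemma ptDeg_le {k : ℕ} [NeZero k] (x : OnePoint (FiniteField.Extension F p k)) :
    ptDeg F x ≤ k := by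
  have h := ptDeg_dvd (F := F) x
  rw [FiniteField.finrank_extension] at h
  exact Nat.le_of_dvd (NeZero.pos k) h

/-- The error q^{d+1} · q^{2m+1} times q^d is q^{2m} q^{2d+2}, and the density hypothesis turns
q^{2d+2} into 27 times the size of the family. The factor 2 in the count of poles raises the
constant to 54. -/
lemma equidistributed_of_card_ge {d : ℕ} {H : MvPolynomial (Fin 2) F → Prop}
    (hH : Nat.card F ^ (2 * d + 2) ≤ 27 * (family d H).card) :
    Equidistributed p 54 d (family d H) := by
  classical
  have hq : 1 ≤ Nat.card F := Nat.card_pos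
  have hH' : (Nat.card F : ℝ) ^ (2 * d + 2) ≤ 27 * (family d H).card := by exact_mod_cast hH
  refine ⟨fun f hf => (mem_family.1 hf).1, ?_, ?_, ?_⟩
  · rw [← Finset.card_pos]
    have : 0 < Nat.card F ^ (2 * d + 2) := by positivity
    lia
  · intro k₁ k₂ _ _ χ₁ χ₂ x y hs _
    have h1 := norm_sum_family_le hs d H
    have h2 : ptDeg F x + ptDeg F y ≤ k₁ + k₂ := add_le_add (ptDeg_le x) (ptDeg_le y)
    calc _ ≤ (Nat.card F : ℝ) ^ (d + 1) *
          (Nat.card F : ℝ) ^ (2 * (k₁ + k₂) + 1) * (Nat.card F : ℝ) ^ d := by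
          refine mul_le_mul_of_nonneg_right (h1.trans ?_) (by positivity)
          gcongr
          exact_mod_cast hq
      _ = (Nat.card F : ℝ) ^ (2 * (k₁ + k₂)) * (Nat.card F : ℝ) ^ (2 * d + 2) := by ring
      _ ≤ (Nat.card F : ℝ) ^ (2 * (k₁ + k₂)) * (54 * (family d H).card) := by
          gcongr
          have : (0 : ℝ) ≤ (family d H).card := by positivity
          linarith
      _ = _ := by ring
  · intro k _ hk
    have h1 := sum_family_card_zeros_le (E := FiniteField.Extension F p k) hk
      (FiniteField.finrank_extension F p k) H
    have h2 : (∑ f ∈ family d H, ((Finset.univ.filter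
        fun x : OnePoint (FiniteField.Extension F p k) =>
          ptDeg F x = k ∧ val x f.2 = 0).card : ℝ)) ≤ 2 * (Nat.card F : ℝ) ^ (2 * d + 2) := by
      exact_mod_cast h1
    linarith

/-- Such families may be too thin for the density argument, but the radical of h has degree at most
∑ r_t whatever the exponents, so the sieve gives exact vanishing for large d. -/
lemma equidistributed_fact {n : ℕ} (r : Fin n → ℕ) : ∃ C : ℝ, ∀ (d : ℕ) (e : Fin n → ℕ),
    (∀ t, 1 ≤ e t) → (family (F := F) d (HasFactorizationType r e)).Nonempty →
      Equidistributed p C d (family (F := F) d (HasFactorizationType r e)) := by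
  classical
  have hq : 1 ≤ Nat.card F := Nat.card_pos
  have hq' : (1 : ℝ) ≤ Nat.card F := by exact_mod_cast hq
  set c := ∑ t, r t with hc
  refine ⟨(Nat.card F : ℝ) ^ (2 * c) + (∑ t, (r t + 1) : ℕ), fun d e he hne =>
    ⟨fun f hf => (mem_family.1 hf).1, hne, ?_, ?_⟩⟩
  · intro k₁ k₂ _ _ χ₁ χ₂ x y hs hk
    have h2 : ptDeg F x + ptDeg F y ≤ k₁ + k₂ := add_le_add (ptDeg_le x) (ptDeg_le y)
    -- Combined with 3(k₁ + k₂) ≤ d, the first case forces d ≤ 2c, and the trivial bound suffices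
    -- with q^{2c} in the constant.
    rcases Nat.lt_or_ge (d + 1) (k₁ + k₂ + c) with hd | hd
    · have h1 : ‖∑ f ∈ family (F := F) d (HasFactorizationType r e), term χ₁ x f * term χ₂ y f‖ ≤
          (family (F := F) d (HasFactorizationType r e)).card := by
        have h3 : ∀ f ∈ family (F := F) d (HasFactorizationType r e),
            ‖term χ₁ x f * term χ₂ y f‖ ≤ 1 := fun f _ => by
          rw [norm_mul]
          exact mul_le_one₀ (norm_term_le_one _ _ _) (norm_nonneg _) (norm_term_le_one _ _ _)
        exact (norm_sum_le_of_le _ h3).trans (by simp)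
      calc _ ≤ ((family (F := F) d (HasFactorizationType r e)).card : ℝ) *
            (Nat.card F : ℝ) ^ (2 * c) := by
            gcongr
            lia
        _ ≤ ((family (F := F) d (HasFactorizationType r e)).card : ℝ) *
            (((Nat.card F : ℝ) ^ (2 * c) + (∑ t, (r t + 1) : ℕ)) * 
              (Nat.card F : ℝ) ^ (2 * (k₁ + k₂))) := by
            gcongr
            calc (Nat.card F : ℝ) ^ (2 * c) ≤ (Nat.card F : ℝ) ^ (2 * c) + (∑ t, (r t + 1) : ℕ) :=
                  le_add_of_nonneg_right (by positivity)
              _ ≤ _ := le_mul_of_one_le_right (by positivity) (one_le_pow₀ hq')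
        _ = _ := by ring
    · rw [sum_family_eq_zero hs, norm_zero, zero_mul]
      · positivity
      · intro h hh h0
        obtain ⟨S, hS, hdeg⟩ := hh.exists_isPrimeSupport he
        exact ⟨S, hS, by lia⟩
  · intro k _ _
    have h1 : ∀ f ∈ family (F := F) d (HasFactorizationType r e),
        ((Finset.univ.filter fun x : OnePoint (FiniteField.Extension F p k) =>
          ptDeg F x = k ∧ val x f.2 = 0).card : ℝ) ≤ (∑ t, (r t + 1) : ℕ) := by
      intro f hf
      have h3 := (mem_family.1 hf).2.1.card_zeros_le (E := FiniteField.Extension F p k)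
      have h4 : (Finset.univ.filter fun x : OnePoint (FiniteField.Extension F p k) =>
          ptDeg F x = k ∧ val x f.2 = 0) ⊆ Finset.univ.filter fun x => val x f.2 = 0 :=
        Finset.monotone_filter_right _ fun x _ hx => hx.2
      exact_mod_cast (Finset.card_le_card h4).trans h3
    refine (Finset.sum_le_card_nsmul _ _ _ h1).trans ?_
    rw [nsmul_eq_mul, mul_comm]
    gcongr
    exact le_add_of_nonneg_left (by positivity)

lemma coe_family (d : ℕ) (H : MvPolynomial (Fin 2) F → Prop) :
    (family d H : Set (FormPair F)) = {f | f ∈ fullFamily F d ∧ H f.2} := by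
  ext f
  rw [Finset.mem_coe, mem_family, Set.mem_ofPred_eq, fullFamily, Set.mem_ofPred_eq]
  tauto

lemma three_le_card (hp : p ≠ 2) : 3 ≤ Nat.card F := by
  have h1 : (Nat.card F : F) = 0 := by
    have := Fintype.ofFinite F
    rw [Nat.card_eq_fintype_card]
    exact Nat.cast_card_eq_zero F
  have h2 := Nat.le_of_dvd Nat.card_pos ((CharP.cast_eq_zero_iff F p _).1 h1)
  have h3 := (Fact.out : p.Prime).two_le
  lia

/-- The ordinary family has positive density, the full family contains it, and prescribed types are
treated separately. Odd characteristic enters here through q ≥ 3. -/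
lemma exists_equidistributed (hp : p ≠ 2) (κ : FamilyKind) : ∃ C : ℝ, ∀ d, 2 ≤ d →
    ∀ 𝓕 ∈ κ.members F d, ∃ 𝓢 : Finset (FormPair F), 𝓕 = ↑𝓢 ∧ Equidistributed p C d 𝓢 := by
  classical
  have hord : ∀ d, 2 ≤ d → Nat.card F ^ (2 * d + 2) ≤ 27 * (family (F := F) d Squarefree).card :=
    fun d hd => card_family_squarefree_ge hd (three_le_card hp)
  cases κ with
  | ord =>
    refine ⟨54, fun d hd 𝓕 h𝓕 => ⟨family d Squarefree, ?_, equidistributed_of_card_ge (hord d hd)⟩⟩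
    rw [coe_family]
    exact h𝓕
  | full =>
    refine ⟨54, fun d hd 𝓕 h𝓕 => ⟨family d fun _ => True, ?_, equidistributed_of_card_ge
      ((hord d hd).trans (Nat.mul_le_mul_left _ (Finset.card_le_card fun f hf => ?_)))⟩⟩
    · rw [coe_family, Set.mem_singleton_iff.1 h𝓕]
      ext f
      simp
    · rw [mem_family] at hf ⊢
      tauto
  | fact r =>
    obtain ⟨C, hC⟩ := equidistributed_fact (F := F) (p := p) r
    refine ⟨C, fun d _ 𝓕 h𝓕 => ?_⟩
    obtain ⟨e, he, -, rfl, hne⟩ := h𝓕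
    have h1 : factFamily F d r e = ↑(family (F := F) d (HasFactorizationType r e)) :=
      (coe_family d _).symm
    rw [h1] at hne
    exact ⟨_, h1, hC d e he (Finset.coe_nonempty.1 hne)⟩

lemma average_coe (𝓢 : Finset (FormPair F)) (G : FormPair F → ℂ) :
    average (𝓢 : Set (FormPair F)) G = (∑ f ∈ 𝓢, G f) / 𝓢.card := by
  rw [average, finsum_mem_coe_finset, Set.ncard_coe_finset]

end Families

lemma three_mul_le_of_dvd {p : ℕ} [Fact p.Prime] {k u v : ℕ} (hp : p ≠ 2) (hk : k ≠ 0) (huv : u * v = k) (hv : p ∣ v) :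
    u ≤ k / 3 := by
  have h1 : v ≠ 0 := by
    rintro rfl
    exact hk (by rw [← huv, mul_zero])
  have h2 := Nat.le_of_dvd (Nat.pos_of_ne_zero h1) hv
  have h3 := (Fact.out : p.Prime).two_le
  rw [Nat.le_div_iff_mul_le (by norm_num), ← huv]
  exact Nat.mul_le_mul_left _ (by lia)

/-! ### Exceptional pairs and the contribution of separated pairs -/

section SecondMoment

variable {F : Type*} [Field F] [Finite F] {p : ℕ} [Fact p.Prime] [CharP F p]
  {k₁ k₂ : ℕ} [NeZero k₁] [NeZero k₂]

/-- The pairs of points at which cancellation may fail for reasons that are negligible on average. -/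
def exceptionalPairs (F : Type*) [Field F] [Finite F] (p : ℕ) [Fact p.Prime] [CharP F p]
    (k₁ k₂ : ℕ) [NeZero k₁] [NeZero k₂] :
    Finset (OnePoint (FiniteField.Extension F p k₁) × OnePoint (FiniteField.Extension F p k₂)) :=
  open scoped Classical in
  Finset.univ.filter fun z => (ptClass F z.2 = ptClass F z.1 ∧ ptDeg F z.1 ≤ (k₁ + k₂) / 3) ∨
    (ptDeg F z.1 ≤ k₁ / 3 ∧ ptDeg F z.2 ≤ k₂ / 3)

lemma mem_exceptionalPairs
    {z : OnePoint (FiniteField.Extension F p k₁) × OnePoint (FiniteField.Extension F p k₂)} :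
    z ∈ exceptionalPairs F p k₁ k₂ ↔
      (ptClass F z.2 = ptClass F z.1 ∧ ptDeg F z.1 ≤ (k₁ + k₂) / 3) ∨
        (ptDeg F z.1 ≤ k₁ / 3 ∧ ptDeg F z.2 ≤ k₂ / 3) := by
  classical
  rw [exceptionalPairs, Finset.mem_filter]
  simp

/-- At most 2q^B points x, each with at most k₁ + k₂ conjugates, for the first kind; at most
2q^{k₁/3} · 2q^{k₂/3} pairs for the second. -/
lemma card_exceptionalPairs_le : (exceptionalPairs F p k₁ k₂).card ≤
    (2 * (k₁ + k₂) + 4) * Nat.card F ^ ((k₁ + k₂) / 3) := by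
  classical
  set B := (k₁ + k₂) / 3 with hB
  have hsub : exceptionalPairs F p k₁ k₂ ⊆
      ((Finset.univ.filter fun x : OnePoint (FiniteField.Extension F p k₁) =>
        ptDeg F x ≤ B).biUnion fun x => (Finset.univ.filter
          fun y : OnePoint (FiniteField.Extension F p k₂) =>
            ptClass F y = ptClass F x).image fun y => (x, y)) ∪
      (Finset.univ.filter fun x : OnePoint (FiniteField.Extension F p k₁) =>
        ptDeg F x ≤ k₁ / 3) ×ˢ (Finset.univ.filter
          fun y : OnePoint (FiniteField.Extension F p k₂) => ptDeg F y ≤ k₂ / 3) := by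
    intro z hz
    rw [mem_exceptionalPairs] at hz
    rw [Finset.mem_union, Finset.mem_biUnion, Finset.mem_product, Finset.mem_filter,
      Finset.mem_filter]
    refine hz.imp (fun h => ⟨z.1, by simpa using h.2, ?_⟩) fun h => by simpa using h
    rw [Finset.mem_image]
    exact ⟨z.2, by simpa using h.1, rfl⟩
  refine (Finset.card_le_card hsub).trans ((Finset.card_union_le _ _).trans ?_)
  have h1 : ((Finset.univ.filter fun x : OnePoint (FiniteField.Extension F p k₁) =>
        ptDeg F x ≤ B).biUnion fun x => (Finset.univ.filter
          fun y : OnePoint (FiniteField.Extension F p k₂) =>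
            ptClass F y = ptClass F x).image fun y => (x, y)).card ≤
      (2 * Nat.card F ^ B) * (k₁ + k₂) := by
    refine Finset.card_biUnion_le.trans ((Finset.sum_le_card_nsmul _ _ (k₁ + k₂) ?_).trans ?_)
    · intro x _
      refine Finset.card_image_le.trans ((card_ptClass_eq_le x).trans ?_)
      have := ptDeg_le (F := F) x
      lia
    · rw [smul_eq_mul]
      exact Nat.mul_le_mul_right _ (card_ptDeg_le B)
  have h2 : ((Finset.univ.filter fun x : OnePoint (FiniteField.Extension F p k₁) =>
        ptDeg F x ≤ k₁ / 3) ×ˢ (Finset.univ.filter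
          fun y : OnePoint (FiniteField.Extension F p k₂) => ptDeg F y ≤ k₂ / 3)).card ≤
      4 * Nat.card F ^ B := by
    rw [Finset.card_product]
    refine (Nat.mul_le_mul (card_ptDeg_le (F := F) (k₁ / 3))
      (card_ptDeg_le (F := F) (k₂ / 3))).trans ?_
    have h3 : Nat.card F ^ (k₁ / 3 + k₂ / 3) ≤ Nat.card F ^ B :=
      Nat.pow_le_pow_right Nat.card_pos (by lia)
    rw [pow_add] at h3
    nlinarith
  nlinarith

/-- Pairs of points of different classes are separated or exceptional. -/
lemma separated_or_mem_of_ptClass_ne (hp : p ≠ 2) {χ₁ χ₂ : AddChar (ZMod p) ℂ} (h₁ : χ₁ ≠ 1)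
    (h₂ : χ₂ ≠ 1) {x : OnePoint (FiniteField.Extension F p k₁)}
    {y : OnePoint (FiniteField.Extension F p k₂)} (hxy : ptClass F y ≠ ptClass F x) :
    Separated F χ₁ χ₂ x y ∨ (x, y) ∈ exceptionalPairs F p k₁ k₂ := by
  -- The test numerator may be concentrated at either point. This fails only if p divides both
  -- residue indices, and then p ≥ 3 makes both degrees small.
  by_cases hx : p ∣ Module.finrank (ptField F x) (FiniteField.Extension F p k₁)
  · by_cases hy : p ∣ Module.finrank (ptField F y) (FiniteField.Extension F p k₂)
    · right
      rw [mem_exceptionalPairs]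
      refine Or.inr ⟨three_mul_le_of_dvd hp (NeZero.ne k₁) ?_ hx,
        three_mul_le_of_dvd hp (NeZero.ne k₂) ?_ hy⟩
      · exact (ptDeg_mul_finrank x).trans (FiniteField.finrank_extension F p k₁)
      · exact (ptDeg_mul_finrank y).trans (FiniteField.finrank_extension F p k₂)
    · exact Or.inl (separated_of_ptClass_ne h₂ hxy hy).symm
  · exact Or.inl (separated_of_ptClass_ne h₁ hxy.symm hx)

/-- The common degree u divides both k₁ = ua and k₂ = ub. Unless a = b = 1 one has a + b ≥ 3, hence
3u ≤ k₁ + k₂. -/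
lemma mem_of_ptClass_eq {x : OnePoint (FiniteField.Extension F p k₁)}
    {y : OnePoint (FiniteField.Extension F p k₂)} (hxy : ptClass F y = ptClass F x)
    (h : ¬ (k₁ = k₂ ∧ ptDeg F x = k₁)) : (x, y) ∈ exceptionalPairs F p k₁ k₂ := by
  rw [mem_exceptionalPairs]
  refine Or.inl ⟨hxy, ?_⟩
  obtain ⟨a, ha⟩ := ptDeg_dvd (F := F) x
  obtain ⟨b, hb⟩ := ptDeg_dvd (F := F) y
  rw [FiniteField.finrank_extension] at ha hb
  rw [ptDeg_eq_of_ptClass_eq hxy] at hb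
  change ptDeg F x ≤ _
  set u := ptDeg F x
  have hk₁ := NeZero.ne k₁
  have hk₂ := NeZero.ne k₂
  have ha0 : a ≠ 0 := by rintro rfl; exact hk₁ (by rw [ha, mul_zero])
  have hb0 : b ≠ 0 := by rintro rfl; exact hk₂ (by rw [hb, mul_zero])
  have hab : 3 ≤ a + b := by
    by_contra hlt
    have ha1 : a = 1 := by lia
    have hb1 : b = 1 := by lia
    subst ha1 hb1
    exact h ⟨by lia, by lia⟩
  rw [Nat.le_div_iff_mul_le (by norm_num), ha, hb, ← mul_add]
  exact Nat.mul_le_mul_left _ hab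

/-- The correlation of the contributions of two points over a family. -/
def pairMean (𝓢 : Finset (FormPair F)) (χ₁ χ₂ : AddChar (ZMod p) ℂ)
    (z : OnePoint (FiniteField.Extension F p k₁) × OnePoint (FiniteField.Extension F p k₂)) : ℂ :=
  (∑ f ∈ 𝓢, term χ₁ z.1 f * term χ₂ z.2 f) / 𝓢.card

lemma norm_pairMean_le_one (𝓢 : Finset (FormPair F)) (χ₁ χ₂ : AddChar (ZMod p) ℂ)
    (z : OnePoint (FiniteField.Extension F p k₁) × OnePoint (FiniteField.Extension F p k₂)) :
    ‖pairMean 𝓢 χ₁ χ₂ z‖ ≤ 1 := by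
  have h3 : ∀ f ∈ 𝓢, ‖term χ₁ z.1 f * term χ₂ z.2 f‖ ≤ 1 := fun f _ => by
    rw [norm_mul]
    exact mul_le_one₀ (norm_term_le_one _ _ _) (norm_nonneg _) (norm_term_le_one _ _ _)
  rw [pairMean, norm_div, Complex.norm_natCast]
  exact div_le_one_of_le₀ ((norm_sum_le_of_le _ h3).trans (by simp)) (Nat.cast_nonneg _)

variable {C : ℝ} {d : ℕ} {𝓢 : Finset (FormPair F)}

/-- Here 3(k₁ + k₂) ≤ d is decisive: q^{2(k₁+k₂)-d} is at most q^{-(k₁+k₂)}, which beats the number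
of pairs of points. -/
lemma norm_pairMean_le_of_separated (h𝓢 : Equidistributed p C d 𝓢) (hk : 3 * (k₁ + k₂) ≤ d)
    {χ₁ χ₂ : AddChar (ZMod p) ℂ}
    {z : OnePoint (FiniteField.Extension F p k₁) × OnePoint (FiniteField.Extension F p k₂)}
    (hz : Separated F χ₁ χ₂ z.1 z.2) :
    ‖pairMean 𝓢 χ₁ χ₂ z‖ * (Nat.card F : ℝ) ^ (k₁ + k₂) ≤ |C| := by
  have h1 := h𝓢.norm_sum_le k₁ k₂ χ₁ χ₂ z.1 z.2 hz hk
  have h2 : (0 : ℝ) < 𝓢.card := by exact_mod_cast Finset.card_pos.2 h𝓢.nonempty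
  have hq : (1 : ℝ) ≤ Nat.card F := by exact_mod_cast (Nat.card_pos : 0 < Nat.card F)
  have hq0 : (0 : ℝ) < Nat.card F := by linarith
  rw [pairMean, norm_div, Complex.norm_natCast, div_mul_eq_mul_div, div_le_iff₀ h2]
  have h3 : (Nat.card F : ℝ) ^ (2 * (k₁ + k₂)) * (Nat.card F : ℝ) ^ (k₁ + k₂) ≤
      (Nat.card F : ℝ) ^ d := by
    rw [← pow_add]
    exact pow_le_pow_right₀ hq (by lia)
  set S := ‖∑ f ∈ 𝓢, term χ₁ z.1 f * term χ₂ z.2 f‖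
  have hS : 0 ≤ S := norm_nonneg _
  have h4 : S * (Nat.card F : ℝ) ^ (k₁ + k₂) * (Nat.card F : ℝ) ^ (2 * (k₁ + k₂)) ≤
      |C| * 𝓢.card * (Nat.card F : ℝ) ^ (2 * (k₁ + k₂)) := by
    calc _ = S * ((Nat.card F : ℝ) ^ (2 * (k₁ + k₂)) * (Nat.card F : ℝ) ^ (k₁ + k₂)) := by ring
      _ ≤ S * (Nat.card F : ℝ) ^ d := by gcongr
      _ ≤ _ := h1
      _ ≤ |C| * (Nat.card F : ℝ) ^ (2 * (k₁ + k₂)) * 𝓢.card := by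
        gcongr
        exact le_abs_self C
      _ = _ := by ring
  exact le_of_mul_le_mul_right h4 (by positivity)

/-- Off M there are at most (q^{k₁} + 1)(q^{k₂} + 1) ≤ 4q^{k₁+k₂} separated pairs, each of mean at
most |C|q^{-(k₁+k₂)}; exceptional pairs are bounded by 1 each. -/
lemma norm_sum_pairMean_sub_le (h𝓢 : Equidistributed p C d 𝓢) (hk : 3 * (k₁ + k₂) ≤ d)
    {χ₁ χ₂ : AddChar (ZMod p) ℂ}
    (M : Finset (OnePoint (FiniteField.Extension F p k₁) × OnePoint (FiniteField.Extension F p k₂)))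
    (hM : ∀ z ∉ M, Separated F χ₁ χ₂ z.1 z.2 ∨ z ∈ exceptionalPairs F p k₁ k₂) :
    ‖∑ z : OnePoint (FiniteField.Extension F p k₁) × OnePoint (FiniteField.Extension F p k₂),
      pairMean 𝓢 χ₁ χ₂ z - ∑ z ∈ M, pairMean 𝓢 χ₁ χ₂ z‖ ≤
      4 * |C| + (2 * (k₁ + k₂) + 4) * (Nat.card F : ℝ) ^ ((k₁ + k₂) / 3) := by
  classical
  have hq : (1 : ℝ) ≤ Nat.card F := by exact_mod_cast (Nat.card_pos : 0 < Nat.card F)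
  have hqm : (0 : ℝ) < (Nat.card F : ℝ) ^ (k₁ + k₂) := by positivity
  rw [← Finset.sum_compl_add_sum M, add_sub_cancel_right]
  have h1 : ∀ z ∈ Mᶜ, ‖pairMean 𝓢 χ₁ χ₂ z‖ ≤ |C| / (Nat.card F : ℝ) ^ (k₁ + k₂) +
      if z ∈ exceptionalPairs F p k₁ k₂ then 1 else 0 := by
    intro z hz
    obtain h | h := hM z (Finset.mem_compl.1 hz)
    · have h2 := norm_pairMean_le_of_separated (z := z) h𝓢 hk h
      rw [← le_div_iff₀ hqm] at h2
      refine h2.trans (le_add_of_nonneg_right ?_)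
      split_ifs <;> norm_num
    · rw [if_pos h]
      exact (norm_pairMean_le_one 𝓢 χ₁ χ₂ z).trans (le_add_of_nonneg_left (by positivity))
  refine (norm_sum_le_of_le Mᶜ h1).trans ?_
  refine (Finset.sum_le_sum_of_subset_of_nonneg (Finset.subset_univ _) fun z _ _ => ?_).trans ?_
  · refine add_nonneg (by positivity) ?_
    split_ifs <;> norm_num
  rw [Finset.sum_add_distrib, Finset.sum_const, Finset.sum_boole, nsmul_eq_mul]
  refine add_le_add ?_ ?_
  · rw [Finset.card_univ, Fintype.card_prod, card_onePoint, card_onePoint,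
      FiniteField.natCard_extension, FiniteField.natCard_extension, mul_div_assoc', div_le_iff₀ hqm]
    push_cast
    have e1 : (1 : ℝ) ≤ (Nat.card F : ℝ) ^ k₁ := one_le_pow₀ hq
    have e2 : (1 : ℝ) ≤ (Nat.card F : ℝ) ^ k₂ := one_le_pow₀ hq
    have e3 : ((Nat.card F : ℝ) ^ k₁ + 1) * ((Nat.card F : ℝ) ^ k₂ + 1) ≤
        4 * (Nat.card F : ℝ) ^ (k₁ + k₂) := by
      rw [pow_add]
      nlinarith
    nlinarith [abs_nonneg C]
  · have h2 := card_exceptionalPairs_le (F := F) (p := p) (k₁ := k₁) (k₂ := k₂)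
    have h3 : (Finset.univ.filter fun z => z ∈ exceptionalPairs F p k₁ k₂) =
        exceptionalPairs F p k₁ k₂ := by ext; simp
    rw [h3]
    exact_mod_cast h2

end SecondMoment

/-! ### The main term from conjugate points -/

section Diagonal

variable {F : Type*} [Field F] [Finite F] {p : ℕ} [Fact p.Prime] [CharP F p]
  {C : ℝ} {d : ℕ} {𝓢 : Finset (FormPair F)}

/-- The points of exact degree `k`. -/
def primitivePoints (F : Type*) [Field F] [Finite F] (p : ℕ) [Fact p.Prime] [CharP F p]
    (k : ℕ) [NeZero k] : Finset (OnePoint (FiniteField.Extension F p k)) :=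
  Finset.univ.filter fun x => ptDeg F x = k

/-- Degrees divide k, so a point that is not of exact degree k has degree at most k/2; there are at
most 2q^{k/2} of those. -/
lemma abs_card_primitivePoints_sub_le (k : ℕ) [NeZero k] :
    |((primitivePoints F p k).card : ℝ) - (Nat.card F : ℝ) ^ k| ≤
      2 * (Nat.card F : ℝ) ^ (k / 2) := by
  classical
  have h1 : (primitivePoints F p k).card + (Finset.univ.filter
      fun x : OnePoint (FiniteField.Extension F p k) => ¬ ptDeg F x = k).card =
        Nat.card F ^ k + 1 := by
    rw [primitivePoints, Finset.card_filter_add_card_filter_not, Finset.card_univ, card_onePoint,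
      FiniteField.natCard_extension]
  have h2 : (Finset.univ.filter
      fun x : OnePoint (FiniteField.Extension F p k) => ¬ ptDeg F x = k).card ≤
        2 * Nat.card F ^ (k / 2) := by
    refine (Finset.card_le_card ?_).trans
      (card_ptDeg_le (F := F) (E := FiniteField.Extension F p k) (k / 2))
    refine Finset.monotone_filter_right _ fun x _ hx => ?_
    obtain ⟨v, hv⟩ := ptDeg_dvd (F := F) x
    rw [FiniteField.finrank_extension] at hv
    have hk := NeZero.ne k
    have h0 : v ≠ 0 := by rintro rfl; exact hk (by rw [hv, mul_zero])
    have h1 : v ≠ 1 := by rintro rfl; exact hx (by rw [mul_one] at hv; exact hv.symm)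
    change ptDeg F x ≤ _
    rw [Nat.le_div_iff_mul_le (by norm_num)]
    conv_rhs => rw [hv]
    exact Nat.mul_le_mul_left _ (by lia)
  have h3 : ((primitivePoints F p k).card : ℝ) + ((Finset.univ.filter
      fun x : OnePoint (FiniteField.Extension F p k) => ¬ ptDeg F x = k).card : ℝ) =
        (Nat.card F : ℝ) ^ k + 1 := by exact_mod_cast h1
  have h4 : ((Finset.univ.filter
      fun x : OnePoint (FiniteField.Extension F p k) => ¬ ptDeg F x = k).card : ℝ) ≤
        2 * (Nat.card F : ℝ) ^ (k / 2) := by exact_mod_cast h2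
  have h5 : (1 : ℝ) ≤ (Nat.card F : ℝ) ^ (k / 2) :=
    one_le_pow₀ (by exact_mod_cast (Nat.card_pos : 0 < Nat.card F))
  have h6 : (0 : ℝ) ≤ ((Finset.univ.filter
      fun x : OnePoint (FiniteField.Extension F p k) => ¬ ptDeg F x = k).card : ℝ) :=
    Nat.cast_nonneg _
  rw [abs_le]
  constructor <;> linarith

/-- The pairs of conjugate points of exact degree `k`. -/
def diagonalPairs (F : Type*) [Field F] [Finite F] (p : ℕ) [Fact p.Prime] [CharP F p]
    (k : ℕ) [NeZero k] :
    Finset (OnePoint (FiniteField.Extension F p k) × OnePoint (FiniteField.Extension F p k)) :=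
  open scoped Classical in
  Finset.univ.filter fun z => ptClass F z.2 = ptClass F z.1 ∧ ptDeg F z.1 = k

lemma sum_diagonalPairs {k : ℕ} [NeZero k]
    (G : OnePoint (FiniteField.Extension F p k) → ℂ) :
    ∑ z ∈ diagonalPairs F p k, G z.1 = k * ∑ x ∈ primitivePoints F p k, G x := by
  classical
  rw [diagonalPairs, Finset.sum_filter, Fintype.sum_prod_type, primitivePoints, Finset.sum_filter,
    Finset.mul_sum]
  refine Finset.sum_congr rfl fun x _ => ?_
  by_cases hx : ptDeg F x = k
  · simp only [hx, and_true, if_true]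
    rw [← Finset.sum_filter, Finset.sum_const, card_ptClass_eq, hx, nsmul_eq_mul]
  · simp [hx]

/-- A diagonal pair contributes 1 minus the proportion of f with a pole at x, and each primitive x
occurs with its k conjugates. -/
lemma sum_diagonalPairs_pairMean (h𝓢 : Equidistributed p C d 𝓢) {k : ℕ} [NeZero k]
    {χ₁ χ₂ : AddChar (ZMod p) ℂ} (hχ : χ₁ * χ₂ = 1) :
    ∑ z ∈ diagonalPairs F p k, pairMean 𝓢 χ₁ χ₂ z =
      k * ((primitivePoints F p k).card - (∑ f ∈ 𝓢, open scoped Classical in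
        ((Finset.univ.filter fun x : OnePoint (FiniteField.Extension F p k) =>
          ptDeg F x = k ∧ val x f.2 = 0).card : ℂ)) / 𝓢.card) := by
  classical
  have hN : (𝓢.card : ℂ) ≠ 0 := by
    exact_mod_cast (Finset.card_pos.2 h𝓢.nonempty).ne'
  have h1 : ∀ z ∈ diagonalPairs F p k, pairMean 𝓢 χ₁ χ₂ z =
      1 - (∑ f ∈ 𝓢, if val z.1 f.2 = 0 then 1 else 0) / 𝓢.card := by
    intro z hz
    rw [diagonalPairs, Finset.mem_filter] at hz
    have h2 : ∀ f ∈ 𝓢, term χ₁ z.1 f * term χ₂ z.2 f =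
        1 - if val z.1 f.2 = 0 then 1 else 0 := by
      intro f _
      rw [term_mul_term_of_ptClass_eq hχ hz.2.1.symm]
      split_ifs <;> simp
    rw [pairMean, Finset.sum_congr rfl h2, Finset.sum_sub_distrib, sub_div, Finset.sum_const,
      nsmul_eq_mul, mul_one, div_self hN]
  rw [Finset.sum_congr rfl h1, sum_diagonalPairs fun x =>
    1 - (∑ f ∈ 𝓢, if val x f.2 = 0 then 1 else 0) / (𝓢.card : ℂ), Finset.sum_sub_distrib,
    Finset.sum_const, nsmul_eq_mul, mul_one, ← Finset.sum_div, Finset.sum_comm]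
  have h3 : ∀ f ∈ 𝓢, (∑ x ∈ primitivePoints F p k, if val x f.2 = 0 then (1 : ℂ) else 0) =
      ((Finset.univ.filter fun x : OnePoint (FiniteField.Extension F p k) =>
          ptDeg F x = k ∧ val x f.2 = 0).card : ℂ) := by
    intro f _
    rw [Finset.sum_boole, primitivePoints, Finset.filter_filter]
  rw [Finset.sum_congr rfl h3]

lemma norm_sum_diagonalPairs_sub_le (h𝓢 : Equidistributed p C d 𝓢) {k : ℕ} [NeZero k] (hk : k ≤ d)
    {χ₁ χ₂ : AddChar (ZMod p) ℂ} (hχ : χ₁ * χ₂ = 1) :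
    ‖∑ z ∈ diagonalPairs F p k, pairMean 𝓢 χ₁ χ₂ z - k * (Nat.card F : ℂ) ^ k‖ ≤
      k * (2 * (Nat.card F : ℝ) ^ (k / 2) + |C|) := by
  classical
  have hN : (0 : ℝ) < 𝓢.card := by exact_mod_cast Finset.card_pos.2 h𝓢.nonempty
  set Z : ℝ := ∑ f ∈ 𝓢, ((Finset.univ.filter fun x : OnePoint (FiniteField.Extension F p k) =>
          ptDeg F x = k ∧ val x f.2 = 0).card : ℝ) with hZ
  have h1 : ∑ z ∈ diagonalPairs F p k, pairMean 𝓢 χ₁ χ₂ z - k * (Nat.card F : ℂ) ^ k =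
      ((k * (((primitivePoints F p k).card - (Nat.card F : ℝ) ^ k) - Z / 𝓢.card) : ℝ) : ℂ) := by
    rw [sum_diagonalPairs_pairMean h𝓢 hχ, hZ]
    push_cast
    ring
  have hZ0 : 0 ≤ Z := Finset.sum_nonneg fun _ _ => Nat.cast_nonneg _
  have h2 : Z / 𝓢.card ≤ |C| := by
    rw [div_le_iff₀ hN]
    exact (h𝓢.sum_zeros_le k hk).trans (by gcongr; exact le_abs_self C)
  rw [h1, Complex.norm_real, Real.norm_eq_abs, abs_mul, Nat.abs_cast]
  gcongr
  refine (abs_sub _ _).trans (add_le_add (abs_card_primitivePoints_sub_le k) ?_)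
  rwa [abs_of_nonneg (div_nonneg hZ0 hN.le)]

/-- The correlations of the exponential sums over a family. -/
lemma norm_average_expSum_mul_sub_le (hp : p ≠ 2) (h𝓢 : Equidistributed p C d 𝓢)
    {k₁ k₂ : ℕ} [NeZero k₁] [NeZero k₂] (hk : 3 * (k₁ + k₂) ≤ d) {χ₁ χ₂ : AddChar (ZMod p) ℂ}
    (h₁ : χ₁ ≠ 1) (h₂ : χ₂ ≠ 1) :
    ‖average (𝓢 : Set (FormPair F)) (fun f => expSum k₁ f χ₁ * expSum k₂ f χ₂) -
      (if k₁ = k₂ ∧ χ₁ * χ₂ = 1 then k₁ * (Nat.card F : ℂ) ^ k₁ else 0)‖ ≤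
      (5 * |C| + 6) * ((k₁ + k₂ + 1) * (Nat.card F : ℝ) ^ ((k₁ + k₂) / 3)) := by
  classical
  have hq : (1 : ℝ) ≤ Nat.card F := by exact_mod_cast (Nat.card_pos : 0 < Nat.card F)
  have hQ : (1 : ℝ) ≤ (Nat.card F : ℝ) ^ ((k₁ + k₂) / 3) := one_le_pow₀ hq
  have hsum : average (𝓢 : Set (FormPair F)) (fun f => expSum k₁ f χ₁ * expSum k₂ f χ₂) =
      ∑ z : OnePoint (FiniteField.Extension F p k₁) × OnePoint (FiniteField.Extension F p k₂),
        pairMean 𝓢 χ₁ χ₂ z := by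
    rw [average_coe]
    simp only [pairMean]
    rw [← Finset.sum_div, Finset.sum_comm]
    congr 1
    refine Finset.sum_congr rfl fun f hf => ?_
    obtain ⟨hf1, hf2⟩ := h𝓢.isHomogeneous f hf
    rw [expSum_eq_sum_term hf1 hf2, expSum_eq_sum_term hf1 hf2, Finset.sum_mul_sum,
      ← Fintype.sum_prod_type']
  rw [hsum]
  split_ifs with hcase
  · obtain ⟨rfl, hχ⟩ := hcase
    have h3 := norm_sum_pairMean_sub_le h𝓢 hk (χ₁ := χ₁) (χ₂ := χ₂) (diagonalPairs F p k₁) (by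
      intro z hz
      rw [diagonalPairs, Finset.mem_filter, not_and] at hz
      by_cases hc : ptClass F z.2 = ptClass F z.1
      · exact Or.inr (mem_of_ptClass_eq hc fun h => hz (Finset.mem_univ _) ⟨hc, h.2⟩)
      · exact separated_or_mem_of_ptClass_ne hp h₁ h₂ hc)
    have h4 := norm_sum_diagonalPairs_sub_le h𝓢 (k := k₁) (by lia) hχ
    -- Points of lower degree cost k q^{k/2}, which is within the exceptional error k q^{2k/3}.
    have h5 : (Nat.card F : ℝ) ^ (k₁ / 2) ≤ (Nat.card F : ℝ) ^ ((k₁ + k₁) / 3) :=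
      pow_le_pow_right₀ hq (by lia)
    refine (norm_sub_le_norm_sub_add_norm_sub _ (∑ z ∈ diagonalPairs F p k₁, pairMean 𝓢 χ₁ χ₂ z)
      _).trans ((add_le_add h3 h4).trans ?_)
    generalize (Nat.card F : ℝ) ^ ((k₁ + k₁) / 3) = Q at *
    generalize (Nat.card F : ℝ) ^ (k₁ / 2) = R at *
    have hk0 : (0 : ℝ) ≤ k₁ := Nat.cast_nonneg _
    have hC := abs_nonneg C
    have e1 : (k₁ : ℝ) * R ≤ k₁ * Q := by gcongr
    have e2 : |C| * 1 ≤ |C| * Q := by gcongr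
    have e3 : |C| * k₁ * 1 ≤ |C| * k₁ * Q := by gcongr
    have e4 : 0 ≤ |C| * k₁ * Q := by positivity
    nlinarith
  · have h3 := norm_sum_pairMean_sub_le h𝓢 hk (χ₁ := χ₁) (χ₂ := χ₂) ∅ (by
      intro z _
      by_cases hc : ptClass F z.2 = ptClass F z.1
      · by_cases hd : k₁ = k₂ ∧ ptDeg F z.1 = k₁
        · obtain ⟨rfl, hdeg⟩ := hd
          exact Or.inl (separated_of_mul_ne_one (fun h => hcase ⟨rfl, h⟩) hc.symm
            (by rw [hdeg, FiniteField.finrank_extension]))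
        · exact Or.inr (mem_of_ptClass_eq hc hd)
      · exact separated_or_mem_of_ptClass_ne hp h₁ h₂ hc)
    rw [Finset.sum_empty] at h3
    refine h3.trans ?_
    generalize (Nat.card F : ℝ) ^ ((k₁ + k₂) / 3) = Q at *
    have hk0 : (0 : ℝ) ≤ k₁ := Nat.cast_nonneg _
    have hk1 : (0 : ℝ) ≤ k₂ := Nat.cast_nonneg _
    have hC := abs_nonneg C
    have e2 : |C| * 1 ≤ |C| * Q := by gcongr
    have e4 : 0 ≤ |C| * k₁ * Q := by positivity
    have e5 : 0 ≤ |C| * k₂ * Q := by positivity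
    have e6 : 0 ≤ k₁ * Q := by positivity
    have e7 : 0 ≤ k₂ * Q := by positivity
    nlinarith

end Diagonal

/-! ### Fourier coefficients of the Beurling–Selberg polynomials -/

section FourierCoefficients

/-- The `k`-th Fourier coefficient of the Beurling–Selberg polynomial. -/
def selbergCoeff (s : ℤˣ) (K : ℕ) (β : ℝ) (k : ℕ) : ℝ :=
  (Real.pi * ((k : ℝ) / (K + 1)) * (1 - (k : ℝ) / (K + 1)) *
      Real.cot (Real.pi * ((k : ℝ) / (K + 1))) + (k : ℝ) / (K + 1)) *
        (Real.sin (Real.pi * k * β) / (Real.pi * k)) +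
    ((s : ℤ) : ℝ) * ((1 - (k : ℝ) / (K + 1)) * Real.cos (Real.pi * k * β) / (K + 1))

/-- The two shifts are exchanged by x ↦ -x, so the addition formulas leave only cosines in x. As σ =
±1, σ sin(σy) = sin y makes the Vaaler part independent of the sign, while the Fejér part keeps the
factor σ. -/
lemma selberg_eq (s : ℤˣ) (K : ℕ) (β x : ℝ) : selberg s K β x =
    β + ((s : ℤ) : ℝ) / (K + 1) + ∑ k ∈ Finset.Icc 1 K,
      2 * selbergCoeff s K β k * Real.cos (2 * Real.pi * k * x) := by
  have hIco : Finset.Ico 1 (K + 1) = Finset.Icc 1 K := rfl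
  have hK : (K : ℝ) + 1 ≠ 0 := by positivity
  obtain ⟨σ, hσ, hσ'⟩ : ∃ σ : ℝ, σ = ((s : ℤ) : ℝ) ∧ (σ = 1 ∨ σ = -1) := by
    refine ⟨_, rfl, ?_⟩
    rcases Int.units_eq_one_or s with rfl | rfl <;> simp
  simp only [selberg, beurling, vaaler, fejer, selbergCoeff, hIco, Nat.cast_add, Nat.cast_one,
    ← hσ]
  set a : ℕ → ℝ := fun k => (Real.pi * ((k : ℝ) / (K + 1)) * (1 - (k : ℝ) / (K + 1)) *
      Real.cot (Real.pi * ((k : ℝ) / (K + 1))) + (k : ℝ) / (K + 1)) with ha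
  have hsplit : ∀ y z : ℝ, σ * (-∑ k ∈ Finset.Icc 1 K, a k *
        (Real.sin (2 * Real.pi * k * y) / (Real.pi * k)) +
      (1 + 2 * ∑ k ∈ Finset.Icc 1 K, (1 - (k : ℝ) / (K + 1)) * Real.cos (2 * Real.pi * k * y)) /
        (2 * (K + 1)) +
      (-∑ k ∈ Finset.Icc 1 K, a k * (Real.sin (2 * Real.pi * k * z) / (Real.pi * k)) +
      (1 + 2 * ∑ k ∈ Finset.Icc 1 K, (1 - (k : ℝ) / (K + 1)) * Real.cos (2 * Real.pi * k * z)) /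
        (2 * (K + 1)))) = σ / (K + 1) + ∑ k ∈ Finset.Icc 1 K,
        (σ * (-(a k * ((Real.sin (2 * Real.pi * k * y) + Real.sin (2 * Real.pi * k * z)) /
          (Real.pi * k))) + (1 - (k : ℝ) / (K + 1)) *
          (Real.cos (2 * Real.pi * k * y) + Real.cos (2 * Real.pi * k * z)) / (K + 1))) := by
    intro y z
    have h1 : ∀ k ∈ Finset.Icc 1 K, (σ * (-(a k * ((Real.sin (2 * Real.pi * k * y) +
        Real.sin (2 * Real.pi * k * z)) / (Real.pi * k))) + (1 - (k : ℝ) / (K + 1)) *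
          (Real.cos (2 * Real.pi * k * y) + Real.cos (2 * Real.pi * k * z)) / (K + 1))) =
        -σ * (a k * (Real.sin (2 * Real.pi * k * y) / (Real.pi * k))) +
        -σ * (a k * (Real.sin (2 * Real.pi * k * z) / (Real.pi * k))) +
        σ / (K + 1) * ((1 - (k : ℝ) / (K + 1)) * Real.cos (2 * Real.pi * k * y)) +
        σ / (K + 1) * ((1 - (k : ℝ) / (K + 1)) * Real.cos (2 * Real.pi * k * z)) := by
      intro k _
      ring
    rw [Finset.sum_congr rfl h1]
    simp only [Finset.sum_add_distrib, ← Finset.mul_sum]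
    generalize ∑ k ∈ Finset.Icc 1 K, a k * (Real.sin (2 * Real.pi * k * y) / (Real.pi * k)) = A₁
    generalize ∑ k ∈ Finset.Icc 1 K, a k * (Real.sin (2 * Real.pi * k * z) / (Real.pi * k)) = A₂
    generalize ∑ k ∈ Finset.Icc 1 K, (1 - (k : ℝ) / (K + 1)) *
      Real.cos (2 * Real.pi * k * y) = A₃
    generalize ∑ k ∈ Finset.Icc 1 K, (1 - (k : ℝ) / (K + 1)) *
      Real.cos (2 * Real.pi * k * z) = A₄
    field_simp
    ring
  rw [hsplit, ← add_assoc]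
  congr 1
  refine Finset.sum_congr rfl fun k _ => ?_
  have e1 : 2 * Real.pi * k * (x - σ * (β / 2)) = 2 * Real.pi * k * x - σ * (Real.pi * k * β) := by
    ring
  have e2 : 2 * Real.pi * k * (-x - σ * (β / 2)) =
      -(2 * Real.pi * k * x + σ * (Real.pi * k * β)) := by ring
  rw [e1, e2, Real.sin_neg, Real.cos_neg, Real.sin_sub, Real.sin_add, Real.cos_sub, Real.cos_add]
  rcases hσ' with h | h
  · rw [h]
    simp only [one_mul]
    ring
  · rw [h]
    simp only [neg_mul, one_mul, Real.sin_neg, Real.cos_neg]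
    ring

lemma integral_exp_int (n : ℤ) : ∫ θ in (-(1 / 2) : ℝ)..(1 / 2),
    Complex.exp (2 * Real.pi * Complex.I * n * θ) = if n = 0 then 1 else 0 := by
  split_ifs with h
  · subst h
    simp
    norm_num
  · have hc : 2 * Real.pi * Complex.I * (n : ℂ) ≠ 0 := by
      refine mul_ne_zero Complex.two_pi_I_ne_zero ?_
      exact_mod_cast h
    rw [integral_exp_mul_complex hc]
    have e1 : 2 * Real.pi * Complex.I * (n : ℂ) * ((1 / 2 : ℝ) : ℂ) =
        2 * Real.pi * Complex.I * (n : ℂ) * ((-(1 / 2) : ℝ) : ℂ) + n * (2 * Real.pi * Complex.I) := by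
      push_cast
      ring
    rw [e1, Complex.exp_add, Complex.exp_int_mul_two_pi_mul_I, mul_one, sub_self, zero_div]

/-- Orthogonality of exponentials, with each cosine split into the frequencies k and -k; m ≠ 0
removes the constant term. -/
lemma fourierCoefficient_selberg (s : ℤˣ) (K : ℕ) (β : ℝ) (m : ℤ) (hm : m ≠ 0) :
    fourierCoefficient (selberg s K β) m = ∑ k ∈ Finset.Icc 1 K,
      (selbergCoeff s K β k : ℂ) * ((if (k : ℤ) - m = 0 then 1 else 0) +
        if -(k : ℤ) - m = 0 then 1 else 0) := by
  have h1 : ∀ θ : ℝ, (selberg s K β θ : ℂ) *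
      Complex.exp (-(2 * Real.pi * Complex.I * (m : ℂ) * (θ : ℂ))) =
      ((β + ((s : ℤ) : ℝ) / (K + 1) : ℝ) : ℂ) *
        Complex.exp (2 * Real.pi * Complex.I * ((-m : ℤ) : ℂ) * θ) +
      ∑ k ∈ Finset.Icc 1 K, (selbergCoeff s K β k : ℂ) *
        (Complex.exp (2 * Real.pi * Complex.I * (((k : ℤ) - m : ℤ) : ℂ) * θ) +
          Complex.exp (2 * Real.pi * Complex.I * ((-(k : ℤ) - m : ℤ) : ℂ) * θ)) := by
    intro θ
    rw [selberg_eq, Complex.ofReal_add, add_mul, Complex.ofReal_sum, Finset.sum_mul]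
    congr 1
    · congr 2
      push_cast
      ring
    · refine Finset.sum_congr rfl fun k _ => ?_
      have e1 : 2 * Real.pi * Complex.I * (((k : ℤ) - m : ℤ) : ℂ) * θ =
          (2 * Real.pi * k * θ) * Complex.I + -(2 * Real.pi * Complex.I * (m : ℂ) * (θ : ℂ)) := by
        push_cast
        ring
      have e2 : 2 * Real.pi * Complex.I * ((-(k : ℤ) - m : ℤ) : ℂ) * θ =
          -(2 * Real.pi * k * θ) * Complex.I +
            -(2 * Real.pi * Complex.I * (m : ℂ) * (θ : ℂ)) := by
        push_cast
        ring
      rw [e1, e2, Complex.exp_add, Complex.exp_add]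
      push_cast
      rw [Complex.cos]
      ring
  have hint : ∀ n : ℤ, IntervalIntegrable
      (fun θ : ℝ => Complex.exp (2 * Real.pi * Complex.I * (n : ℂ) * θ)) MeasureTheory.volume
        (-(1 / 2)) (1 / 2) := fun n => Continuous.intervalIntegrable (by fun_prop) _ _
  rw [fourierCoefficient]
  simp only [h1]
  rw [intervalIntegral.integral_add ((hint _).const_mul _), intervalIntegral.integral_const_mul,
    integral_exp_int, if_neg (by simpa using hm), mul_zero, zero_add,
    intervalIntegral.integral_finsetSum]
  · refine Finset.sum_congr rfl fun k _ => ?_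
    rw [intervalIntegral.integral_const_mul, intervalIntegral.integral_add (hint _) (hint _),
      integral_exp_int, integral_exp_int]
  · exact fun k _ => ((hint _).add (hint _)).const_mul _
  · exact Continuous.intervalIntegrable (by fun_prop) _ _

lemma fourierCoefficient_selberg_pos (s : ℤˣ) {K : ℕ} (β : ℝ) {k : ℕ} (h1 : 1 ≤ k) (hk : k ≤ K) :
    fourierCoefficient (selberg s K β) (k : ℤ) = selbergCoeff s K β k := by
  rw [fourierCoefficient_selberg s K β _ (by lia),
    Finset.sum_eq_single_of_mem k (Finset.mem_Icc.2 ⟨h1, hk⟩)]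
  · rw [if_pos (by lia), if_neg (by lia)]
    simp
  · intro j hj hjk
    rw [if_neg (by lia), if_neg (by lia)]
    simp

lemma fourierCoefficient_selberg_neg (s : ℤˣ) {K : ℕ} (β : ℝ) {k : ℕ} (h1 : 1 ≤ k) (hk : k ≤ K) :
    fourierCoefficient (selberg s K β) (-(k : ℤ)) = selbergCoeff s K β k := by
  rw [fourierCoefficient_selberg s K β _ (by lia),
    Finset.sum_eq_single_of_mem k (Finset.mem_Icc.2 ⟨h1, hk⟩)]
  · rw [if_neg (by lia), if_pos (by lia)]
    simp
  · intro j hj hjk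
    rw [if_neg (by lia), if_neg (by lia)]
    simp

/-- The multiplier of Vaaler's polynomial is close to `1` near `0`. -/
lemma abs_vaaler_multiplier_sub_one_le {u : ℝ} (hu : 0 < u) (hu1 : u < 1) :
    |Real.pi * u * (1 - u) * Real.cot (Real.pi * u) + u - 1| ≤ 3 * u := by
  have hpi := Real.pi_pos
  have hpi3 := Real.pi_gt_three
  have hpi4 : Real.pi < 3.15 := Real.pi_lt_d2
  have hsin : 0 < Real.sin (Real.pi * u) :=
    Real.sin_pos_of_pos_of_lt_pi (by positivity) (by nlinarith)
  rw [Real.cot_eq_cos_div_sin]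
  -- For u ≤ 1/2, 1 - x²/2 ≤ x cot x ≤ 1 with x = πu. For u > 1/2 the factor 1 - u cancels the pole
  -- of the cotangent at u = 1, and boundedness is enough.
  rcases le_or_gt u (1 / 2) with h | h
  · set x := Real.pi * u with hx
    have hx0 : 0 < x := by positivity
    have hx2 : x ≤ Real.pi / 2 := by rw [hx]; nlinarith
    have h1 : x * (Real.cos x / Real.sin x) ≤ 1 := by
      rw [mul_div_assoc', div_le_one hsin]
      rcases eq_or_lt_of_le hx2 with h2 | h2
      · rw [h2, Real.cos_pi_div_two, Real.sin_pi_div_two]; norm_num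
      · have h3 := Real.le_tan hx0.le h2
        have h4 : 0 < Real.cos x := Real.cos_pos_of_mem_Ioo ⟨by linarith, h2⟩
        rwa [Real.tan_eq_sin_div_cos, le_div_iff₀ h4] at h3
    have h2 : 1 - x ^ 2 / 2 ≤ x * (Real.cos x / Real.sin x) := by
      have h3 : 0 ≤ Real.cos x := Real.cos_nonneg_of_mem_Icc ⟨by linarith, hx2⟩
      have h4 : Real.sin x ≤ x := Real.sin_le hx0.le
      refine (Real.one_sub_sq_div_two_le_cos).trans ?_
      rw [mul_div_assoc', le_div_iff₀ hsin, mul_comm x]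
      gcongr
    have e : x * (1 - u) * (Real.cos x / Real.sin x) + u - 1 =
        -((1 - u) * (1 - x * (Real.cos x / Real.sin x))) := by ring
    rw [e, abs_neg, abs_of_nonneg (mul_nonneg (by linarith) (by linarith))]
    have h5 : x ^ 2 ≤ 3.15 ^ 2 * u ^ 2 := by
      rw [hx, mul_pow]
      gcongr
    nlinarith
  · have h1 : 2 * (1 - u) ≤ Real.sin (Real.pi * u) := by
      have h2 := Real.mul_le_sin (x := Real.pi * (1 - u)) (by nlinarith) (by nlinarith)
      rw [show Real.pi * (1 - u) = Real.pi - Real.pi * u by ring, Real.sin_pi_sub] at h2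
      refine le_trans (le_of_eq ?_) h2
      field_simp
    have h2 : |(1 - u) * (Real.cos (Real.pi * u) / Real.sin (Real.pi * u))| ≤ 1 / 2 := by
      rw [abs_mul, abs_div, abs_of_pos hsin, abs_of_pos (by linarith : 0 < 1 - u),
        mul_div_assoc', div_le_iff₀ hsin]
      have := Real.abs_cos_le_one (Real.pi * u)
      nlinarith
    have e : Real.pi * u * (1 - u) * (Real.cos (Real.pi * u) / Real.sin (Real.pi * u)) + u - 1 =
        Real.pi * u * ((1 - u) * (Real.cos (Real.pi * u) / Real.sin (Real.pi * u))) - (1 - u) := by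
      ring
    rw [e]
    rw [abs_le] at h2 ⊢
    have h3 : 0 < Real.pi * u := by positivity
    constructor <;> nlinarith

/-- The multiplier differs from 1 by at most 3k/(K + 1), which against 1/(πk) costs at most 1/(K +
1); the Fejér part costs another 1/(K + 1). -/
lemma abs_selbergCoeff_sub_le (s : ℤˣ) {K : ℕ} (β : ℝ) {k : ℕ} (h1 : 1 ≤ k) (hk : k ≤ K) :
    |selbergCoeff s K β k - Real.sin (Real.pi * k * β) / (Real.pi * k)| ≤ 2 / (K + 1) := by
  have hk0 : (0 : ℝ) < k := by exact_mod_cast h1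
  have hkK : (k : ℝ) ≤ K := by exact_mod_cast hk
  have hK : (0 : ℝ) < (K : ℝ) + 1 := by positivity
  have hpi := Real.pi_gt_three
  set u := (k : ℝ) / (K + 1) with hu
  have hu0 : 0 < u := by positivity
  have hu1 : u < 1 := by rw [hu, div_lt_one hK]; linarith
  have e : selbergCoeff s K β k - Real.sin (Real.pi * k * β) / (Real.pi * k) =
      (Real.pi * u * (1 - u) * Real.cot (Real.pi * u) + u - 1) *
        (Real.sin (Real.pi * k * β) / (Real.pi * k)) +
      ((s : ℤ) : ℝ) * ((1 - u) * Real.cos (Real.pi * k * β) / (K + 1)) := by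
    rw [selbergCoeff, ← hu]
    ring
  have hs : |((s : ℤ) : ℝ)| = 1 := by
    rcases Int.units_eq_one_or s with rfl | rfl <;> simp
  rw [e]
  refine (abs_add_le _ _).trans ?_
  rw [abs_mul, abs_mul, hs, one_mul, abs_div, abs_div, abs_mul (1 - u),
    abs_of_pos (by linarith : 0 < 1 - u), abs_of_pos hK, abs_of_pos (by positivity : 0 < Real.pi * k)]
  have h2 : |Real.pi * u * (1 - u) * Real.cot (Real.pi * u) + u - 1| *
      (|Real.sin (Real.pi * k * β)| / (Real.pi * k)) ≤ 1 / (K + 1) := by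
    calc _ ≤ 3 * u * (1 / (Real.pi * k)) := by
          gcongr
          · exact abs_vaaler_multiplier_sub_one_le hu0 hu1
          · exact Real.abs_sin_le_one _
      _ = 3 / Real.pi * (1 / (K + 1)) := by
          rw [hu]
          field_simp
      _ ≤ 1 * (1 / (K + 1)) := by
          gcongr
          rw [div_le_one (by linarith)]
          exact hpi.le
      _ = _ := one_mul _
  have h3 : (1 - u) * |Real.cos (Real.pi * k * β)| / (K + 1) ≤ 1 / (K + 1) := by
    gcongr
    have := Real.abs_cos_le_one (Real.pi * k * β)
    nlinarith [abs_nonneg (Real.cos (Real.pi * k * β))]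
  refine (add_le_add h2 h3).trans (le_of_eq ?_)
  ring

lemma abs_sin_div_le {β : ℝ} {k : ℕ} (h1 : 1 ≤ k) :
    |Real.sin (Real.pi * k * β) / (Real.pi * k)| ≤ 1 / k := by
  have hk0 : (0 : ℝ) < k := by exact_mod_cast h1
  have hpi := Real.pi_gt_three
  rw [abs_div, abs_of_pos (by positivity : 0 < Real.pi * k), div_le_div_iff₀ (by positivity) hk0]
  have := Real.abs_sin_le_one (Real.pi * k * β)
  nlinarith

lemma abs_selbergCoeff_le (s : ℤˣ) {K : ℕ} (β : ℝ) {k : ℕ} (h1 : 1 ≤ k) (hk : k ≤ K) :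
    |selbergCoeff s K β k| ≤ 3 / k := by
  have hk0 : (0 : ℝ) < k := by exact_mod_cast h1
  have hkK : (k : ℝ) ≤ K := by exact_mod_cast hk
  have h2 := abs_selbergCoeff_sub_le s β h1 hk
  have h3 := abs_sin_div_le (β := β) h1
  have h4 : 2 / ((K : ℝ) + 1) ≤ 2 / k := by gcongr; linarith
  have h5 : |selbergCoeff s K β k| ≤ 2 / k + 1 / k := by
    have := abs_add_le (selbergCoeff s K β k - Real.sin (Real.pi * k * β) / (Real.pi * k))
      (Real.sin (Real.pi * k * β) / (Real.pi * k))
    rw [sub_add_cancel] at this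
    linarith
  refine h5.trans (le_of_eq ?_)
  ring

/-- Each of the K terms has error at most k(3/k + 1/k) · 2/(K + 1) = 8/(K + 1). The signs s and t
affect only this error, so all combinations share one asymptotic. -/
lemma abs_sum_mul_selbergCoeff_sub_le (s t : ℤˣ) (K : ℕ) (β : ℝ) :
    |∑ k ∈ Finset.Icc 1 K, (k : ℝ) * (selbergCoeff s K β k * selbergCoeff t K β k) -
      1 / Real.pi ^ 2 * ∑ k ∈ Finset.Icc 1 K, Real.sin (Real.pi * k * β) ^ 2 / k| ≤ 8 := by
  have hK : (0 : ℝ) < (K : ℝ) + 1 := by positivity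
  rw [Finset.mul_sum, ← Finset.sum_sub_distrib]
  have h : ∀ k ∈ Finset.Icc 1 K, |(k : ℝ) * (selbergCoeff s K β k * selbergCoeff t K β k) -
      1 / Real.pi ^ 2 * (Real.sin (Real.pi * k * β) ^ 2 / k)| ≤ 8 / ((K : ℝ) + 1) := by
    intro k hk
    rw [Finset.mem_Icc] at hk
    have hk0 : (0 : ℝ) < k := by exact_mod_cast hk.1
    have h1 := abs_selbergCoeff_sub_le s β hk.1 hk.2
    have h2 := abs_selbergCoeff_sub_le t β hk.1 hk.2
    have h3 := abs_selbergCoeff_le s β hk.1 hk.2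
    have h4 := abs_sin_div_le (β := β) hk.1
    have e : 1 / Real.pi ^ 2 * (Real.sin (Real.pi * k * β) ^ 2 / k) =
        k * (Real.sin (Real.pi * k * β) / (Real.pi * k)) ^ 2 := by
      have := Real.pi_pos
      field_simp
    rw [e]
    generalize selbergCoeff s K β k = a at *
    generalize selbergCoeff t K β k = b at *
    generalize Real.sin (Real.pi * k * β) / (Real.pi * k) = S at *
    have e2 : (k : ℝ) * (a * b) - k * S ^ 2 = k * (a * (b - S) + S * (a - S)) := by ring
    rw [e2, abs_mul, Nat.abs_cast]
    calc (k : ℝ) * |a * (b - S) + S * (a - S)| ≤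
        k * (3 / k * (2 / (K + 1)) + 1 / k * (2 / (K + 1))) := by
          gcongr
          refine (abs_add_le _ _).trans ?_
          rw [abs_mul, abs_mul]
          gcongr
      _ = 8 / (K + 1) := by
          field_simp
          ring
  refine (Finset.abs_sum_le_sum_abs _ _).trans ((Finset.sum_le_sum h).trans ?_)
  rw [Finset.sum_const, Nat.card_Icc, nsmul_eq_mul, Nat.add_sub_cancel, mul_div_assoc',
    div_le_iff₀ hK]
  nlinarith

end FourierCoefficients

/-! ### Asymptotics of the sum of sin²(πkβ)/k -/

section SineSquares

/-- Abel summation for an antitone sequence and bounded partial sums. -/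
lemma abs_sum_mul_le_of_antitone {a c : ℕ → ℝ} {M : ℝ} (ha : Antitone a) (ha0 : ∀ n, 0 ≤ a n)
    (hc : ∀ n, |∑ i ∈ Finset.range n, c i| ≤ M) (n : ℕ) :
    |∑ i ∈ Finset.range n, a i * c i| ≤ M * a 0 := by
  have hM : 0 ≤ M := (abs_nonneg _).trans (hc 0)
  have key : ∀ n, |∑ i ∈ Finset.range (n + 1), a i * c i -
      a n * ∑ i ∈ Finset.range (n + 1), c i| ≤ M * (a 0 - a n) := by
    intro n
    induction n with
    | zero => simp
    | succ n ih =>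
      have e : ∑ i ∈ Finset.range (n + 1 + 1), a i * c i -
          a (n + 1) * ∑ i ∈ Finset.range (n + 1 + 1), c i =
          (∑ i ∈ Finset.range (n + 1), a i * c i - a n * ∑ i ∈ Finset.range (n + 1), c i) +
            (a n - a (n + 1)) * ∑ i ∈ Finset.range (n + 1), c i := by
        rw [Finset.sum_range_succ _ (n + 1), Finset.sum_range_succ _ (n + 1)]
        ring
      have h1 : 0 ≤ a n - a (n + 1) := sub_nonneg.2 (ha n.le_succ)
      have h2 : |(a n - a (n + 1)) * ∑ i ∈ Finset.range (n + 1), c i| ≤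
          (a n - a (n + 1)) * M := by
        rw [abs_mul, abs_of_nonneg h1]
        gcongr
        exact hc _
      rw [e]
      refine (abs_add_le _ _).trans ((add_le_add ih h2).trans (le_of_eq ?_))
      ring
  rcases n with _ | n
  · simpa using mul_nonneg hM (ha0 0)
  · have h2 : |a n * ∑ i ∈ Finset.range (n + 1), c i| ≤ a n * M := by
      rw [abs_mul, abs_of_nonneg (ha0 n)]
      gcongr
      · exact ha0 n
      · exact hc _
    have h3 := abs_add_le (∑ i ∈ Finset.range (n + 1), a i * c i -
      a n * ∑ i ∈ Finset.range (n + 1), c i) (a n * ∑ i ∈ Finset.range (n + 1), c i)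
    rw [sub_add_cancel] at h3
    linarith [key n]

/-- Multiplication by 2 sin(θ/2) makes the sum telescope to a difference of two sines. -/
lemma abs_sum_cos_le (x θ : ℝ) (hθ : 0 < Real.sin (θ / 2)) (n : ℕ) :
    |∑ i ∈ Finset.range n, Real.cos (x + i * θ)| ≤ 1 / Real.sin (θ / 2) := by
  have e : ∀ n : ℕ, 2 * Real.sin (θ / 2) * ∑ i ∈ Finset.range n, Real.cos (x + i * θ) =
      Real.sin (x + n * θ - θ / 2) - Real.sin (x - θ / 2) := by
    intro n
    induction n with
    | zero => simp
    | succ n ih =>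
      rw [Finset.sum_range_succ, mul_add, ih]
      have e1 : x + ((n + 1 : ℕ) : ℝ) * θ - θ / 2 = x + n * θ + θ / 2 := by
        push_cast
        ring
      rw [e1, Real.sin_sub (x + n * θ), Real.sin_add (x + n * θ)]
      ring
  rw [le_div_iff₀ hθ, ← abs_of_pos hθ, ← abs_mul]
  have h := e n
  have e2 : (∑ i ∈ Finset.range n, Real.cos (x + i * θ)) * Real.sin (θ / 2) =
      (Real.sin (x + n * θ - θ / 2) - Real.sin (x - θ / 2)) / 2 := by
    rw [← h]
    ring
  rw [e2, abs_le]
  have h1 := abs_le.1 (Real.abs_sin_le_one (x + n * θ - θ / 2))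
  have h2 := abs_le.1 (Real.abs_sin_le_one (x - θ / 2))
  constructor <;> linarith

/-- Jordan's inequality on [0, 1/2] and the symmetry β ↦ 1 - β. The zero of the sine at β = 1 is the
reason for keeping β ≤ β₀ < 1. -/
lemma two_mul_le_sin_pi_mul {β : ℝ} (h0 : 0 ≤ β) (h1 : β ≤ 1) :
    2 * (β * (1 - β)) ≤ Real.sin (Real.pi * β) := by
  have hpi := Real.pi_pos
  have key : ∀ b : ℝ, 0 ≤ b → b ≤ 1 / 2 → 2 * (b * (1 - b)) ≤ Real.sin (Real.pi * b) := by
    intro b hb hb'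
    have h2 := Real.mul_le_sin (x := Real.pi * b) (by positivity) (by nlinarith)
    have h3 : 2 / Real.pi * (Real.pi * b) = 2 * b := by field_simp
    nlinarith
  rcases le_total β (1 / 2) with h | h
  · exact key β h0 h
  · have := key (1 - β) (by linarith) (by linarith)
    rw [show Real.pi * (1 - β) = Real.pi - Real.pi * β by ring, Real.sin_pi_sub] at this
    linarith

lemma abs_sum_range_inv_sub_log_le {N n : ℕ} (hN : 1 ≤ N) :
    |∑ i ∈ Finset.range n, ((N + 1 + i : ℕ) : ℝ)⁻¹ - Real.log (((N + n : ℕ) : ℝ) / N)| ≤ 1 := by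
  have hN0 : (0 : ℝ) < N := by exact_mod_cast hN
  have e : ∑ i ∈ Finset.range n, ((N + 1 + i : ℕ) : ℝ)⁻¹ =
      (harmonic (N + n) : ℝ) - harmonic N := by
    rw [harmonic, harmonic, Finset.sum_range_add]
    push_cast
    rw [add_sub_cancel_left]
    refine Finset.sum_congr rfl fun i _ => ?_
    congr 1
    ring
  have hlow : ∀ m : ℕ, Real.log m ≤ harmonic m := by
    intro m
    rcases m with _ | m
    · simp
    · refine le_trans (Real.log_le_log (by positivity) ?_) (log_add_one_le_harmonic (m + 1))
      push_cast
      linarith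
  have h1 := hlow N
  have h2 := hlow (N + n)
  have h3 := harmonic_le_one_add_log N
  have h4 := harmonic_le_one_add_log (N + n)
  rw [e, Real.log_div (by positivity) hN0.ne', abs_le]
  constructor <;> linarith

/-- The sum changes behaviour at k ≈ 1/β. Below, sin²(πkβ) ≤ (πkβ)² gives O(1). Above, sin² = (1 -
cos)/2: the constant part is half a harmonic sum, about log(Kβ)/2, and the oscillating part is
bounded by Abel summation. -/
lemma exists_abs_sum_sin_sq_sub_log_le {β₀ : ℝ} (hβ₀ : β₀ < 1) : ∃ C : ℝ, ∀ β : ℝ, 0 < β →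
    β ≤ β₀ → ∀ K : ℕ, 1 / β < K →
    |∑ k ∈ Finset.Icc 1 K, Real.sin (Real.pi * k * β) ^ 2 / k - 1 / 2 * Real.log (K * β)| ≤ C := by
  refine ⟨Real.pi ^ 2 + 1 + 1 / (1 - β₀) , fun β hβ hββ₀ K hK => ?_⟩
  have hpi := Real.pi_pos
  have hβ1 : β < 1 := hββ₀.trans_lt hβ₀
  have hc : 0 < 1 - β₀ := by linarith
  set N := ⌊1 / β⌋₊ with hN
  have hN1 : 1 ≤ N := by
    rw [hN, Nat.one_le_floor_iff, le_div_iff₀ hβ]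
    linarith
  have hNle : (N : ℝ) ≤ 1 / β := Nat.floor_le (by positivity)
  have hNlt : 1 / β < N + 1 := Nat.lt_floor_add_one _
  have hNβ : N * β ≤ 1 := by rwa [le_div_iff₀ hβ] at hNle
  have hNβ' : 1 < (N + 1) * β := by rwa [div_lt_iff₀ hβ] at hNlt
  have hNK : N ≤ K := by exact_mod_cast hNle.trans hK.le
  have hN0 : (1 : ℝ) ≤ N := by exact_mod_cast hN1
  obtain ⟨n, rfl⟩ := Nat.exists_eq_add_of_le hNK
  have hIcc : ∀ m : ℕ, ∀ g : ℕ → ℝ, ∑ k ∈ Finset.Icc 1 m, g k =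
      ∑ i ∈ Finset.range m, g (i + 1) := by
    intro m g
    rw [Finset.range_eq_Ico, Finset.sum_Ico_add' (f := g)]
    rfl
  rw [hIcc, Finset.sum_range_add]
  have hfirst : |∑ i ∈ Finset.range N,
      Real.sin (Real.pi * ((i + 1 : ℕ) : ℝ) * β) ^ 2 / ((i + 1 : ℕ) : ℝ)| ≤ Real.pi ^ 2 := by
    rw [abs_of_nonneg (Finset.sum_nonneg fun i _ => by positivity)]
    have hb : ∀ i ∈ Finset.range N,
        Real.sin (Real.pi * ((i + 1 : ℕ) : ℝ) * β) ^ 2 / ((i + 1 : ℕ) : ℝ) ≤ Real.pi ^ 2 * β := by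
      intro i hi
      rw [Finset.mem_range] at hi
      have hi' : ((i + 1 : ℕ) : ℝ) ≤ N := by exact_mod_cast hi
      have hi0 : (0 : ℝ) < ((i + 1 : ℕ) : ℝ) := by positivity
      generalize ((i + 1 : ℕ) : ℝ) = k at *
      have h1 : Real.sin (Real.pi * k * β) ^ 2 ≤ (Real.pi * k * β) ^ 2 := by
        rw [sq_le_sq]
        exact Real.abs_sin_le_abs
      rw [div_le_iff₀ hi0]
      refine h1.trans ?_
      have h2 : k * β ≤ 1 := (mul_le_mul_of_nonneg_right hi' hβ.le).trans hNβ
      have h3 : (Real.pi * k * β) ^ 2 = Real.pi ^ 2 * β * k * (k * β) := by ring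
      rw [h3]
      exact mul_le_of_le_one_right (by positivity) h2
    refine (Finset.sum_le_sum hb).trans ?_
    rw [Finset.sum_const, Finset.card_range, nsmul_eq_mul]
    nlinarith [sq_nonneg Real.pi]
  have hsecond : ∑ i ∈ Finset.range n, Real.sin (Real.pi * ((N + i + 1 : ℕ) : ℝ) * β) ^ 2 /
      ((N + i + 1 : ℕ) : ℝ) = 1 / 2 * ∑ i ∈ Finset.range n, ((N + 1 + i : ℕ) : ℝ)⁻¹ -
      1 / 2 * ∑ i ∈ Finset.range n, ((N + 1 + i : ℕ) : ℝ)⁻¹ *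
        Real.cos (2 * Real.pi * β * (N + 1) + i * (2 * Real.pi * β)) := by
    rw [Finset.mul_sum, Finset.mul_sum, ← Finset.sum_sub_distrib]
    refine Finset.sum_congr rfl fun i _ => ?_
    have e1 : 2 * Real.pi * β * (N + 1) + i * (2 * Real.pi * β) =
        2 * (Real.pi * ((N + i + 1 : ℕ) : ℝ) * β) := by
      push_cast
      ring
    rw [e1, Real.cos_two_mul, Real.sin_sq, show N + 1 + i = N + i + 1 by ring]
    ring
  have hcos : |∑ i ∈ Finset.range n, ((N + 1 + i : ℕ) : ℝ)⁻¹ *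
      Real.cos (2 * Real.pi * β * (N + 1) + i * (2 * Real.pi * β))| ≤ 1 / (1 - β₀) := by
    have h1 : 2 * (β * (1 - β₀)) ≤ Real.sin (2 * Real.pi * β / 2) := by
      rw [show 2 * Real.pi * β / 2 = Real.pi * β by ring]
      refine le_trans ?_ (two_mul_le_sin_pi_mul hβ.le hβ1.le)
      gcongr
    have h2 : 0 < Real.sin (2 * Real.pi * β / 2) := lt_of_lt_of_le (by positivity) h1
    refine (abs_sum_mul_le_of_antitone (a := fun i => ((N + 1 + i : ℕ) : ℝ)⁻¹) ?_ ?_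
      (abs_sum_cos_le (2 * Real.pi * β * (N + 1)) (2 * Real.pi * β) h2) n).trans ?_
    · intro i j hij
      dsimp only
      gcongr
    · intro i
      positivity
    -- The leading weight 1/(N + 1) ≤ β compensates the factor 1/β in the bound for the partial sums
    -- of cosines.
    · have h3 : (((N + 1 + 0 : ℕ) : ℝ))⁻¹ ≤ β := by
        push_cast
        rw [add_zero, inv_le_comm₀ (by positivity) hβ, ← one_div]
        exact hNlt.le
      calc _ ≤ 1 / (2 * (β * (1 - β₀))) * β := by gcongr
        _ = 1 / 2 * (1 / (1 - β₀)) := by field_simp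
        _ ≤ 1 / (1 - β₀) := by
          have : 0 < 1 / (1 - β₀) := by positivity
          linarith
  have hharm := abs_sum_range_inv_sub_log_le (n := n) hN1
  have hlog : Real.log (((N + n : ℕ) : ℝ) * β) =
      Real.log (((N + n : ℕ) : ℝ) / N) + Real.log (N * β) := by
    rw [← Real.log_mul (by positivity) (by positivity)]
    congr 1
    field_simp
  have hl1 : Real.log (N * β) ≤ 0 := Real.log_nonpos (by positivity) hNβ
  -- N ≥ 1 and (N + 1)β > 1 give Nβ ≥ 1/2, so rounding 1/β costs at most log 2.
  have hl2 : -1 ≤ Real.log (N * β) := by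
    have h1 : (1 / 2 : ℝ) ≤ N * β := by nlinarith
    have h2 := Real.log_le_log (by norm_num) h1
    rw [one_div, Real.log_inv] at h2
    have := Real.log_two_lt_d9
    linarith
  rw [hsecond, hlog]
  rw [abs_le] at hfirst hcos hharm ⊢
  constructor <;> linarith

end SineSquares

/-! ### Second moments of the weighted sums -/

section Moments

/-- The exponents differ by 1/3 - 1/2 = -1/6, so w(k) = (k + 1)q^{-k/6} works. A product weight
bounds the double error sum by the square of a convergent series, uniformly in K. -/
lemma exists_summable_weight {q : ℝ} (hq : 1 < q) : ∃ w : ℕ → ℝ, (∀ k, 0 ≤ w k) ∧ Summable w ∧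
    ∀ k₁ k₂ : ℕ, ((k₁ : ℝ) + k₂ + 1) * q ^ ((k₁ + k₂) / 3) ≤
      Real.sqrt q ^ k₁ * Real.sqrt q ^ k₂ * (w k₁ * w k₂) := by
  have hq0 : 0 < q := by linarith
  set t := q ^ (1 / 6 : ℝ) with ht
  have ht1 : 1 < t := Real.one_lt_rpow hq (by norm_num)
  have ht0 : 0 < t := by linarith
  have ht6 : t ^ 6 = q := by
    rw [ht, ← Real.rpow_natCast, ← Real.rpow_mul hq0.le]
    norm_num
  have ht3 : Real.sqrt q = t ^ 3 := by
    rw [Real.sqrt_eq_iff_mul_self_eq hq0.le (by positivity), ← ht6]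
    ring
  refine ⟨fun k => (k + 1) * t⁻¹ ^ k, fun k => by positivity, ?_, fun k₁ k₂ => ?_⟩
  · have hρ : ‖t⁻¹‖ < 1 := by
      rw [Real.norm_of_nonneg (by positivity)]
      exact inv_lt_one_of_one_lt₀ ht1
    have h1 := summable_pow_mul_geometric_of_norm_lt_one 1 hρ
    have h2 := summable_geometric_of_norm_lt_one hρ
    refine (h1.add h2).congr fun k => ?_
    ring
  · have h1 : q ^ ((k₁ + k₂) / 3) ≤ t ^ (2 * (k₁ + k₂)) := by
      rw [← ht6, ← pow_mul]
      exact pow_le_pow_right₀ ht1.le (by lia)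
    have h2 : (k₁ : ℝ) + k₂ + 1 ≤ (k₁ + 1) * (k₂ + 1) := by
      nlinarith [mul_nonneg (Nat.cast_nonneg (α := ℝ) k₁) (Nat.cast_nonneg (α := ℝ) k₂)]
    have h3 : ∀ k : ℕ, (t ^ 3) ^ k * t⁻¹ ^ k = (t ^ 2) ^ k := by
      intro k
      rw [← mul_pow]
      congr 1
      field_simp
    calc _ ≤ ((k₁ + 1) * (k₂ + 1)) * t ^ (2 * (k₁ + k₂)) := by gcongr
      _ = ((k₁ + 1) * (k₂ + 1)) * ((t ^ 2) ^ k₁ * (t ^ 2) ^ k₂) := by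
          rw [← pow_add, ← pow_mul]
      _ = _ := by
          rw [ht3, ← h3, ← h3]
          ring

variable {F : Type*} [Field F] [Finite F]

lemma average_sum_mul_sum (𝓢 : Finset (FormPair F)) {ι κ : Type*} (A : Finset ι) (B : Finset κ)
    (X : ι → FormPair F → ℂ) (Y : κ → FormPair F → ℂ) :
    average (𝓢 : Set (FormPair F)) (fun f => (∑ i ∈ A, X i f) * ∑ j ∈ B, Y j f) =
      ∑ i ∈ A, ∑ j ∈ B, average (𝓢 : Set (FormPair F)) (fun f => X i f * Y j f) := by
  simp only [average_coe, Finset.sum_mul_sum, ← Finset.sum_div]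
  rw [Finset.sum_comm]
  congr 1
  exact Finset.sum_congr rfl fun i _ => Finset.sum_comm

lemma average_const_mul (𝓢 : Finset (FormPair F)) (c : ℂ) (X : FormPair F → ℂ) :
    average (𝓢 : Set (FormPair F)) (fun f => c * X f) =
      c * average (𝓢 : Set (FormPair F)) X := by
  rw [average_coe, average_coe, ← Finset.mul_sum, mul_div_assoc]

variable {p : ℕ} [Fact p.Prime] [CharP F p]

/-- The part of `charSum` that belongs to a single character. -/
def halfSum (s : ℤˣ) (K : ℕ) (β : ℝ) (f : FormPair F) (χ : AddChar (ZMod p) ℂ) : ℂ :=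
  ∑ j ∈ Finset.range K,
    ((selbergCoeff s K β (j + 1) / Real.sqrt (Nat.card F) ^ (j + 1) : ℝ) : ℂ) * expSum (j + 1) f χ

lemma charSum_eq (s : ℤˣ) (K : ℕ) (β : ℝ) (f : FormPair F) (χ : AddChar (ZMod p) ℂ) :
    charSum s K β f χ = halfSum s K β f χ + halfSum s K β f χ⁻¹ := by
  rw [charSum, halfSum, halfSum, ← Finset.sum_add_distrib]
  refine Finset.sum_congr rfl fun j hj => ?_
  rw [Finset.mem_range] at hj
  rw [fourierCoefficient_selberg_pos s β j.succ_pos hj,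
    fourierCoefficient_selberg_neg s β j.succ_pos hj]
  push_cast
  ring

/-- The main term of the second moments. -/
def diagonalSum (s t : ℤˣ) (K : ℕ) (β : ℝ) : ℝ :=
  ∑ k ∈ Finset.Icc 1 K, (k : ℝ) * (selbergCoeff s K β k * selbergCoeff t K β k)

lemma diagonalSum_eq_sum_range (s t : ℤˣ) (K : ℕ) (β : ℝ) : diagonalSum s t K β =
    ∑ j ∈ Finset.range K, ((j + 1 : ℕ) : ℝ) *
      (selbergCoeff s K β (j + 1) * selbergCoeff t K β (j + 1)) := by
  rw [diagonalSum, Finset.range_eq_Ico, Finset.sum_Ico_add'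
    (f := fun k : ℕ => (k : ℝ) * (selbergCoeff s K β k * selbergCoeff t K β k))]
  rfl

lemma exists_abs_diagonalSum_sub_log_le {β₀ : ℝ} (hβ₀ : β₀ < 1) : ∃ C : ℝ, 0 ≤ C ∧ ∀ β : ℝ,
    0 < β → β ≤ β₀ → ∀ K : ℕ, 1 / β < K → ∀ s t : ℤˣ,
    |diagonalSum s t K β - 1 / (2 * Real.pi ^ 2) * Real.log (K * β)| ≤ C := by
  obtain ⟨C, hC⟩ := exists_abs_sum_sin_sq_sub_log_le hβ₀
  refine ⟨8 + 1 / Real.pi ^ 2 * |C|, by positivity, fun β hβ hββ₀ K hK s t => ?_⟩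
  have h1 := abs_sum_mul_selbergCoeff_sub_le s t K β
  have h2 := (hC β hβ hββ₀ K hK).trans (le_abs_self C)
  have hpi : 0 ≤ 1 / Real.pi ^ 2 := by positivity
  have h3 := mul_le_mul_of_nonneg_left h2 hpi
  rw [← abs_of_nonneg hpi, ← abs_mul, abs_of_nonneg hpi] at h3
  refine le_trans (le_of_eq ?_) ((abs_add_le _ _).trans (add_le_add h1 h3))
  rw [diagonalSum]
  congr 1
  ring

variable {C : ℝ} {d : ℕ} {𝓢 : Finset (FormPair F)}

lemma abs_normalized_selbergCoeff_le (s : ℤˣ) {K : ℕ} (β : ℝ) {x : ℝ} (hx : 0 < x) {j : ℕ}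
    (hj : j < K) : |selbergCoeff s K β (j + 1) / x ^ (j + 1)| ≤ 3 / x ^ (j + 1) := by
  rw [abs_div, abs_of_pos (pow_pos hx _)]
  gcongr
  refine (abs_selbergCoeff_le s β j.succ_pos hj).trans ?_
  rw [div_le_iff₀ (by positivity)]
  push_cast
  nlinarith [Nat.cast_nonneg (α := ℝ) j]

/-- The main term k q^k cancels the normalization on the diagonal and leaves the sum of k times
products of coefficients. The off-diagonal errors factor through w; the 9 comes from bounding both
coefficients by 3. The condition 6K ≤ d is 3(k₁ + k₂) ≤ d at k₁ = k₂ = K. -/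
lemma norm_average_halfSum_mul_sub_le (hp : p ≠ 2) (h𝓢 : Equidistributed p C d 𝓢) {w : ℕ → ℝ}
    (hw : ∀ k₁ k₂ : ℕ, ((k₁ : ℝ) + k₂ + 1) * (Nat.card F : ℝ) ^ ((k₁ + k₂) / 3) ≤
      Real.sqrt (Nat.card F) ^ k₁ * Real.sqrt (Nat.card F) ^ k₂ * (w k₁ * w k₂))
    {K : ℕ} (hK : 6 * K ≤ d) (s t : ℤˣ) (β : ℝ) {χ₁ χ₂ : AddChar (ZMod p) ℂ}
    (h₁ : χ₁ ≠ 1) (h₂ : χ₂ ≠ 1) :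
    ‖average (𝓢 : Set (FormPair F)) (fun f => halfSum s K β f χ₁ * halfSum t K β f χ₂) -
      (if χ₁ * χ₂ = 1 then (diagonalSum s t K β : ℂ) else 0)‖ ≤
      9 * (5 * |C| + 6) * (∑ j ∈ Finset.range K, w (j + 1)) ^ 2 := by
  have hq : (0 : ℝ) < Nat.card F := by exact_mod_cast (Nat.card_pos : 0 < Nat.card F)
  have hqc : (Nat.card F : ℂ) ≠ 0 := by exact_mod_cast hq.ne'
  set x := Real.sqrt (Nat.card F) with hx
  have hx0 : 0 < x := Real.sqrt_pos.2 hq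
  have hxx : x * x = Nat.card F := Real.mul_self_sqrt hq.le
  have hdiag : (if χ₁ * χ₂ = 1 then (diagonalSum s t K β : ℂ) else 0) =
      ∑ i ∈ Finset.range K, ∑ j ∈ Finset.range K,
        ((selbergCoeff s K β (i + 1) / x ^ (i + 1) : ℝ) : ℂ) *
        ((selbergCoeff t K β (j + 1) / x ^ (j + 1) : ℝ) : ℂ) *
        (if i + 1 = j + 1 ∧ χ₁ * χ₂ = 1 then ((i + 1 : ℕ) : ℂ) * (Nat.card F : ℂ) ^ (i + 1)
          else 0) := by
    by_cases h : χ₁ * χ₂ = 1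
    · rw [if_pos h, diagonalSum_eq_sum_range, Complex.ofReal_sum]
      refine Finset.sum_congr rfl fun i hi => ?_
      rw [Finset.sum_eq_single_of_mem i hi]
      · rw [if_pos ⟨rfl, h⟩]
        have hxc : (x : ℂ) ≠ 0 := by exact_mod_cast hx0.ne'
        have hxxc : (Nat.card F : ℂ) = x * x := by exact_mod_cast hxx.symm
        rw [hxxc]
        push_cast
        rw [mul_pow]
        field_simp
      · intro j _ hj
        rw [if_neg (fun h => hj (by lia)), mul_zero]
    · rw [if_neg h]
      symm
      refine Finset.sum_eq_zero fun i _ => Finset.sum_eq_zero fun j _ => ?_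
      rw [if_neg (fun h' => h h'.2), mul_zero]
  simp only [halfSum]
  rw [average_sum_mul_sum, hdiag, ← Finset.sum_sub_distrib, sq, Finset.sum_mul_sum,
    Finset.mul_sum]
  refine norm_sum_le_of_le _ fun i hi => ?_
  rw [← Finset.sum_sub_distrib, Finset.mul_sum]
  refine norm_sum_le_of_le _ fun j hj => ?_
  rw [Finset.mem_range] at hi hj
  have h3 := norm_average_expSum_mul_sub_le hp h𝓢 (k₁ := i + 1) (k₂ := j + 1) (by lia) h₁ h₂
  have e : (fun f : FormPair F => ((selbergCoeff s K β (i + 1) / x ^ (i + 1) : ℝ) : ℂ) *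
      expSum (i + 1) f χ₁ * (((selbergCoeff t K β (j + 1) / x ^ (j + 1) : ℝ) : ℂ) *
      expSum (j + 1) f χ₂)) = fun f => (((selbergCoeff s K β (i + 1) / x ^ (i + 1) : ℝ) : ℂ) *
      ((selbergCoeff t K β (j + 1) / x ^ (j + 1) : ℝ) : ℂ)) *
      (expSum (i + 1) f χ₁ * expSum (j + 1) f χ₂) := by
    funext f
    ring
  rw [e, average_const_mul, ← mul_sub, norm_mul, norm_mul, Complex.norm_real, Complex.norm_real,
    Real.norm_eq_abs, Real.norm_eq_abs]
  calc _ ≤ 3 / x ^ (i + 1) * (3 / x ^ (j + 1)) * ((5 * |C| + 6) *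
        (x ^ (i + 1) * x ^ (j + 1) * (w (i + 1) * w (j + 1)))) := by
        gcongr
        · exact abs_normalized_selbergCoeff_le s β hx0 hi
        · exact abs_normalized_selbergCoeff_le t β hx0 hj
        · refine h3.trans ?_
          refine mul_le_mul_of_nonneg_left ?_ (by positivity)
          exact hw _ _
    _ = _ := by
        field_simp
        ring

/-- Of the four products of χ₁ or χ₁⁻¹ with χ₂ or χ₂⁻¹, two are trivial when χ₁χ₂ = 1 and the other
two when χ₁ = χ₂. -/
lemma norm_average_charSum_mul_sub_le (hp : p ≠ 2) (h𝓢 : Equidistributed p C d 𝓢) {w : ℕ → ℝ}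
    (hw : ∀ k₁ k₂ : ℕ, ((k₁ : ℝ) + k₂ + 1) * (Nat.card F : ℝ) ^ ((k₁ + k₂) / 3) ≤
      Real.sqrt (Nat.card F) ^ k₁ * Real.sqrt (Nat.card F) ^ k₂ * (w k₁ * w k₂))
    {K : ℕ} (hK : 6 * K ≤ d) (s t : ℤˣ) (β : ℝ) {χ₁ χ₂ : AddChar (ZMod p) ℂ}
    (h₁ : χ₁ ≠ 1) (h₂ : χ₂ ≠ 1) :
    ‖average (𝓢 : Set (FormPair F)) (fun f => charSum s K β f χ₁ * charSum t K β f χ₂) -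
      (2 * (if χ₁ = χ₂ then 1 else 0) + 2 * (if χ₁ * χ₂ = 1 then 1 else 0)) *
        (diagonalSum s t K β : ℂ)‖ ≤
      36 * (5 * |C| + 6) * (∑ j ∈ Finset.range K, w (j + 1)) ^ 2 := by
  have h₁' : χ₁⁻¹ ≠ 1 := inv_ne_one.2 h₁
  have h₂' : χ₂⁻¹ ≠ 1 := inv_ne_one.2 h₂
  have b1 := norm_average_halfSum_mul_sub_le hp h𝓢 hw hK s t β h₁ h₂
  have b2 := norm_average_halfSum_mul_sub_le hp h𝓢 hw hK s t β h₁ h₂'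
  have b3 := norm_average_halfSum_mul_sub_le hp h𝓢 hw hK s t β h₁' h₂
  have b4 := norm_average_halfSum_mul_sub_le hp h𝓢 hw hK s t β h₁' h₂'
  have i2 : χ₁ * χ₂⁻¹ = 1 ↔ χ₁ = χ₂ := mul_inv_eq_one
  have i3 : χ₁⁻¹ * χ₂ = 1 ↔ χ₁ = χ₂ := inv_mul_eq_one
  have i4 : χ₁⁻¹ * χ₂⁻¹ = 1 ↔ χ₁ * χ₂ = 1 := by
    rw [← mul_inv, inv_eq_one]
  simp only [i2] at b2
  simp only [i3] at b3
  simp only [i4] at b4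
  have e : average (𝓢 : Set (FormPair F)) (fun f => charSum s K β f χ₁ * charSum t K β f χ₂) =
      average (𝓢 : Set (FormPair F)) (fun f => halfSum s K β f χ₁ * halfSum t K β f χ₂) +
      average (𝓢 : Set (FormPair F)) (fun f => halfSum s K β f χ₁ * halfSum t K β f χ₂⁻¹) +
      average (𝓢 : Set (FormPair F)) (fun f => halfSum s K β f χ₁⁻¹ * halfSum t K β f χ₂) +
      average (𝓢 : Set (FormPair F)) (fun f => halfSum s K β f χ₁⁻¹ * halfSum t K β f χ₂⁻¹) := by
    simp only [average_coe, charSum_eq, ← add_div, ← Finset.sum_add_distrib]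
    congr 1
    refine Finset.sum_congr rfl fun f _ => ?_
    ring
  rw [e]
  refine le_trans (le_of_eq ?_) ((norm_add₄_le (a := _ - _) (b := _ - _) (c := _ - _)
    (d := _ - _)).trans ((add_le_add (add_le_add (add_le_add b1 b2) b3) b4).trans (le_of_eq ?_)))
  · congr 1
    split_ifs <;> ring
  · ring

lemma pow_eq_pow_iff_modEq_of_ne_one {ψ : AddChar (ZMod p) ℂ} (hψ : ψ ≠ 1) (a b : ℕ) :
    ψ ^ a = ψ ^ b ↔ a ≡ b [MOD p] := by
  have h1 : ψ ^ p = 1 := by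
    ext x
    rw [AddChar.pow_apply, ← AddChar.map_nsmul_eq_pow]
    simp
  rw [pow_eq_pow_iff_modEq, orderOf_eq_prime h1 hψ]

lemma pow_eq_one_iff_dvd_of_ne_one {ψ : AddChar (ZMod p) ℂ} (hψ : ψ ≠ 1) (a : ℕ) :
    ψ ^ a = 1 ↔ p ∣ a := by
  rw [← pow_zero ψ, pow_eq_pow_iff_modEq_of_ne_one hψ, Nat.modEq_zero_iff_dvd]

/-- Each h₁ meets exactly h₂ = h₁ and h₂ = p - h₁, with weight 2 each; no case distinction is needed
since the two indicators are added. -/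
lemma sum_sum_multiplicity {ψ : AddChar (ZMod p) ℂ} (hψ : ψ ≠ 1) :
    ∑ h₁ ∈ Finset.Icc 1 (p - 1), ∑ h₂ ∈ Finset.Icc 1 (p - 1),
      (2 * (if ψ ^ h₁ = ψ ^ h₂ then 1 else 0) +
        2 * (if ψ ^ h₁ * ψ ^ h₂ = 1 then 1 else 0) : ℂ) = 4 * ((p : ℂ) - 1) := by
  have hp2 := (Fact.out : p.Prime).two_le
  have hinner : ∀ h₁ ∈ Finset.Icc 1 (p - 1), ∑ h₂ ∈ Finset.Icc 1 (p - 1),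
      (2 * (if ψ ^ h₁ = ψ ^ h₂ then 1 else 0) +
        2 * (if ψ ^ h₁ * ψ ^ h₂ = 1 then 1 else 0) : ℂ) = 4 := by
    intro h₁ hh₁
    rw [Finset.mem_Icc] at hh₁
    rw [Finset.sum_add_distrib, ← Finset.mul_sum, ← Finset.mul_sum,
      Finset.sum_eq_single_of_mem h₁ (Finset.mem_Icc.2 hh₁),
      Finset.sum_eq_single_of_mem (p - h₁) (Finset.mem_Icc.2 (by lia)), if_pos rfl, if_pos]
    · norm_num
    · rw [← pow_add, pow_eq_one_iff_dvd_of_ne_one hψ, show h₁ + (p - h₁) = p by lia]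
    · intro h₂ hh₂ hne
      rw [Finset.mem_Icc] at hh₂
      rw [if_neg]
      rw [← pow_add, pow_eq_one_iff_dvd_of_ne_one hψ]
      rintro ⟨c, hc⟩
      have hc2 : c < 2 := Nat.lt_of_mul_lt_mul_left (a := p) (by lia)
      interval_cases c <;> lia
    · intro h₂ hh₂ hne
      rw [Finset.mem_Icc] at hh₂
      rw [if_neg]
      rw [pow_eq_pow_iff_modEq_of_ne_one hψ]
      intro h
      exact hne (Nat.ModEq.eq_of_lt_of_lt h (by lia) (by lia)).symm
  rw [Finset.sum_congr rfl hinner, Finset.sum_const, Nat.card_Icc, nsmul_eq_mul,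
    Nat.add_sub_cancel, Nat.cast_sub (by lia)]
  push_cast
  ring

end Moments

/-! ### Sums over all characters and the final asymptotics -/

section MainTheorem

variable {F : Type*} [Field F] [Finite F] {p : ℕ} [Fact p.Prime] [CharP F p]
  {𝓢 : Finset (FormPair F)}

lemma norm_average_curveSum_mul_sub_le {ψ : AddChar (ZMod p) ℂ} (hψ : ψ ≠ 1) {s t : ℤˣ} {K : ℕ}
    {β E : ℝ} (hE : ∀ χ₁ χ₂ : AddChar (ZMod p) ℂ, χ₁ ≠ 1 → χ₂ ≠ 1 →
      ‖average (𝓢 : Set (FormPair F)) (fun f => charSum s K β f χ₁ * charSum t K β f χ₂) -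
      (2 * (if χ₁ = χ₂ then 1 else 0) + 2 * (if χ₁ * χ₂ = 1 then 1 else 0)) *
        (diagonalSum s t K β : ℂ)‖ ≤ E) :
    ‖average (𝓢 : Set (FormPair F)) (fun f => curveSum s K β f ψ * curveSum t K β f ψ) -
      4 * ((p : ℂ) - 1) * (diagonalSum s t K β : ℂ)‖ ≤ ((p - 1 : ℕ) : ℝ) ^ 2 * E := by
  have hne : ∀ h ∈ Finset.Icc 1 (p - 1), ψ ^ h ≠ 1 := by
    intro h hh
    rw [Finset.mem_Icc] at hh
    rw [Ne, pow_eq_one_iff_dvd_of_ne_one hψ]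
    intro h'
    have := Nat.le_of_dvd hh.1 h'
    lia
  simp only [curveSum]
  rw [average_sum_mul_sum, ← sum_sum_multiplicity hψ, Finset.sum_mul, ← Finset.sum_sub_distrib]
  have e : ((p - 1 : ℕ) : ℝ) ^ 2 * E =
      ∑ _h₁ ∈ Finset.Icc 1 (p - 1), ∑ _h₂ ∈ Finset.Icc 1 (p - 1), E := by
    simp only [Finset.sum_const, Nat.card_Icc, Nat.add_sub_cancel, nsmul_eq_mul]
    ring
  rw [e]
  refine norm_sum_le_of_le _ fun h₁ hh₁ => ?_
  rw [Finset.sum_mul, ← Finset.sum_sub_distrib]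
  exact norm_sum_le_of_le _ fun h₂ hh₂ => hE _ _ (hne _ hh₁) (hne _ hh₂)

lemma norm_sub_ofReal_le_of_norm_sub_mul_le {z c : ℂ} {a D L E B : ℝ} (hc : c = (a : ℂ))
    (ha : 0 ≤ a) (h₁ : ‖z - c * (D : ℂ)‖ ≤ E) (h₂ : |D - L| ≤ B) :
    ‖z - ((a * L : ℝ) : ℂ)‖ ≤ E + a * B := by
  have e : z - ((a * L : ℝ) : ℂ) = (z - c * (D : ℂ)) + ((a * (D - L) : ℝ) : ℂ) := by
    rw [hc]
    push_cast
    ring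
  rw [e]
  refine (norm_add_le _ _).trans (add_le_add h₁ ?_)
  rw [Complex.norm_real, Real.norm_eq_abs, abs_mul, abs_of_nonneg ha]
  gcongr

end MainTheorem
end ArtinSchreier
end

open ArtinSchreier in
theorem mainTheorem6 {F : Type*} [Field F] [Finite F] {p : ℕ} [Fact p.Prime] [CharP F p]
    (hp : p ≠ 2) (κ : FamilyKind) (β₀ : ℝ) (hβ₀ : β₀ < 1) :
    ∃ C : ℝ, ∀ (ψ : AddChar (ZMod p) ℂ), ψ ≠ 1 →
      ∀ (d : ℕ), ∀ 𝓕 ∈ κ.members F d, ∀ (β : ℝ), 0 < β → β ≤ β₀ →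
      ∀ (K : ℕ), 1 / β < (K : ℝ) → (K : ℝ) < (d : ℝ) / 6 → ∀ s t : ℤˣ,
        (∀ h₁ ∈ Finset.Icc 1 ((p - 1) / 2), ∀ h₂ ∈ Finset.Icc 1 ((p - 1) / 2),
          ‖average 𝓕 (fun f => charSum s K β f (ψ ^ h₁) * charSum t K β f (ψ ^ h₂)) -
              (if h₁ = h₂ then ((1 / Real.pi ^ 2 * Real.log (K * β) : ℝ) : ℂ) else 0)‖ ≤ C) ∧
        ‖average 𝓕 (fun f => curveSum s K β f ψ * curveSum t K β f ψ) -
            ((2 * ((p : ℝ) - 1) / Real.pi ^ 2 * Real.log (K * β) : ℝ) : ℂ)‖ ≤ C := by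
  obtain ⟨C, hC⟩ := exists_equidistributed (F := F) hp κ
  obtain ⟨B, hB0, hB⟩ := exists_abs_diagonalSum_sub_log_le hβ₀
  have hq : (1 : ℝ) < Nat.card F := by exact_mod_cast Finite.one_lt_card
  obtain ⟨w, hw0, hws, hw⟩ := exists_summable_weight hq
  have hp1 : (1 : ℝ) ≤ p := by exact_mod_cast (Fact.out : p.Prime).one_lt.le
  set W := ∑' j, w (j + 1) with hW
  have hW' : ∀ K, ∑ j ∈ Finset.range K, w (j + 1) ≤ W := fun K =>
    ((summable_nat_add_iff 1).2 hws).sum_le_tsum _ fun j _ => hw0 _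
  set E := 36 * (5 * |C| + 6) * W ^ 2 with hE
  have hE0 : 0 ≤ E := by positivity
  -- One constant serves both statements: the bounds for single characters and for the curve are
  -- added. Multiplicities 2 and 4(p - 1) scale the error B of the diagonal sum.
  refine ⟨(E + 2 * B) + (((p - 1 : ℕ) : ℝ) ^ 2 * E + 4 * ((p : ℝ) - 1) * B),
    fun ψ hψ d 𝓕 h𝓕 β hβ hββ₀ K hK hKd s t => ?_⟩
  have hpB : 0 ≤ 4 * ((p : ℝ) - 1) * B := mul_nonneg (by linarith) hB0
  have hpE : 0 ≤ ((p - 1 : ℕ) : ℝ) ^ 2 * E := by positivity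
  have hK6 : 6 * K < d := by
    have : (6 : ℝ) * K < d := by linarith
    exact_mod_cast this
  have hK1 : 1 ≤ K := by
    have : (0 : ℝ) < K := lt_trans (by positivity) hK
    exact_mod_cast this
  obtain ⟨𝓢, rfl, h𝓢⟩ := hC d (by lia) 𝓕 h𝓕
  have hdiag := hB β hβ hββ₀ K hK s t
  have hchar : ∀ χ₁ χ₂ : AddChar (ZMod p) ℂ, χ₁ ≠ 1 → χ₂ ≠ 1 →
      ‖average (𝓢 : Set (FormPair F)) (fun f => charSum s K β f χ₁ * charSum t K β f χ₂) -
      (2 * (if χ₁ = χ₂ then 1 else 0) + 2 * (if χ₁ * χ₂ = 1 then 1 else 0)) *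
        (diagonalSum s t K β : ℂ)‖ ≤ E := by
    intro χ₁ χ₂ h₁ h₂
    refine (norm_average_charSum_mul_sub_le hp h𝓢 hw hK6.le s t β h₁ h₂).trans ?_
    rw [hE]
    gcongr
    · exact Finset.sum_nonneg fun j _ => hw0 _
    · exact hW' K
  constructor
  · intro h₁ hh₁ h₂ hh₂
    rw [Finset.mem_Icc] at hh₁ hh₂
    have hn : ∀ h : ℕ, 1 ≤ h → h < p → ψ ^ h ≠ 1 := by
      intro h h1 h2 h3
      rw [pow_eq_one_iff_dvd_of_ne_one hψ] at h3
      have := Nat.le_of_dvd h1 h3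
      lia
    have key := hchar _ _ (hn h₁ (by lia) (by lia)) (hn h₂ (by lia) (by lia))
    -- Since 2 ≤ h₁ + h₂ ≤ p - 1, the product is never trivial; only the multiplicity 2 for h₁ = h₂
    -- remains and turns 1/(2π²) into 1/π².
    rw [if_neg (c := ψ ^ h₁ * ψ ^ h₂ = 1) (by
      rw [← pow_add]
      exact hn _ (by lia) (by lia)), mul_zero, add_zero] at key
    split_ifs with h
    · rw [if_pos (congrArg _ h)] at key
      have := norm_sub_ofReal_le_of_norm_sub_mul_le (a := 2) (by norm_num) (by norm_num) key hdiag
      rw [show (2 : ℝ) * (1 / (2 * Real.pi ^ 2) * Real.log (K * β)) =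
        1 / Real.pi ^ 2 * Real.log (K * β) by ring] at this
      linarith
    · rw [if_neg, mul_zero, zero_mul] at key
      · linarith
      · rw [pow_eq_pow_iff_modEq_of_ne_one hψ]
        exact fun h' => h (Nat.ModEq.eq_of_lt_of_lt h' (by lia) (by lia))
  · have := norm_sub_ofReal_le_of_norm_sub_mul_le (a := 4 * ((p : ℝ) - 1)) (by push_cast; ring)
      (by linarith) (norm_average_curveSum_mul_sub_le hψ hchar) hdiag
    rw [show (4 * ((p : ℝ) - 1)) * (1 / (2 * Real.pi ^ 2) * Real.log (K * β)) =
      2 * ((p : ℝ) - 1) / Real.pi ^ 2 * Real.log (K * β) by ring] at this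
    linarith
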